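/- All graphs are finite, simple, undirected and connected; $n$ and $m$ denote the numbers of vertices and edges. A graph is chordal if it has no induced cycle of length greater than $3$. A vertex order of $G=(V,E)$ is a linear order $\sigma=(v_1,\dots,v_n)$ of $V$. **Searches.** Consider the following searches with start vertex $s$. The vertex $s$ initially has a one-element label, all other vertices have the empty label. In step $i=1,\dots,n$ an unvisited vertex with lexicographically largest label (a proper prefix being smaller) is visited, becomes the $i$-th vertex of the order, and the label of each of its unvisited neighbours is updated. * LexDFS: the initial label of $s$ is $(0)$, and $i$ is prepended to the label. * LexBFS: the initial label of $s$ is $(n)$, and $n-i$ is appended to the label. * DFS: the initial label of $s$ is $(0)$, and the label is replaced by $(i)$ (the last visited neighbour decides; this is the search with a stack). * BFS: the initial label of $s$ is $(n)$, and the label is replaced by $(n-i)$ if it was empty and is unchanged otherwise (the first visited neighbour decides; this is the search with a queue). For a vertex order $\rho$, the searches LexDFS$^+(\rho)$, LexBFS$^+(\rho)$ and DFS$^+(\rho)$ choose, in each step, among the unvisited vertices with largest label the one that is rightmost in $\rho$; so each of them yields a unique order. The *last-in tree* of a search order $\pi$ is the tree on $V$, rooted at the first vertex of $\pi$, in which each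 other vertex $v$ is joined to its parent, the rightmost in $\pi$ among the neighbours of $v$ to the left of $v$. **Ordering$(G,T,s,\rho)$**, for a spanning tree $T$ of $G$ rooted at $s$ and a vertex order $\rho$ ending in $s$: 1. Let $\beta$ be the reverse of a BFS order of $T$ starting at $s$ (ties broken arbitrarily). 2. Start with the ordered partition $\mathcal Q=(V)$. For $i=1,\dots,n$ let $v=\beta(i)$, let $S$ be the set of neighbours of $v$ in $G$ that are to the left of $v$ in $\beta$, and replace each class $Q$ of $\mathcal Q$ for which $Q\cap S$ and $Q\setminus S$ are both non-empty by the two classes $Q\cap S,\ Q\setminus S$, in this order. 3. Move the class $\{s\}$ to the leftmost position, order each class by the reverse of $\rho$, and let $\tau$ be the reverse of the resulting vertex order. 4. Return the DFS$^+(\tau)$ order $\sigma$ of the tree $T$, with start vertex $s$. **Algorithm.** Input: a connected chordal graph $G$, a vertex $s$, and a vertex order $\rho$ ending in $s$. Let $\pi$ be the LexBFS$^+(\rho)$ order of $G$ with start vertex $s$, let $T$ be the last-in tree of $\pi$, and return $\sigma=$ Ordering$(G,T,s,\rho)$. **Theorem.** Let $G$ be a connected chordal graph, $s$ a vertex of $G$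 and $\rho$ a vertex order of $G$ that ends in $s$. Then the algorithm has a run on the input $(G,s,\rho)$, and the result $\sigma$ of every run (that is, for every choice of the BFS order in step 1 of Ordering) is the LexDFS$^+(\rho)$ order of $G$ with start vertex $s$; in particular $\sigma$ is a vertex order of $G$ that starts at $s$. Moreover, the algorithm can be carried out in time $O(n+m)$: there are a constant $c$ and a single program for a random access machine (with variables and arrays of natural numbers, whose unit-cost operations are loading a constant or a variable, reading and writing an array cell, assignment, adding or subtracting $1$, and comparison) which, for every such input, given by $n$, $s$, $\rho$ and the adjacency lists of $G$ in arbitrary order, for an arbitrary numbering of the vertices by $0,\dots,n-1$, halts after at most $c\,(n+m)$ units of time and leaves in its memory the orders $\pi$, $\beta$, $\tau$, $\sigma$ and the parent function of $T$ of a run of the algorithm on this input. -/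

import Mathlib

/-! ### Vertex orders and graph searches -/

/-- A linear order of the vertex set, written as the list of all vertices from left to right. -/
def IsVertexOrder {V : Type*} (σ : List V) : Prop :=
  σ.Nodup ∧ ∀ v, v ∈ σ

/-- A graph is chordal if it has no induced cycle of length larger than `3`. -/
def IsChordal {V : Type*} (G : SimpleGraph V) : Prop :=
  ∀ k : ℕ, 3 < k → IsEmpty (SimpleGraph.cycleGraph k ↪g G)

/-- The vertices to the left of `v` in the order `σ`, from left to right. -/
def leftOf {V : Type*} [DecidableEq V] (σ : List V) (v : V) : List V :=
  σ.takeWhile (fun w => w ≠ v)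

/-- A labelling rule for graph searches on `n` vertices. The start vertex gets the label `start n`,
the other vertices get the empty label, and when the `i`-th vertex of the search is visited
(`i = 1, …, n`), the label `l` of each of its unvisited neighbours is replaced by `update n i l`.
The next vertex is always one with lexicographically largest label. -/
structure SearchRule where
  start : ℕ → List ℕ
  update : ℕ → ℕ → List ℕ → List ℕ

/-- Lexicographic depth first search: prepend `i`. -/
def lexDFS : SearchRule where
  start _ := [0]
  update _ i l := i :: l

/-- Lexicographic breadth first search: append `n - i`. -/
def lexBFS : SearchRule where
  start n := [n]
  update n i l := l ++ [n - i]

/-- Depth first search: only the most recently visited neighbour counts. (The vertices seen but not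
yet visited are kept on a stack, and a vertex that is seen again is moved to the top.) -/
def dfs : SearchRule where
  start _ := [0]
  update _ i _ := [i]

/-- Breadth first search: only the first visited neighbour counts. (The vertices seen but not
yet visited are kept in a queue.) -/
def bfs : SearchRule where
  start n := [n]
  update n i l := if l = [] then [n - i] else l

namespace SearchRule

variable {V : Type*} [Fintype V] [DecidableEq V]

/-- The label of the unvisited vertex `w` in a search with start vertex `s`, after the vertices in
the list `visited` have been visited in this order. -/
def label (R : SearchRule) (G : SimpleGraph V) [DecidableRel G.Adj] (s : V)
    (visited : List V) (w : V) : List ℕ :=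
  (visited.zipIdx 1).foldl
    (fun l p => if G.Adj p.1 w then R.update (Fintype.card V) p.2 l else l)
    (if w = s then R.start (Fintype.card V) else [])

/-- `σ` is a possible result of the search with start vertex `s`: each vertex of `σ` has, when it is
visited, a lexicographically largest label among the unvisited vertices. -/
def IsSearchOrder (R : SearchRule) (G : SimpleGraph V) [DecidableRel G.Adj] (s : V)
    (σ : List V) : Prop :=
  IsVertexOrder σ ∧ ∀ (visited : List V) (v : V) (rest : List V), σ = visited ++ v :: rest →
    ∀ w ∈ rest, R.label G s visited w ≤ R.label G s visited v

/-- The first `k` vertices of the search with start vertex `s` in which, among the unvisited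
vertices with lexicographically largest label, the rightmost one with respect to `ρ` is chosen.
(Among several maximal elements `List.argmax` returns the first one in the list.) -/
def plusPrefix (R : SearchRule) (G : SimpleGraph V) [DecidableRel G.Adj] (s : V) (ρ : List V) :
    ℕ → List V
  | 0 => []
  | k + 1 =>
    let visited := R.plusPrefix G s ρ k
    visited ++
      ((ρ.reverse.filter (fun w => w ∉ visited)).argmax (R.label G s visited)).toList

/-- The order computed by the search with start vertex `s` in which ties are broken by taking the
rightmost candidate with respect to `ρ`. -/
def plus (R : SearchRule) (G : SimpleGraph V) [DecidableRel G.Adj] (s : V) (ρ : List V) : List V :=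
  R.plusPrefix G s ρ (Fintype.card V)

end SearchRule

/-! ### Last-in trees and the ordering procedure -/

section Ordering

variable {V : Type*} [DecidableEq V]

/-- The parent of `v` in the last-in tree of `σ`: the rightmost neighbour of `v` to the left of `v`,
if there is one. -/
def lastInParent (G : SimpleGraph V) [DecidableRel G.Adj] (σ : List V) (v : V) : Option V :=
  (leftOf σ v).reverse.find? (fun w => G.Adj v w)

theorem lastInParent_ne_self (G : SimpleGraph V) [DecidableRel G.Adj] (σ : List V) (v : V) :
    lastInParent G σ v ≠ some v := by
  intro h
  have := List.find?_some h
  simp at this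

/-- The last-in tree of `σ`: each vertex is joined to its parent. -/
def lastInTree (G : SimpleGraph V) [DecidableRel G.Adj] (σ : List V) : SimpleGraph V where
  Adj u v := lastInParent G σ u = some v ∨ lastInParent G σ v = some u
  symm := ⟨fun _ _ h => h.symm⟩
  loopless := ⟨fun v h => h.elim (lastInParent_ne_self G σ v) (lastInParent_ne_self G σ v)⟩

instance (G : SimpleGraph V) [DecidableRel G.Adj] (σ : List V) :
    DecidableRel (lastInTree G σ).Adj :=
  fun u v => inferInstanceAs (Decidable (lastInParent G σ u = some v ∨ lastInParent G σ v = some u))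

/-- Refinement of the ordered partition `Q` with the set `S`: each class `q` with `q ∩ S` and
`q \ S` both non-empty is replaced by these two classes, in this order. -/
def refinePartition (Q : List (Finset V)) (S : Finset V) : List (Finset V) :=
  Q.flatMap fun q => if (q ∩ S).Nonempty ∧ (q \ S).Nonempty then [q ∩ S, q \ S] else [q]

/-- The final ordered partition of the loop of the ordering procedure: start with the single class
of all vertices and go through `β` from left to right, refining for each vertex `v` with the set of
the neighbours of `v` that are to the left of `v` in `β`. -/
def orderingPartition [Fintype V] (G : SimpleGraph V) [DecidableRel G.Adj] (β : List V) :
    List (Finset V) :=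
  β.foldl (fun Q v => refinePartition Q ((leftOf β v).filter (fun w => G.Adj v w)).toFinset)
    [Finset.univ]

/-- The tie-break order of the ordering procedure: move `{s}` to the leftmost position of the
partition, order every class with respect to the reverse of `ρ`, and reverse the resulting vertex
order. -/
def orderingTieBreak [Fintype V] (G : SimpleGraph V) [DecidableRel G.Adj] (s : V)
    (ρ β : List V) : List V :=
  ((({s} : Finset V) :: (orderingPartition G β).erase {s}).flatMap
    fun q => ρ.reverse.filter (fun v => v ∈ q)).reverse

end Ordering

/-! ### The algorithm -/

/-- A valid input of the algorithm: a connected chordal graph `G`, a vertex `s`, and a vertex order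
`ρ` that ends with `s`. -/
structure IsValidInput {V : Type*} (G : SimpleGraph V) (s : V) (ρ : List V) : Prop where
  connected : G.Connected
  chordal : IsChordal G
  order : IsVertexOrder ρ
  last : ρ.getLast? = some s

/-- `(π, β, τ, σ)` are the vertex orders of a run of the algorithm on `(G, s, ρ)`. The result of the
run is `σ`. There may be several runs, since `β` is the reverse of an arbitrary breadth first search
order of the last-in tree of `π`. -/
structure IsRun {V : Type*} [Fintype V] [DecidableEq V] (G : SimpleGraph V) [DecidableRel G.Adj]
    (s : V) (ρ π β τ σ : List V) : Prop where
  pi_eq : π = lexBFS.plus G s ρ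
  beta_bfs : bfs.IsSearchOrder (lastInTree G π) s β.reverse
  tau_eq : τ = orderingTieBreak G s ρ β
  sigma_eq : σ = dfs.plus (lastInTree G π) s τ

/-! ### Random access machines

A machine has variables and arrays, indexed by natural numbers, that hold natural numbers. A program
mentions only finitely many of them. The elementary operations are to load a constant or a variable,
to read or write an array cell, to assign a variable, to add or subtract `1`, and to compare two
numbers; each of them costs one unit of time. -/

namespace RAM

structure Store where
  var : ℕ → ℕ
  arr : ℕ → ℕ → ℕ

inductive Expr where
  | const (k : ℕ)
  | var (x : ℕ)
  | read (a : ℕ) (i : Expr)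
  | succ (e : Expr)
  | pred (e : Expr)

namespace Expr

def eval (st : Store) : Expr → ℕ
  | const k => k
  | var x => st.var x
  | read a i => st.arr a (i.eval st)
  | succ e => e.eval st + 1
  | pred e => e.eval st - 1

def cost : Expr → ℕ
  | const _ => 1
  | var _ => 1
  | read _ i => i.cost + 1
  | succ e => e.cost + 1
  | pred e => e.cost + 1

end Expr

inductive Test where
  | lt (e f : Expr)
  | eq (e f : Expr)
  | not (b : Test)
  | and (b c : Test)

namespace Test

def Holds (st : Store) : Test → Prop
  | lt e f => e.eval st < f.eval st
  | eq e f => e.eval st = f.eval st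
  | not b => ¬ b.Holds st
  | and b c => b.Holds st ∧ c.Holds st

def cost : Test → ℕ
  | lt e f => e.cost + f.cost + 1
  | eq e f => e.cost + f.cost + 1
  | not b => b.cost + 1
  | and b c => b.cost + c.cost + 1

end Test

inductive Prog where
  | skip
  | assign (x : ℕ) (e : Expr)
  | write (a : ℕ) (i e : Expr)
  | seq (p q : Prog)
  | ite (b : Test) (p q : Prog)
  | loop (b : Test) (p : Prog)

/-- `Runs p st t st'`: started in `st`, the program `p` halts after `t` units of time in `st'`. -/
inductive Runs : Prog → Store → ℕ → Store → Prop where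
  | skip (st : Store) : Runs Prog.skip st 1 st
  | assign (x : ℕ) (e : Expr) (st : Store) :
      Runs (Prog.assign x e) st (e.cost + 1)
        { st with var := Function.update st.var x (e.eval st) }
  | write (a : ℕ) (i e : Expr) (st : Store) :
      Runs (Prog.write a i e) st (i.cost + e.cost + 1)
        { st with
          arr := Function.update st.arr a
            (Function.update (st.arr a) (i.eval st) (e.eval st)) }
  | seq {p q : Prog} {st st' st'' : Store} {t t' : ℕ} :
      Runs p st t st' → Runs q st' t' st'' → Runs (Prog.seq p q) st (t + t') st''
  | ite_true {b : Test} {p q : Prog} {st st' : Store} {t : ℕ} :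
      b.Holds st → Runs p st t st' → Runs (Prog.ite b p q) st (b.cost + t) st'
  | ite_false {b : Test} {p q : Prog} {st st' : Store} {t : ℕ} :
      ¬ b.Holds st → Runs q st t st' → Runs (Prog.ite b p q) st (b.cost + t) st'
  | loop_true {b : Test} {p : Prog} {st st' st'' : Store} {t t' : ℕ} :
      b.Holds st → Runs p st t st' → Runs (Prog.loop b p) st' t' st'' →
        Runs (Prog.loop b p) st (b.cost + t + t') st''
  | loop_false {b : Test} {p : Prog} {st : Store} :
      ¬ b.Holds st → Runs (Prog.loop b p) st b.cost st

variable {V : Type*} [Fintype V]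

/-- Array `a` holds the list `l` of vertices, where the vertices are numbered by `e`. -/
def HoldsList (e : V ≃ Fin (Fintype.card V)) (st : Store) (a : ℕ) (l : List V) : Prop :=
  ∀ (i : ℕ) (h : i < l.length), st.arr a i = (e l[i] : ℕ)

/-- The store holds the input `(G, s, ρ)`, where the vertices are numbered `0, …, n - 1` by `e`:
variable `0` holds `n`, variable `1` holds the number of `s`, array `0` holds `ρ`, and the adjacency
lists (in arbitrary order) are stored one after the other in array `2`, where the list of the vertex
number `i` occupies the cells from `arr 1 i` to `arr 1 (i + 1) - 1`. The rest of the store is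
arbitrary. -/
structure HoldsInput (G : SimpleGraph V) (s : V) (ρ : List V) (e : V ≃ Fin (Fintype.card V))
    (st : Store) : Prop where
  size : st.var 0 = Fintype.card V
  start : st.var 1 = (e s : ℕ)
  order : HoldsList e st 0 ρ
  first : st.arr 1 0 = 0
  adj : ∀ v : V, ∃ N : List V, N.Nodup ∧ (∀ w, w ∈ N ↔ G.Adj v w) ∧
    st.arr 1 ((e v : ℕ) + 1) = st.arr 1 (e v) + N.length ∧
    ∀ (k : ℕ) (h : k < N.length), st.arr 2 (st.arr 1 (e v) + k) = (e N[k] : ℕ)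

/-- The store holds the run `(π, β, τ, σ)` of the algorithm: array `3` holds `π`, array `4` holds the
parents in the last-in tree of `π`, and arrays `5`, `6`, `7` hold `β`, `τ`, `σ`. -/
structure HoldsRun [DecidableEq V] (G : SimpleGraph V) [DecidableRel G.Adj] (π β τ σ : List V)
    (e : V ≃ Fin (Fintype.card V)) (st : Store) : Prop where
  pi : HoldsList e st 3 π
  parent : ∀ v w : V, lastInParent G π v = some w → st.arr 4 (e v) = (e w : ℕ)
  beta : HoldsList e st 5 β
  tau : HoldsList e st 6 τ
  sigma : HoldsList e st 7 σ

end RAM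

/-!
The key fact is that on a connected chordal graph the order `π = LexBFS⁺(ρ)` is the reverse of a
perfect elimination order: the neighbours of a vertex to its left are pairwise adjacent
(`adj_of_adj_of_lexBFS`). Everything else uses `π` only through the structure `IsCliqueOrder`, which
records this fact and the effect of the tie-breaking rule. If `q` is the parent of `v` in the last-in
tree `T`, then every other left neighbour of `v` is a left neighbour of `q`
(`IsCliqueOrder.eq_or_adj_parent`). So adjacent vertices of `G` are comparable in `T`, and each order
of the vertices in which parents precede their children arranges adjacent vertices in the same way
as `π` (`IsCliqueOrder.idxOf_lt_iff`).

*The ordering procedure.* Its partition refinement sorts the vertices lexicographically by their sets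
of left neighbours, read along `β`, with ties broken by `ρ` (`TieBreakLT`). This is a strict order,
so the resulting list `s :: W`, the reverse of `τ`, is determined by it (`IsTieBreakOrder.eq`,
`IsCliqueOrder.exists_orderingTieBreak_eq`).

*Correctness.* Insert the vertices of `τ`, one after the other, directly after their parents
(`treeOrder`). The list `L` obtained is the `DFS⁺(τ)` order of `T` (`IsCliqueOrder.dfs_plus_eq`). It
is also the `LexDFS⁺(ρ)` order of `G` (`IsCliqueOrder.lexDFS_plus_eq`). For the latter, let `v` be
the next vertex of `L`, let `w` be another unvisited vertex, and let `c` be the first unvisited vertex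
on the path of `T` from `s` to `w`. The visited neighbours of `w` are neighbours of `c`, so the label
of `c` is at least that of `w`, and if the labels are equal and `c ≠ w`, then `c` is to the right of
`w` in `ρ` because of the tie-breaking rule of `π`. It remains to compare `c` with `v ≠ c`. Both are
children of visited vertices. If their parents differ, then the parent of `v` is visited later and is
not a neighbour of `c`, so it makes the label of `v` larger. If they have the same parent, then `c`
precedes `v` in `τ`, and the left neighbours of both lie in the clique formed by the parent and its
left neighbours. On this clique `β` agrees with the reverse of `L`, so the lexicographic comparison
that defines `τ` is the comparison of the LexDFS labels.

*Running time.* The program `RAM.mainProg` first sorts all adjacency lists by `ρ` simultaneously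
(`RAM.sortAdj`). The partitions of LexBFS and of the ordering procedure are kept in one doubly linked
list. A vertex is moved by placing it before the first vertex of its class; since the sorted
adjacency lists move the vertices in the order of the list, each class remains sorted by `ρ`
(`IsRefined.move`), and a refinement takes time proportional to the degree of the vertex
(`RAM.runsWithin_refine`). LexBFS repeatedly removes the first vertex of the list, so the
tie-breaking costs nothing (`RAM.runsWithin_lexBFSLoop`). The order `β` is produced by a queue
(`exists_queue_order`), and the insertions that give `σ` are insertions into a linked list
(`RAM.dfsTree`). Since the degrees sum to `2m` (`RAM.IsAdjLists.sum_length`), every phase is linear.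
-/

/-! ### Lexicographic comparison along a list -/

/-- `LexGT D A B`: the sets `A` and `B` differ on the list `D`, and the first element of `D` on which
they differ belongs to `A`. -/
def LexGT {α : Type*} : List α → (α → Prop) → (α → Prop) → Prop
  | [], _, _ => False
  | u :: D, A, B => (A u ∧ ¬ B u) ∨ ((A u ↔ B u) ∧ LexGT D A B)

section LexGT

variable {α : Type*}

theorem LexGT.congr {D : List α} {A A' B B' : α → Prop} (hA : ∀ u ∈ D, A u ↔ A' u)
    (hB : ∀ u ∈ D, B u ↔ B' u) (h : LexGT D A B) : LexGT D A' B' := by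
  induction D with
  | nil => exact h
  | cons u D ih =>
    simp only [LexGT, List.mem_cons, forall_eq_or_imp] at *
    rw [← hA.1, ← hB.1]
    exact h.imp_right fun h => ⟨h.1, ih hA.2 hB.2 h.2⟩

theorem lexGT_append_singleton {D : List α} {u : α} {A B : α → Prop} :
    LexGT (D ++ [u]) A B ↔ LexGT D A B ∨ ((∀ d ∈ D, A d ↔ B d) ∧ A u ∧ ¬ B u) := by
  induction D with
  | nil => simp [LexGT]
  | cons d D ih =>
    simp only [List.cons_append, LexGT, ih, List.mem_cons, forall_eq_or_imp]
    tauto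

theorem lexGT_iff {D : List α} {A B : α → Prop} :
    LexGT D A B ↔ ∃ D₁ u D₂, D = D₁ ++ u :: D₂ ∧ A u ∧ ¬ B u ∧ ∀ x ∈ D₁, A x ↔ B x := by
  constructor
  · intro h
    induction D with
    | nil => exact h.elim
    | cons d D ih =>
      rcases h with ⟨h1, h2⟩ | ⟨h1, h2⟩
      · exact ⟨[], d, D, rfl, h1, h2, by simp⟩
      · obtain ⟨D₁, u, D₂, rfl, h3, h4, h5⟩ := ih h2
        exact ⟨d :: D₁, u, D₂, rfl, h3, h4, by simpa using ⟨h1, h5⟩⟩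
  · rintro ⟨D₁, u, D₂, rfl, h3, h4, h5⟩
    induction D₁ with
    | nil => exact Or.inl ⟨h3, h4⟩
    | cons d D₁ ih =>
      simp only [List.mem_cons, forall_eq_or_imp] at h5
      exact Or.inr ⟨h5.1, ih h5.2⟩

theorem lexGT_trichotomy (D : List α) (A B : α → Prop) :
    LexGT D A B ∨ LexGT D B A ∨ ∀ u ∈ D, A u ↔ B u := by
  induction D with
  | nil => simp
  | cons u D ih =>
    simp only [LexGT, List.mem_cons, forall_eq_or_imp]
    tauto

theorem LexGT.asymm {D : List α} {A B : α → Prop} (h : LexGT D A B) : ¬ LexGT D B A := by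
  induction D with
  | nil => exact h.elim
  | cons u D ih =>
    simp only [LexGT] at *
    tauto

theorem LexGT.not_forall_iff {D : List α} {A B : α → Prop} (h : LexGT D A B) :
    ¬ ∀ u ∈ D, A u ↔ B u := by
  intro h'
  exact (h.congr h' fun u hu => (h' u hu).symm).asymm h

/-- Decreasing sequences of numbers that are indexed by sets compare lexicographically like the
sets. -/
theorem LexGT.map_filter_lt {D : List (α × ℕ)} (hD : D.Pairwise fun a b => b.2 < a.2)
    {A B : α → Prop} [DecidablePred A] [DecidablePred B] (h : LexGT (D.map Prod.fst) A B)
    (l : List ℕ) (hl : ∀ x ∈ l, ∀ a ∈ D, x < a.2) :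
    (D.filter fun a => B a.1).map Prod.snd ++ l < (D.filter fun a => A a.1).map Prod.snd ++ l := by
  induction D with
  | nil => exact h.elim
  | cons a D ih =>
    rw [List.pairwise_cons] at hD
    rcases h with ⟨h1, h2⟩ | ⟨h1, h2⟩
    · rw [List.filter_cons_of_neg (by simpa using h2), List.filter_cons_of_pos (by simpa using h1)]
      rcases hb : (D.filter fun a => B a.1).map Prod.snd ++ l with _ | ⟨x, t⟩
      · exact List.nil_lt_cons _ _
      · refine List.Lex.rel ?_
        have : x ∈ (D.filter fun a => B a.1).map Prod.snd ++ l := by simp [hb]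
        simp only [List.mem_append, List.mem_map] at this
        rcases this with ⟨b, hbD, rfl⟩ | hx
        · exact hD.1 b (List.mem_of_mem_filter hbD)
        · exact hl x hx a (by simp)
    · have := ih hD.2 h2 fun x hx b hb => hl x hx b (by simp [hb])
      by_cases hA : A a.1
      · rw [List.filter_cons_of_pos (by simpa using h1.1 hA),
          List.filter_cons_of_pos (by simpa using hA)]
        exact List.Lex.cons this
      · rw [List.filter_cons_of_neg (by simpa [← h1] using hA),
          List.filter_cons_of_neg (by simpa using hA)]
        exact this

end LexGT

/-! ### Positions in vertex orders -/

theorem IsVertexOrder.reverse {V : Type*} {σ : List V} (h : IsVertexOrder σ) :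
    IsVertexOrder σ.reverse :=
  ⟨List.nodup_reverse.2 h.1, fun v => List.mem_reverse.2 (h.2 v)⟩

section Positions

variable {V : Type*} [DecidableEq V]

theorem idxOf_lt_of_append {A B : List V} {v u : V} (hv : v ∉ A) (hu : u ∈ A) :
    (A ++ v :: B).idxOf u < (A ++ v :: B).idxOf v := by
  rw [List.idxOf_append_of_mem hu, List.idxOf_append_of_notMem hv]
  have := List.idxOf_lt_length_of_mem hu
  omega

theorem mem_of_idxOf_lt_append {A B : List V} {v u : V}
    (h : (A ++ v :: B).idxOf u < (A ++ v :: B).idxOf v) : u ∈ A := by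
  by_contra hu
  rw [List.idxOf_append_of_notMem hu] at h
  by_cases hv : v ∈ A
  · rw [List.idxOf_append_of_mem hv] at h
    have := List.idxOf_lt_length_of_mem hv
    omega
  · rw [List.idxOf_append_of_notMem hv] at h
    simp at h

theorem IsVertexOrder.idxOf_inj {σ : List V} (h : IsVertexOrder σ) {u v : V} :
    σ.idxOf u = σ.idxOf v ↔ u = v :=
  List.idxOf_inj (h.2 u)

theorem IsVertexOrder.exists_split {σ : List V} (h : IsVertexOrder σ) (v : V) :
    ∃ A B, σ = A ++ v :: B ∧ v ∉ A ∧ v ∉ B ∧ (∀ u, u ∈ A ↔ σ.idxOf u < σ.idxOf v) ∧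
      ∀ u, u ∈ B ↔ σ.idxOf v < σ.idxOf u := by
  obtain ⟨A, B, rfl⟩ := List.append_of_mem (h.2 v)
  have hn := h.1
  simp only [List.nodup_append, List.nodup_cons, List.mem_cons, ne_eq] at hn
  have hvA : v ∉ A := fun hv => hn.2.2 v hv v (Or.inl rfl) rfl
  have hA : ∀ u, u ∈ A ↔ (A ++ v :: B).idxOf u < (A ++ v :: B).idxOf v :=
    fun u => ⟨idxOf_lt_of_append hvA, mem_of_idxOf_lt_append⟩
  refine ⟨A, B, rfl, hvA, hn.2.1.1, hA, fun u => ⟨fun hu => ?_, fun hu => ?_⟩⟩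
  · have h1 : u ∉ A := fun h' => hn.2.2 u h' u (Or.inr hu) rfl
    have h2 : u ≠ v := by rintro rfl; exact hn.2.1.1 hu
    have h3 := mt (hA u).2 h1
    have h4 := mt h.idxOf_inj.1 h2
    omega
  · have h1 := h.2 u
    simp only [List.mem_append, List.mem_cons] at h1
    rcases h1 with h1 | rfl | h1
    · have := (hA u).1 h1; omega
    · omega
    · exact h1

theorem IsVertexOrder.mem_left {A B : List V} {v : V} (h : IsVertexOrder (A ++ v :: B)) {u : V} :
    u ∈ A ↔ (A ++ v :: B).idxOf u < (A ++ v :: B).idxOf v := by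
  refine ⟨idxOf_lt_of_append ?_, mem_of_idxOf_lt_append⟩
  have hn := h.1
  simp only [List.nodup_append, List.nodup_cons, List.mem_cons, ne_eq] at hn
  exact fun hv => hn.2.2 v hv v (Or.inl rfl) rfl

theorem IsVertexOrder.mem_right {A B : List V} {v : V} (h : IsVertexOrder (A ++ v :: B)) {u : V} :
    u ∈ B ↔ (A ++ v :: B).idxOf v < (A ++ v :: B).idxOf u := by
  have hn := h.1
  simp only [List.nodup_append, List.nodup_cons, List.mem_cons, ne_eq] at hn
  constructor
  · intro hu
    have h1 : u ∉ A := fun h' => hn.2.2 u h' u (Or.inr hu) rfl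
    have h2 : u ≠ v := by rintro rfl; exact hn.2.1.1 hu
    have h3 := mt h.mem_left.2 h1
    have h4 := mt h.idxOf_inj.1 h2
    omega
  · intro hu
    have h1 := h.2 u
    simp only [List.mem_append, List.mem_cons] at h1
    rcases h1 with h1 | rfl | h1
    · have := h.mem_left.1 h1; omega
    · omega
    · exact h1

theorem IsVertexOrder.idxOf_reverse_lt {σ : List V} (h : IsVertexOrder σ) {u v : V} :
    σ.reverse.idxOf u < σ.reverse.idxOf v ↔ σ.idxOf v < σ.idxOf u := by
  obtain ⟨A, B, rfl⟩ := List.append_of_mem (h.2 v)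
  have h' := h.reverse
  rw [← h.mem_right]
  simp only [List.reverse_append, List.reverse_cons, List.append_assoc, List.cons_append,
    List.nil_append] at h' ⊢
  rw [← h'.mem_left, List.mem_reverse]

theorem IsVertexOrder.length_eq [Fintype V] {σ : List V} (h : IsVertexOrder σ) :
    σ.length = Fintype.card V := by
  rw [← List.toFinset_card_of_nodup h.1, ← Finset.card_univ]
  congr 1
  ext v
  simpa using h.2 v

/-- In a list without repetitions, positions in a sublist compare as in the list. -/
theorem List.Nodup.idxOf_filter_le {l : List V} (hl : l.Nodup) {P : V → Prop} [DecidablePred P]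
    {u v : V} (hu : u ∈ l.filter P) (hv : v ∈ l.filter P) :
    (l.filter P).idxOf u ≤ (l.filter P).idxOf v ↔ l.idxOf u ≤ l.idxOf v := by
  induction l with
  | nil => simp at hu
  | cons a l ih =>
    rw [List.nodup_cons] at hl
    by_cases ha : P a
    · rw [List.filter_cons_of_pos (by simpa using ha)] at hu hv ⊢
      by_cases h1 : a = u
      · simp [h1]
      · by_cases h2 : a = v
        · subst h2
          rw [List.idxOf_cons_ne _ h1, List.idxOf_cons_ne _ h1]
          simp
        · rw [List.idxOf_cons_ne _ h1, List.idxOf_cons_ne _ h1, List.idxOf_cons_ne _ h2,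
            List.idxOf_cons_ne _ h2]
          have := ih hl.2 ((List.mem_cons.1 hu).resolve_left (Ne.symm h1))
            ((List.mem_cons.1 hv).resolve_left (Ne.symm h2))
          omega
    · rw [List.filter_cons_of_neg (by simpa using ha)] at hu hv ⊢
      have h1 : a ≠ u := by
        rintro rfl
        exact hl.1 (List.mem_of_mem_filter hu)
      have h2 : a ≠ v := by
        rintro rfl
        exact hl.1 (List.mem_of_mem_filter hv)
      rw [List.idxOf_cons_ne _ h1, List.idxOf_cons_ne _ h2, ih hl.2 hu hv]
      omega

end Positions

/-! ### Graph searches -/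

theorem pairwise_snd_zipIdx {V : Type*} (vis : List V) (k : ℕ) :
    (vis.zipIdx k).Pairwise fun a b => a.2 < b.2 := by
  have := List.pairwise_lt_range' (s := k) (n := vis.length)
  rw [← List.zipIdx_map_snd k vis, List.pairwise_map] at this
  exact this

section Searches

variable {V : Type*} [DecidableEq V]

/-- Tie-breaking: the element chosen by `List.argmax` is the rightmost with respect to `ρ` among the
elements with maximal value. -/
theorem argmax_reverse_filter_eq_some {ρ : List V} (hρ : IsVertexOrder ρ) {β : Type*} [LinearOrder β]
    [hd : DecidableLT β] (vis : List V) (f : V → β) (v : V) :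
    (ρ.reverse.filter (fun w => w ∉ vis)).argmax f = some v ↔
      v ∉ vis ∧ ∀ w ∉ vis, f w < f v ∨ (f w = f v ∧ ρ.idxOf w ≤ ρ.idxOf v) := by
  obtain rfl : hd = LinearOrder.toDecidableLT := Subsingleton.elim _ _
  have hmem : ∀ w, w ∈ ρ.reverse.filter (fun w => w ∉ vis) ↔ w ∉ vis := fun w => by
    simp [hρ.2 w]
  rw [List.argmax_eq_some_iff, hmem]
  refine and_congr_right fun hv => ?_
  have hidx : ∀ w ∉ vis, ((ρ.reverse.filter (fun w => w ∉ vis)).idxOf v ≤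
      (ρ.reverse.filter (fun w => w ∉ vis)).idxOf w ↔ ρ.idxOf w ≤ ρ.idxOf v) := fun w hw => by
    rw [hρ.reverse.1.idxOf_filter_le ((hmem v).2 hv) ((hmem w).2 hw), ← not_lt,
      hρ.idxOf_reverse_lt, not_lt]
  constructor
  · rintro ⟨h1, h2⟩ w hw
    rcases (h1 w ((hmem w).2 hw)).lt_or_eq with h | h
    · exact Or.inl h
    · exact Or.inr ⟨h, (hidx w hw).1 (h2 w ((hmem w).2 hw) h.ge)⟩
  · intro h
    refine ⟨fun w hw => ?_, fun w hw hle => ?_⟩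
    · exact (h w ((hmem w).1 hw)).elim le_of_lt fun h => h.1.le
    · exact (hidx w ((hmem w).1 hw)).2
        ((h w ((hmem w).1 hw)).elim (fun h => absurd h hle.not_gt) fun h => h.2)

namespace SearchRule

variable [Fintype V] (R : SearchRule) (G : SimpleGraph V) [DecidableRel G.Adj] (s : V)

theorem label_append_singleton (vis : List V) (u w : V) :
    R.label G s (vis ++ [u]) w =
      if G.Adj u w then R.update (Fintype.card V) (vis.length + 1) (R.label G s vis w)
      else R.label G s vis w := by
  simp [label, List.zipIdx_append, List.foldl_append, add_comm]

theorem label_nil (w : V) :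
    R.label G s [] w = if w = s then R.start (Fintype.card V) else [] := by
  simp [label]

variable {R G s} {ρ : List V}

theorem plusPrefix_succ (k : ℕ) : R.plusPrefix G s ρ (k + 1) = R.plusPrefix G s ρ k ++
    ((ρ.reverse.filter (fun w => w ∉ R.plusPrefix G s ρ k)).argmax
      (R.label G s (R.plusPrefix G s ρ k))).toList := rfl

/-- A vertex order is the order of a search with tie-breaking if each of its vertices has the
largest label when it is visited, and is the rightmost vertex of `ρ` with this property. -/
theorem plus_eq_of_forall (hρ : IsVertexOrder ρ) {σ : List V} (hσ : IsVertexOrder σ)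
    (h : ∀ vis v rest, σ = vis ++ v :: rest → ∀ w ∈ rest, R.label G s vis w < R.label G s vis v ∨
      (R.label G s vis w = R.label G s vis v ∧ ρ.idxOf w ≤ ρ.idxOf v)) :
    R.plus G s ρ = σ := by
  have key : ∀ k ≤ σ.length, R.plusPrefix G s ρ k = σ.take k := by
    intro k
    induction k with
    | zero => simp [plusPrefix]
    | succ k ih =>
      intro hk
      have hs : σ = σ.take k ++ σ[k] :: σ.drop (k + 1) := by
        rw [← List.drop_eq_getElem_cons, List.take_append_drop]
      have hmax : (ρ.reverse.filter (fun w => w ∉ σ.take k)).argmax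
          (R.label G s (σ.take k)) = some σ[k] := by
        rw [argmax_reverse_filter_eq_some hρ]
        generalize hA : σ.take k = A at hs
        generalize σ.drop (k + 1) = B at hs
        generalize σ[k] = v at hs
        subst hs
        refine ⟨fun hv => lt_irrefl _ (hσ.mem_left.1 hv), fun w hw => ?_⟩
        have := hσ.2 w
        simp only [List.mem_append, List.mem_cons] at this
        rcases this with h1 | rfl | h1
        · exact absurd h1 hw
        · exact Or.inr ⟨rfl, le_rfl⟩
        · exact h _ _ _ rfl w h1
      rw [plusPrefix_succ, ih (by omega), hmax, List.take_succ_eq_append_getElem (by omega)]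
      rfl
  rw [plus, key _ hσ.length_eq.ge, List.take_of_length_le hσ.length_eq.le]

theorem plusPrefix_spec (hρ : IsVertexOrder ρ) (k : ℕ) (hk : k ≤ Fintype.card V) :
    (R.plusPrefix G s ρ k).Nodup ∧ (R.plusPrefix G s ρ k).length = k ∧
      ∀ vis v rest, R.plusPrefix G s ρ k = vis ++ v :: rest →
        (ρ.reverse.filter (fun w => w ∉ vis)).argmax (R.label G s vis) = some v := by
  induction k with
  | zero => simp [plusPrefix]
  | succ k ih =>
    obtain ⟨h1, h2, h3⟩ := ih (by omega)
    rw [plusPrefix_succ]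
    generalize R.plusPrefix G s ρ k = P at h1 h2 h3
    rcases hm : (ρ.reverse.filter (fun w => w ∉ P)).argmax (R.label G s P) with _ | v
    · rw [List.argmax_eq_none] at hm
      have : ∀ w, w ∈ P := fun w => by
        by_contra hw
        have : w ∈ ρ.reverse.filter (fun w => w ∉ P) := by simp [hρ.2 w, hw]
        rw [hm] at this
        simp at this
      have := IsVertexOrder.length_eq ⟨h1, this⟩
      omega
    · have hv := ((argmax_reverse_filter_eq_some hρ P _ v).1 hm).1
      refine ⟨?_, by simp [h2], fun vis u rest h => ?_⟩
      · simp only [Option.toList]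
        rw [List.nodup_append]
        exact ⟨h1, by simp, by rintro a ha b hb rfl; simp at hb; exact hv (hb ▸ ha)⟩
      · simp only [Option.toList] at h
        rcases List.eq_nil_or_concat rest with rfl | ⟨rest', x, rfl⟩
        · obtain ⟨rfl, h'⟩ := List.append_inj' h rfl
          obtain rfl : v = u := by simpa using h'
          exact hm
        · rw [List.concat_eq_append, ← List.cons_append, ← List.append_assoc] at h
          exact h3 _ _ _ (List.append_inj' h rfl).1

theorem plus_isVertexOrder (hρ : IsVertexOrder ρ) : IsVertexOrder (R.plus G s ρ) := by
  obtain ⟨h1, h2, -⟩ := plusPrefix_spec (R := R) (G := G) (s := s) hρ _ le_rfl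
  refine ⟨h1, fun v => ?_⟩
  have : (R.plusPrefix G s ρ (Fintype.card V)).toFinset = Finset.univ := by
    rw [← Finset.card_eq_iff_eq_univ, List.toFinset_card_of_nodup h1, h2]
  rw [plus, ← List.mem_toFinset, this]
  exact Finset.mem_univ v

theorem plus_split (hρ : IsVertexOrder ρ) {vis rest : List V} {v : V}
    (h : R.plus G s ρ = vis ++ v :: rest) :
    ∀ w ∉ vis, R.label G s vis w < R.label G s vis v ∨
      (R.label G s vis w = R.label G s vis v ∧ ρ.idxOf w ≤ ρ.idxOf v) :=
  ((argmax_reverse_filter_eq_some hρ _ _ _).1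
    ((plusPrefix_spec hρ _ le_rfl).2.2 _ _ _ h)).2

theorem plus_isSearchOrder (hρ : IsVertexOrder ρ) : R.IsSearchOrder G s (R.plus G s ρ) := by
  refine ⟨plus_isVertexOrder hρ, fun vis v rest h w hw => ?_⟩
  have hw' : w ∉ vis := fun hw' => by
    have := plus_isVertexOrder (R := R) (G := G) (s := s) hρ
    rw [h] at this
    have h1 := this.mem_left.1 hw'
    have h2 := this.mem_right.1 hw
    omega
  exact (plus_split hρ h w hw').elim le_of_lt fun h => h.1.le

/-- A search with a non-empty start label begins at the start vertex. -/
theorem IsSearchOrder.head_eq (h0 : R.start (Fintype.card V) ≠ []) {σ : List V}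
    (h : R.IsSearchOrder G s σ) {v : V} {rest : List V} (hσ : σ = v :: rest) : v = s := by
  by_contra hv
  have hs := h.1.2 s
  rw [hσ, List.mem_cons] at hs
  have := h.2 [] v rest hσ s (hs.resolve_left (Ne.symm hv))
  rw [label_nil, label_nil, if_pos rfl, if_neg hv] at this
  obtain ⟨a, l, hl⟩ := List.exists_cons_of_ne_nil h0
  rw [hl] at this
  exact this.not_gt (List.nil_lt_cons a l)

/-! ### Labels of the searches -/

theorem label_lexBFS (vis : List V) (w : V) :
    lexBFS.label G s vis w = (if w = s then [Fintype.card V] else []) ++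
      (((vis.zipIdx 1).map fun p => (p.1, Fintype.card V - p.2)).filter
        fun p => G.Adj p.1 w).map Prod.snd := by
  unfold label lexBFS
  simp only
  generalize (if w = s then [Fintype.card V] else []) = l
  generalize vis.zipIdx 1 = P
  induction P generalizing l with
  | nil => simp
  | cons p P ih =>
    by_cases hp : G.Adj p.1 w <;> simp [hp, ih]

theorem label_lexDFS (vis : List V) (w : V) :
    lexDFS.label G s vis w = (((vis.zipIdx 1).reverse.filter fun p => G.Adj p.1 w).map Prod.snd) ++
      (if w = s then [0] else []) := by
  unfold label lexDFS
  simp only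
  generalize (if w = s then [0] else []) = l
  generalize vis.zipIdx 1 = P
  induction P generalizing l with
  | nil => simp
  | cons p P ih =>
    by_cases hp : G.Adj p.1 w <;> simp [hp, ih, List.filter_append]

theorem label_lexDFS_lt (vis : List V) {x y : V} (hx : x ≠ s) (hy : y ≠ s)
    (h : LexGT vis.reverse (fun u => G.Adj u x) (fun u => G.Adj u y)) :
    lexDFS.label G s vis y < lexDFS.label G s vis x := by
  rw [label_lexDFS, label_lexDFS, if_neg hx, if_neg hy]
  refine LexGT.map_filter_lt (D := (vis.zipIdx 1).reverse) (A := fun u => G.Adj u x)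
    (B := fun u => G.Adj u y) ?_ ?_ [] (by simp)
  · rw [List.pairwise_reverse]
    exact pairwise_snd_zipIdx vis 1
  · rwa [List.map_reverse, List.zipIdx_map_fst]

theorem label_lexBFS_lt (vis : List V) (hvis : vis.length ≤ Fintype.card V) {x y : V}
    (hx : x ≠ s) (hy : y ≠ s) (h : LexGT vis (fun u => G.Adj u x) (fun u => G.Adj u y)) :
    lexBFS.label G s vis y < lexBFS.label G s vis x := by
  rw [label_lexBFS, label_lexBFS, if_neg hx, if_neg hy, List.nil_append, List.nil_append]
  have := LexGT.map_filter_lt (D := (vis.zipIdx 1).map fun p => (p.1, Fintype.card V - p.2))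
    (A := fun u => G.Adj u x) (B := fun u => G.Adj u y) ?_ ?_ [] (by simp)
  · simpa using this
  · rw [List.pairwise_map]
    refine (pairwise_snd_zipIdx vis 1).imp_of_mem fun ha hb hab => ?_
    have h1 := List.snd_lt_add_of_mem_zipIdx ha
    have h2 := List.snd_lt_add_of_mem_zipIdx hb
    simp only
    omega
  · rw [List.map_map]
    have : (Prod.fst ∘ fun p : V × ℕ => (p.1, Fintype.card V - p.2)) = Prod.fst := rfl
    rwa [this, List.zipIdx_map_fst]

variable (R) in
theorem label_congr (vis : List V) {x y : V} (hx : x ≠ s) (hy : y ≠ s)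
    (h : ∀ u ∈ vis, G.Adj u x ↔ G.Adj u y) : R.label G s vis x = R.label G s vis y := by
  induction vis using List.reverseRecOn with
  | nil => simp [label_nil, hx, hy]
  | append_singleton vis u ih =>
    rw [label_append_singleton, label_append_singleton, ih fun v hv => h v (by simp [hv])]
    simp [h u (by simp)]

theorem label_eq_nil_of_forall_not_adj (vis : List V) {x : V} (hx : x ≠ s)
    (h : ∀ u ∈ vis, ¬ G.Adj u x) : R.label G s vis x = [] := by
  induction vis using List.reverseRecOn with
  | nil => simp [label_nil, hx]
  | append_singleton vis u ih =>
    rw [label_append_singleton, if_neg (h u (by simp)), ih fun v hv => h v (by simp [hv])]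

theorem label_ne_nil (h0 : ∀ i l, R.update (Fintype.card V) i l ≠ []) (vis : List V) {u x : V}
    (hu : u ∈ vis) (h : G.Adj u x) : R.label G s vis x ≠ [] := by
  induction vis using List.reverseRecOn with
  | nil => simp at hu
  | append_singleton vis v ih =>
    rw [label_append_singleton]
    split
    · exact h0 _ _
    · rename_i hv
      simp only [List.mem_append, List.mem_singleton] at hu
      rcases hu with hu | rfl
      · exact ih hu
      · exact absurd h hv

end SearchRule

end Searches

/-! ### Chordal graphs -/

theorem cycleGraph_adj_iff_of_lt {k : ℕ} {i j : Fin k} (h : i < j) :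
    (SimpleGraph.cycleGraph k).Adj i j ↔ (j : ℕ) = i + 1 ∨ ((i : ℕ) = 0 ∧ (j : ℕ) + 1 = k) := by
  have h1 : ((i - j : Fin k) : ℕ) = k + i - j := Fin.coe_sub_iff_lt.2 h
  have h2 : ((j - i : Fin k) : ℕ) = j - i := Fin.sub_val_of_le h.le
  have := i.2
  have := j.2
  have : (i : ℕ) < j := h
  rw [SimpleGraph.cycleGraph_adj', h1, h2]
  omega

/-- A shortest walk has no chords. -/
theorem SimpleGraph.Walk.eq_add_one_of_adj_of_length_eq_dist {V : Type*} {G : SimpleGraph V}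
    {u v : V} (p : G.Walk u v) (hp : p.length = G.dist u v) {i j : ℕ} (hij : i < j)
    (hj : j ≤ p.length) :
    p.getVert i ≠ p.getVert j ∧ (G.Adj (p.getVert i) (p.getVert j) → j = i + 1) := by
  constructor
  · intro h
    have := SimpleGraph.dist_le ((p.take i).append ((p.drop j).copy h.symm rfl))
    simp only [Walk.length_append, Walk.length_copy, Walk.take_length, Walk.drop_length] at this
    omega
  · intro h
    have := SimpleGraph.dist_le ((p.take i).append (Walk.cons h (p.drop j)))
    simp only [Walk.length_append, Walk.length_cons, Walk.take_length, Walk.drop_length] at this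
    omega

/-- `y` is reachable from `x` by a walk of `G` whose vertices are all in `S`,
or `x = y`. -/
def ReachIn {V : Type*} (G : SimpleGraph V) (S : Set V) : V → V → Prop :=
  Relation.ReflTransGen fun x y => G.Adj x y ∧ x ∈ S ∧ y ∈ S

section ReachIn

variable {V : Type*} {G : SimpleGraph V} {S S' : Set V} {x y z : V}

theorem ReachIn.mono (h : ReachIn G S x y) (hS : S ⊆ S') : ReachIn G S' x y :=
  Relation.ReflTransGen.mono (fun _ _ h => ⟨h.1, hS h.2.1, hS h.2.2⟩) _ _ h

theorem ReachIn.symm (h : ReachIn G S x y) : ReachIn G S y x := by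
  induction h with
  | refl => exact .refl
  | tail _ h ih => exact .head ⟨h.1.symm, h.2.2, h.2.1⟩ ih

theorem ReachIn.tail (h : ReachIn G S x y) (hyz : G.Adj y z) (hy : y ∈ S) (hz : z ∈ S) :
    ReachIn G S x z :=
  Relation.ReflTransGen.tail h ⟨hyz, hy, hz⟩

theorem ReachIn.reachable_induce (h : ReachIn G S x y) (hx : x ∈ S) (hy : y ∈ S) :
    (G.induce S).Reachable ⟨x, hx⟩ ⟨y, hy⟩ := by
  induction h with
  | refl => exact SimpleGraph.Reachable.refl _
  | @tail b c _ h ih =>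
    exact (ih h.2.1).trans (SimpleGraph.Adj.reachable (by simpa using h.1))

end ReachIn

/-- In a chordal graph, two neighbours `c`, `d` of a vertex `a` are adjacent if they are joined by a
walk whose inner vertices are neither `a` nor neighbours of `a`: together with `a`, a shortest such
walk would form an induced cycle. -/
theorem IsChordal.adj_of_reachable {V : Type*} {G : SimpleGraph V} (hG : IsChordal G) {a c d : V}
    (hc : G.Adj a c) (hd : G.Adj a d) (hcd : c ≠ d) {S : Set V} (hcS : c ∈ S) (hdS : d ∈ S)
    (hS : ∀ x ∈ S, x ≠ a ∧ (G.Adj a x → x = c ∨ x = d))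
    (hr : ReachIn G S c d) : G.Adj c d := by
  by_contra hn
  obtain ⟨p, hp⟩ := (hr.reachable_induce hcS hdS).exists_walk_length_eq_dist
  set L := p.length with hL
  have hp0 : p.getVert 0 = ⟨c, hcS⟩ := p.getVert_zero
  have hpL : p.getVert L = ⟨d, hdS⟩ := p.getVert_length
  have hchord := fun i j (hij : i < j) (hj : j ≤ L) =>
    p.eq_add_one_of_adj_of_length_eq_dist hp hij hj
  have hadj : ∀ i < L, G.Adj (p.getVert i) (p.getVert (i + 1)) := fun i hi =>
    p.adj_getVert_succ hi
  have hL2 : 2 ≤ L := by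
    by_contra h
    have : L = 0 ∨ L = 1 := by omega
    rcases this with h | h
    · rw [h, hp0] at hpL
      exact hcd (congrArg Subtype.val hpL)
    · have := hadj 0 (by omega)
      rw [hp0, zero_add, ← h, hpL] at this
      exact hn this
  have hc' : ∀ i ≤ L, ((p.getVert i : S) : V) = c → i = 0 := fun i hi h => by
    by_contra h0
    exact (hchord 0 i (by omega) hi).1 (by rw [hp0]; exact Subtype.ext h.symm)
  have hd' : ∀ i ≤ L, ((p.getVert i : S) : V) = d → i = L := fun i hi h => by
    by_contra h0
    exact (hchord i L (by omega) le_rfl).1 (by rw [hpL]; exact Subtype.ext h)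
  -- the induced cycle, with `a` as its last vertex
  let f : Fin (L + 2) → V := fun i => if (i : ℕ) ≤ L then (p.getVert i : S) else a
  have hlt : ∀ i j : Fin (L + 2), i < j →
      f i ≠ f j ∧ (G.Adj (f i) (f j) ↔ (SimpleGraph.cycleGraph (L + 2)).Adj i j) := by
    intro i j hij
    have hi : (i : ℕ) ≤ L := by have := j.2; have : (i : ℕ) < j := hij; omega
    have hij' : (i : ℕ) < j := hij
    rw [cycleGraph_adj_iff_of_lt hij]
    have hfi : f i = (p.getVert i : S) := if_pos hi
    rw [hfi]
    by_cases hj : (j : ℕ) ≤ L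
    · have hfj : f j = (p.getVert j : S) := if_pos hj
      rw [hfj]
      refine ⟨fun h => (hchord i j hij' hj).1 (Subtype.ext h), fun h =>
        Or.inl ((hchord i j hij' hj).2 h), ?_⟩
      rintro (h | h)
      · rw [h]
        exact hadj i (by omega)
      · omega
    · have hfj : f j = a := if_neg hj
      rw [hfj]
      have hj' : (j : ℕ) = L + 1 := by have := j.2; omega
      have hS' := hS _ (p.getVert i).2
      refine ⟨hS'.1, fun h => ?_, ?_⟩
      · rcases hS'.2 h.symm with h | h
        · have := hc' i hi h
          omega
        · have := hd' i hi h
          omega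
      · rintro (h | h)
        · have : (i : ℕ) = L := by omega
          rw [this, hpL]
          exact hd.symm
        · rw [h.1, hp0]
          exact hc.symm
  refine (hG (L + 2) (by omega)).elim ⟨⟨f, fun i j h => ?_⟩, fun {i j} => ?_⟩
  · rcases lt_trichotomy i j with h' | h' | h'
    · exact absurd h (hlt i j h').1
    · exact h'
    · exact absurd h.symm (hlt j i h').1
  · rcases lt_trichotomy i j with h' | h' | h'
    · exact (hlt i j h').2
    · subst h'
      simp
    · exact (G.adj_comm _ _).trans ((hlt j i h').2.trans (SimpleGraph.adj_comm _ _ _))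

/-! ### Lexicographic breadth first search on chordal graphs -/

section LastIn

variable {V : Type*} [DecidableEq V]

theorem leftOf_append {A B : List V} {v : V} (hv : v ∉ A) : leftOf (A ++ v :: B) v = A := by
  unfold leftOf
  rw [List.takeWhile_append_of_pos]
  · simp
  · intro w hw
    simp only [ne_eq, decide_not, Bool.not_eq_eq_eq_not, Bool.not_true, decide_eq_false_iff_not]
    rintro rfl
    exact hv hw

theorem mem_leftOf {σ : List V} (hσ : IsVertexOrder σ) {u v : V} :
    u ∈ leftOf σ v ↔ σ.idxOf u < σ.idxOf v := by
  obtain ⟨A, B, rfl, hv, -, hA, -⟩ := hσ.exists_split v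
  rw [leftOf_append hv, hA]

variable {G : SimpleGraph V} [DecidableRel G.Adj] {σ : List V}

/-- The first vertex of a reversed list that satisfies a predicate is the last one in the list. -/
theorem List.find?_reverse_eq_some_of_pairwise {f : V → ℕ} {A : List V}
    (hA : A.Pairwise fun a b => f a < f b) {P : V → Bool} {q : V} :
    A.reverse.find? P = some q ↔ q ∈ A ∧ P q ∧ ∀ u ∈ A, P u → f u ≤ f q := by
  induction A using List.reverseRecOn with
  | nil => simp
  | append_singleton A a ih =>
    rw [List.pairwise_append] at hA
    rw [List.reverse_append, List.reverse_singleton, List.singleton_append]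
    by_cases ha : P a
    · rw [List.find?_cons_of_pos ha]
      simp only [Option.some.injEq, List.mem_append, List.mem_singleton]
      constructor
      · rintro rfl
        exact ⟨Or.inr rfl, ha, fun u hu _ => hu.elim (fun hu => (hA.2.2 u hu a (by simp)).le)
          fun hu => by rw [hu]⟩
      · rintro ⟨h1 | h1, h2, h3⟩
        · have := h3 a (Or.inr rfl) ha
          have := hA.2.2 q h1 a (by simp)
          omega
        · exact h1.symm
    · rw [List.find?_cons_of_neg ha, ih hA.1]
      simp only [List.mem_append, List.mem_singleton]
      constructor
      · rintro ⟨h1, h2, h3⟩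
        exact ⟨Or.inl h1, h2, fun u hu hPu => hu.elim (fun hu => h3 u hu hPu)
          fun hu => absurd (hu ▸ hPu) ha⟩
      · rintro ⟨h1 | h1, h2, h3⟩
        · exact ⟨h1, h2, fun u hu hPu => h3 u (Or.inl hu) hPu⟩
        · exact absurd (h1 ▸ h2) ha

theorem pairwise_idxOf_of_append {A B : List V} (h : (A ++ B).Nodup) :
    A.Pairwise fun a b => (A ++ B).idxOf a < (A ++ B).idxOf b := by
  induction A using List.reverseRecOn generalizing B with
  | nil => simp
  | append_singleton A a ih =>
    rw [List.append_assoc] at *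
    rw [List.pairwise_append]
    refine ⟨ih h, by simp, fun u hu v hv => ?_⟩
    rw [List.mem_singleton] at hv
    subst hv
    rw [List.nodup_append] at h
    exact idxOf_lt_of_append (fun hv => h.2.2 v hv v (by simp) rfl) hu

theorem lastInParent_eq_some_iff (hσ : IsVertexOrder σ) {v q : V} :
    lastInParent G σ v = some q ↔ G.Adj v q ∧ σ.idxOf q < σ.idxOf v ∧
      ∀ u, G.Adj v u → σ.idxOf u < σ.idxOf v → σ.idxOf u ≤ σ.idxOf q := by
  obtain ⟨A, B, hAB, hv, -, hA, -⟩ := hσ.exists_split v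
  have h1 : leftOf σ v = A := by rw [hAB, leftOf_append hv]
  have h2 : A.Pairwise fun a b => σ.idxOf a < σ.idxOf b := by
    have := hσ.1
    rw [hAB] at this ⊢
    exact pairwise_idxOf_of_append this
  rw [lastInParent, h1, List.find?_reverse_eq_some_of_pairwise h2]
  simp only [hA, decide_eq_true_eq]
  constructor
  · exact fun h => ⟨h.2.1, h.1, fun u h1 h2 => h.2.2 u h2 h1⟩
  · exact fun h => ⟨h.2.1, h.1, fun u h1 h2 => h.2.2 u h2 h1⟩

theorem exists_lastInParent (hσ : IsVertexOrder σ) {u v : V} (h : G.Adj v u)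
    (huv : σ.idxOf u < σ.idxOf v) : ∃ q, lastInParent G σ v = some q := by
  rw [← Option.isSome_iff_exists, lastInParent, List.find?_isSome]
  exact ⟨u, by simpa [mem_leftOf hσ] using huv, by simpa using h⟩

end LastIn

namespace SearchRule

variable {V : Type*} [Fintype V] [DecidableEq V] {R : SearchRule} {G : SimpleGraph V}
  [DecidableRel G.Adj] {s : V} {σ : List V}

theorem IsSearchOrder.idxOf_start (h0 : R.start (Fintype.card V) ≠ [])
    (h : R.IsSearchOrder G s σ) : σ.idxOf s = 0 := by
  rcases hσ : σ with _ | ⟨v, rest⟩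
  · have := h.1.2 s
    simp [hσ] at this
  · simp [h.head_eq h0 hσ]

/-- A search that ranks the vertices without visited neighbours last visits each vertex, except for
the start vertex, after one of its neighbours, if no set of vertices is closed under adjacency. -/
theorem IsSearchOrder.exists_adj_lt (h0 : R.start (Fintype.card V) ≠ [])
    (hu : ∀ i l, R.update (Fintype.card V) i l ≠ []) (h : R.IsSearchOrder G s σ)
    (hG : ∀ (A : List V) (v : V), s ∈ A → v ∉ A → ∃ u ∈ A, ∃ x ∉ A, G.Adj u x) {v : V}
    (hv : v ≠ s) : ∃ u, G.Adj v u ∧ σ.idxOf u < σ.idxOf v := by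
  obtain ⟨A, B, hσ, hvA, hvB, hA, hB⟩ := h.1.exists_split v
  have hs : s ∈ A := by
    rw [hA, h.idxOf_start h0]
    have := mt h.1.idxOf_inj.1 hv
    rw [h.idxOf_start h0] at this
    omega
  obtain ⟨u, huA, x, hxA, hux⟩ := hG A v hs hvA
  by_contra hcon
  push Not at hcon
  have hvn : R.label G s A v = [] := label_eq_nil_of_forall_not_adj A hv fun w hw hwv =>
    (hcon w hwv.symm).not_gt ((hA w).1 hw)
  have hxn : R.label G s A x ≠ [] := label_ne_nil hu A huA hux
  have hxv : x ≠ v := by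
    rintro rfl
    exact hxn hvn
  have hxB : x ∈ B := by
    have := h.1.2 x
    rw [hσ] at this
    simp only [List.mem_append, List.mem_cons] at this
    tauto
  have := h.2 A v B hσ x hxB
  rw [hvn] at this
  obtain ⟨a, l, hl⟩ := List.exists_cons_of_ne_nil hxn
  rw [hl] at this
  exact this.not_gt (List.nil_lt_cons a l)

end SearchRule

theorem SimpleGraph.Connected.exists_adj_of_notMem {V : Type*} {G : SimpleGraph V}
    (hG : G.Connected) {A : List V} {s v : V} (hs : s ∈ A) (hv : v ∉ A) :
    ∃ u ∈ A, ∃ x ∉ A, G.Adj u x := by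
  obtain ⟨p⟩ := hG.preconnected s v
  obtain ⟨d, -, h1, h2⟩ := p.exists_boundary_dart {x | x ∈ A} hs hv
  exact ⟨d.fst, h1, d.snd, h2, d.adj⟩

/-- On a walk from a neighbour of `a` to a vertex `b` that is not a neighbour of `a`, consider the
last neighbour of `a`. -/
theorem ReachIn.exists_last_adj {V : Type*} {G : SimpleGraph V} {S : Set V} {a b y : V}
    (h : ReachIn G S y b) (hb : ¬ G.Adj a b) (hy : G.Adj a y) :
    ∃ c ∈ S, G.Adj a c ∧ ReachIn G ({c} ∪ {x | x ∈ S ∧ ¬ G.Adj a x}) c b := by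
  have key : ReachIn G {x | x ∈ S ∧ ¬ G.Adj a x} y b ∧ ¬ G.Adj a y ∨
      ∃ c ∈ S, G.Adj a c ∧ ReachIn G ({c} ∪ {x | x ∈ S ∧ ¬ G.Adj a x}) c b := by
    clear hy
    induction h using Relation.ReflTransGen.head_induction_on with
    | refl => exact Or.inl ⟨.refl, hb⟩
    | @head x y hxy _ ih =>
      rcases ih with ⟨h1, h2⟩ | h1
      · by_cases hx : G.Adj a x
        · refine Or.inr ⟨x, hxy.2.1, hx, ?_⟩
          exact .head ⟨hxy.1, Or.inl rfl, Or.inr ⟨hxy.2.2, h2⟩⟩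
            (h1.mono Set.subset_union_right)
        · exact Or.inl ⟨.head ⟨hxy.1, ⟨hxy.2.1, hx⟩, ⟨hxy.2.2, h2⟩⟩ h1, hx⟩
      · exact Or.inr h1
  exact key.resolve_left fun h => h.2 hy

theorem ne_start_of_idxOf_lt {V : Type*} [DecidableEq V] {s : V} {σ : List V}
    (h : σ.idxOf s = 0) {u v : V} (huv : σ.idxOf u < σ.idxOf v) : v ≠ s := by
  rintro rfl
  omega

section LexBFS

variable {V : Type*} [Fintype V] [DecidableEq V] {G : SimpleGraph V}
  [DecidableRel G.Adj] {s : V} {σ : List V}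

open SearchRule

theorem lexBFS_start_ne_nil (n : ℕ) : lexBFS.start n ≠ [] := by simp [lexBFS]

/-- The property of LexBFS (shared with maximal neighbourhood search) that makes it yield perfect
elimination orders of chordal graphs: a vertex `b` that is visited before `c`, although an earlier
vertex `a` is a neighbour of `c` only, has an earlier neighbour that is not a neighbour of `c`. -/
theorem exists_adj_not_adj_of_lexBFS (hσ : lexBFS.IsSearchOrder G s σ) {a b c : V}
    (hab : σ.idxOf a < σ.idxOf b) (hbc : σ.idxOf b < σ.idxOf c) (hac : G.Adj a c)
    (hnab : ¬ G.Adj a b) : ∃ d, σ.idxOf d < σ.idxOf b ∧ G.Adj d b ∧ ¬ G.Adj d c := by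
  obtain ⟨A, B, hAB, -, -, hA, hB⟩ := hσ.1.exists_split b
  have hs := hσ.idxOf_start (lexBFS_start_ne_nil _)
  have hlen : A.length ≤ Fintype.card V := by
    rw [← hσ.1.length_eq, hAB]
    simp
  have hle := hσ.2 A b B hAB c ((hB c).2 hbc)
  rcases lexGT_trichotomy A (fun u => G.Adj u b) (fun u => G.Adj u c) with h | h | h
  · obtain ⟨A₁, d, A₂, rfl, h1, h2, -⟩ := lexGT_iff.1 h
    exact ⟨d, (hA d).1 (by simp), h1, h2⟩
  · exact absurd hle (label_lexBFS_lt A hlen (ne_start_of_idxOf_lt hs hbc)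
      (ne_start_of_idxOf_lt hs hab) h).not_ge
  · exact absurd ((h a ((hA a).2 hab)).2 hac) hnab

/-- In a LexBFS order of a chordal graph, two non-adjacent vertices are not joined by a walk whose
inner vertices come after both of them. -/
theorem adj_of_reachIn_later (hG : IsChordal G) (hσ : lexBFS.IsSearchOrder G s σ) {a b y : V}
    (hab : σ.idxOf a < σ.idxOf b) (hy : G.Adj a y)
    (hyb : ReachIn G {x | σ.idxOf b ≤ σ.idxOf x} y b) : G.Adj a b := by
  -- a counterexample with `b` as far to the left as possible
  induction hk : σ.idxOf b using Nat.strong_induction_on generalizing a b y with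
  | _ k ih =>
  subst hk
  by_contra hn
  obtain ⟨c, hbc, hac, hcb⟩ := hyb.exists_last_adj hn hy
  have hcb' : c ≠ b := by
    rintro rfl
    exact hn hac
  have hbc' : σ.idxOf b < σ.idxOf c := lt_of_le_of_ne hbc fun h => hcb' (hσ.1.idxOf_inj.1 h).symm
  obtain ⟨d, hdb, hadj, hdc⟩ := exists_adj_not_adj_of_lexBFS hσ hab hbc' hac hn
  have hda : d ≠ a := by
    rintro rfl
    exact hn hadj
  have hlater : ReachIn G {x | σ.idxOf b ≤ σ.idxOf x} c b := hcb.mono <| by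
    rintro x (rfl | hx)
    · exact hbc
    · exact hx.1
  by_cases had : G.Adj a d
  · -- then `d`, `a`, `c` and the walk from `c` to `b` form a cycle without a chord at `a`
    have hac' : c ≠ d := by
      rintro rfl
      omega
    refine hdc (hG.adj_of_reachable hac had hac'
      (S := {d} ∪ ({c} ∪ {x | σ.idxOf b ≤ σ.idxOf x ∧ ¬ G.Adj a x})) (Or.inr (Or.inl rfl))
      (Or.inl rfl) ?_ ((hcb.mono Set.subset_union_right).tail hadj.symm
        (Or.inr (Or.inr ⟨le_refl (σ.idxOf b), hn⟩)) (Or.inl rfl))).symm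
    rintro x (rfl | rfl | hx)
    · exact ⟨hda, fun _ => Or.inr rfl⟩
    · exact ⟨hac.ne', fun _ => Or.inl rfl⟩
    · refine ⟨?_, fun h => absurd h hx.2⟩
      rintro rfl
      have := hx.1
      omega
  · -- then `a` and `d` are a counterexample further to the left
    rcases lt_or_gt_of_ne (mt hσ.1.idxOf_inj.1 hda) with h | h
    · refine had (ih (σ.idxOf a) hab h hadj ?_ rfl).symm
      exact (hlater.symm.mono fun x hx => hab.le.trans hx).tail hac.symm (hab.le.trans hbc)
        (le_refl (σ.idxOf a))
    · refine had (ih (σ.idxOf d) hdb h hac ?_ rfl)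
      exact (hlater.mono fun x hx => hdb.le.trans hx).tail hadj.symm hdb.le (le_refl (σ.idxOf d))

/-- A LexBFS order of a chordal graph is the reverse of a perfect elimination order. -/
theorem adj_of_adj_of_lexBFS (hG : IsChordal G) (hσ : lexBFS.IsSearchOrder G s σ) {u v w : V}
    (hu : G.Adj u v) (huv : σ.idxOf u < σ.idxOf v) (hw : G.Adj w v)
    (hwv : σ.idxOf w < σ.idxOf v) (huw : u ≠ w) : G.Adj u w := by
  have key : ∀ {u w : V}, G.Adj u v → G.Adj w v → σ.idxOf u < σ.idxOf w →
      σ.idxOf w < σ.idxOf v → G.Adj u w := fun hu hw huw hwv =>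
    adj_of_reachIn_later hG hσ huw hu (.single ⟨hw.symm, hwv.le, le_refl (σ.idxOf _)⟩)
  rcases lt_or_gt_of_ne (mt hσ.1.idxOf_inj.1 huw) with h | h
  · exact key hu hw h hwv
  · exact (key hw hu h huv).symm

end LexBFS

/-! ### The last-in tree of a LexBFS order of a chordal graph -/

/-- The properties of the order `LexBFS⁺(ρ)` of a connected chordal graph that matter for the
algorithm: the order starts at `s`, every other vertex has a neighbour to its left, the neighbours to
the left of a vertex are pairwise adjacent, and of two vertices with the same neighbours to the left
of both of them, the one further to the right in `ρ` comes first. -/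
structure IsCliqueOrder {V : Type*} [DecidableEq V] (G : SimpleGraph V) (s : V) (ρ π : List V) :
    Prop where
  order : IsVertexOrder π
  start : π.idxOf s = 0
  exists_left : ∀ v, v ≠ s → ∃ u, G.Adj v u ∧ π.idxOf u < π.idxOf v
  clique : ∀ {u w v : V}, G.Adj u v → π.idxOf u < π.idxOf v → G.Adj w v → π.idxOf w < π.idxOf v →
    u ≠ w → G.Adj u w
  tie : ∀ {c w : V}, c ≠ s → π.idxOf c < π.idxOf w →
    (∀ u, π.idxOf u < π.idxOf c → (G.Adj u c ↔ G.Adj u w)) → ρ.idxOf w ≤ ρ.idxOf c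

theorem isCliqueOrder_lexBFS_plus {V : Type*} [Fintype V] [DecidableEq V] {G : SimpleGraph V}
    [DecidableRel G.Adj] {s : V} {ρ : List V} (h : IsValidInput G s ρ) :
    IsCliqueOrder G s ρ (lexBFS.plus G s ρ) := by
  have hS : lexBFS.IsSearchOrder G s (lexBFS.plus G s ρ) :=
    SearchRule.plus_isSearchOrder h.order
  have hs := hS.idxOf_start (lexBFS_start_ne_nil _)
  refine ⟨hS.1, hs, fun v hv => ?_, fun hu huv hw hwv =>
    adj_of_adj_of_lexBFS h.chordal hS hu huv hw hwv,
    fun {c w} hc hcw heq => ?_⟩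
  · exact hS.exists_adj_lt (lexBFS_start_ne_nil _) (fun i l => by simp [lexBFS])
      (fun A v hsA hvA => h.connected.exists_adj_of_notMem hsA hvA) hv
  · obtain ⟨A, B, hAB, -, -, hA, -⟩ := hS.1.exists_split c
    have hw : w ∉ A := fun hw => by
      have := (hA w).1 hw
      omega
    have hlab := SearchRule.label_congr (G := G) (s := s) lexBFS A hc (ne_start_of_idxOf_lt hs hcw)
      fun u hu => heq u ((hA u).1 hu)
    rcases SearchRule.plus_split h.order hAB w hw with h1 | h1
    · rw [hlab] at h1
      exact absurd h1 (lt_irrefl _)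
    · exact h1.2

/-- The parents precede their children in the vertex order `B`. -/
structure IsTopological {V : Type*} [DecidableEq V] (p : V → Option V) (B : List V) : Prop where
  order : IsVertexOrder B
  parent_lt : ∀ {v q : V}, p v = some q → B.idxOf q < B.idxOf v

namespace IsCliqueOrder

variable {V : Type*} [DecidableEq V] {G : SimpleGraph V} [DecidableRel G.Adj] {s : V} {ρ π : List V}

theorem parent_start (h : IsCliqueOrder G s ρ π) : lastInParent G π s = none := by
  rw [Option.eq_none_iff_forall_ne_some]
  intro q hq
  have := ((lastInParent_eq_some_iff h.order).1 hq).2.1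
  rw [h.start] at this
  omega

theorem ne_start_of_parent (h : IsCliqueOrder G s ρ π) {v q : V}
    (hq : lastInParent G π v = some q) : v ≠ s := by
  rintro rfl
  rw [h.parent_start] at hq
  simp at hq

theorem exists_parent (h : IsCliqueOrder G s ρ π) {v : V} (hv : v ≠ s) :
    ∃ q, lastInParent G π v = some q := by
  obtain ⟨u, hu, huv⟩ := h.exists_left v hv
  exact exists_lastInParent h.order hu huv

theorem adj_parent (h : IsCliqueOrder G s ρ π) {v q : V} (hq : lastInParent G π v = some q) :
    G.Adj q v :=
  ((lastInParent_eq_some_iff h.order).1 hq).1.symm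

theorem parent_lt (h : IsCliqueOrder G s ρ π) {v q : V} (hq : lastInParent G π v = some q) :
    π.idxOf q < π.idxOf v :=
  ((lastInParent_eq_some_iff h.order).1 hq).2.1

theorem isTopological (h : IsCliqueOrder G s ρ π) : IsTopological (lastInParent G π) π :=
  ⟨h.order, h.parent_lt⟩

/-- The neighbours to the left of `v` are its parent and neighbours to the left of its parent. -/
theorem eq_or_adj_parent (h : IsCliqueOrder G s ρ π) {u v q : V}
    (hq : lastInParent G π v = some q) (hu : G.Adj u v) (huv : π.idxOf u < π.idxOf v) :
    u = q ∨ (G.Adj u q ∧ π.idxOf u < π.idxOf q) := by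
  by_cases huq : u = q
  · exact Or.inl huq
  · refine Or.inr ⟨h.clique hu huv (h.adj_parent hq) (h.parent_lt hq) huq, ?_⟩
    exact lt_of_le_of_ne (((lastInParent_eq_some_iff h.order).1 hq).2.2 u hu.symm huv)
      (mt h.order.idxOf_inj.1 huq)

/-- The last-in tree is normal: every edge of the graph joins a vertex to one of its ancestors.
Therefore all orders in which parents precede their children agree on adjacent vertices. -/
theorem idxOf_lt_iff (h : IsCliqueOrder G s ρ π) {B : List V}
    (hB : IsTopological (lastInParent G π) B) {u v : V} (huv : G.Adj u v) :
    B.idxOf u < B.idxOf v ↔ π.idxOf u < π.idxOf v := by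
  have key : ∀ (k : ℕ) {u v : V}, π.idxOf v = k → G.Adj u v → π.idxOf u < π.idxOf v →
      B.idxOf u < B.idxOf v := by
    intro k
    induction k using Nat.strong_induction_on with
    | _ k ih =>
    intro u v hk hadj hlt
    obtain ⟨q, hq⟩ := exists_lastInParent h.order hadj.symm hlt
    have hqv := hB.parent_lt hq
    rcases h.eq_or_adj_parent hq hadj hlt with rfl | ⟨h1, h2⟩
    · exact hqv
    · exact (ih _ (hk ▸ h.parent_lt hq) rfl h1 h2).trans hqv
  refine ⟨fun hlt => ?_, key _ rfl huv⟩
  by_contra hn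
  have := key _ rfl huv.symm
    (lt_of_le_of_ne (not_lt.1 hn) fun he => huv.ne (h.order.idxOf_inj.1 he).symm)
  omega

end IsCliqueOrder

/-! ### The depth first order of the tree, built by insertions -/

section InsertAfter

variable {V : Type*} [DecidableEq V]

/-- Insert `x` into a list right after (the first occurrence of) `q`. -/
def insertAfter (q x : V) : List V → List V
  | [] => []
  | a :: L => if a = q then a :: x :: L else a :: insertAfter q x L

theorem insertAfter_append {q x : V} {A B : List V} (hq : q ∉ A) :
    insertAfter q x (A ++ q :: B) = A ++ q :: x :: B := by
  induction A with
  | nil => simp [insertAfter]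
  | cons a A ih =>
    simp only [List.mem_cons, not_or] at hq
    simp [insertAfter, Ne.symm hq.1, ih hq.2]

theorem idxOf_insertAfter {q x : V} {L : List V} (hq : q ∈ L) (hx : x ∉ L) {a : V} (ha : a ∈ L) :
    (insertAfter q x L).idxOf a = if L.idxOf a ≤ L.idxOf q then L.idxOf a else L.idxOf a + 1 := by
  induction L with
  | nil => simp at hq
  | cons b L ih =>
    simp only [List.mem_cons, not_or] at hq hx ha
    unfold insertAfter
    by_cases hbq : b = q
    · subst hbq
      rw [if_pos rfl]
      by_cases hba : b = a
      · simp [hba]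
      · have hxa : x ≠ a := by
          rintro rfl
          exact hx.2 (ha.resolve_left (Ne.symm hba))
        simp [List.idxOf_cons_ne _ hba, List.idxOf_cons_ne _ hxa]
    · rw [if_neg hbq]
      by_cases hba : b = a
      · simp [hba]
      · rw [List.idxOf_cons_ne _ hba, List.idxOf_cons_ne _ hba, List.idxOf_cons_ne _ hbq,
          ih (hq.resolve_left (Ne.symm hbq)) hx.2 (ha.resolve_left (Ne.symm hba))]
        simp only [Nat.succ_eq_add_one, Nat.add_le_add_iff_right]
        split <;> rfl

theorem idxOf_insertAfter_self {q x : V} {L : List V} (hq : q ∈ L) (hx : x ∉ L) :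
    (insertAfter q x L).idxOf x = L.idxOf q + 1 := by
  induction L with
  | nil => simp at hq
  | cons b L ih =>
    simp only [List.mem_cons, not_or] at hq hx
    unfold insertAfter
    by_cases hbq : b = q
    · subst hbq
      rw [if_pos rfl, List.idxOf_cons_ne _ (Ne.symm hx.1)]
      simp
    · rw [if_neg hbq, List.idxOf_cons_ne _ (Ne.symm hx.1), List.idxOf_cons_ne _ hbq,
        ih (hq.resolve_left (Ne.symm hbq)) hx.2]

theorem perm_insertAfter {q x : V} {L : List V} (hq : q ∈ L) :
    (insertAfter q x L).Perm (x :: L) := by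
  induction L with
  | nil => simp at hq
  | cons b L ih =>
    unfold insertAfter
    by_cases hbq : b = q
    · rw [if_pos hbq]
      exact List.Perm.swap _ _ _
    · rw [if_neg hbq]
      exact ((ih ((List.mem_cons.1 hq).resolve_left (Ne.symm hbq))).cons b).trans
        (List.Perm.swap _ _ _)

/-- Start with the list `[s]` and insert the vertices of `W`, one after the other, right after their
parents. -/
def treeOrder (p : V → Option V) (s : V) (W : List V) : List V :=
  W.foldl (fun L x => (p x).elim L fun q => insertAfter q x L) [s]

/-- Invariants of the construction of `treeOrder`. The last one says: if `v` comes before `w` although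
the parent of `w` comes before `v`, then the parent of `w` comes before the parent of `v`, or the
parents are the same and `w` has been inserted before `v`. -/
structure IsTreeOrder (p : V → Option V) (s : V) (W : List V) (L : List V) : Prop where
  nodup : L.Nodup
  mem_iff : ∀ v, v ∈ L ↔ v = s ∨ v ∈ W
  start : L.idxOf s = 0
  parent_mem : ∀ {v q : V}, v ∈ L → p v = some q → q ∈ L ∧ L.idxOf q < L.idxOf v
  lt_or_eq : ∀ {v w q : V}, v ∈ L → w ∈ L → L.idxOf v < L.idxOf w → p w = some q →
    L.idxOf q < L.idxOf v →
    ∃ r, p v = some r ∧ (L.idxOf q < L.idxOf r ∨ (q = r ∧ W.idxOf w < W.idxOf v))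

theorem isTreeOrder_treeOrder {p : V → Option V} {s : V} (hps : p s = none) {W : List V}
    (hnd : (s :: W).Nodup)
    (hW : ∀ A x B, W = A ++ x :: B → ∃ q, p x = some q ∧ (q = s ∨ q ∈ A)) :
    IsTreeOrder p s W (treeOrder p s W) := by
  induction W using List.reverseRecOn with
  | nil =>
    refine ⟨by simp [treeOrder], by simp [treeOrder], by simp [treeOrder], ?_, ?_⟩
    · intro v q hv hq
      simp only [treeOrder, List.foldl_nil, List.mem_singleton] at hv
      simp [hv, hps] at hq
    · intro v w q hv hw hvw
      simp only [treeOrder, List.foldl_nil, List.mem_singleton] at hv hw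
      simp [hv, hw] at hvw
  | append_singleton W x ih =>
    have hnd' : (s :: W).Nodup := by
      rw [← List.cons_append] at hnd
      exact hnd.of_append_left
    have hxs : x ≠ s ∧ x ∉ W := by
      rw [← List.cons_append, List.nodup_append] at hnd
      have := fun a ha => hnd.2.2 a ha x (by simp)
      exact ⟨fun h => this s (by simp) h.symm, fun h => this x (by simp [h]) rfl⟩
    have ih' := ih hnd' fun A y B h => hW A y (B ++ [x]) (by simp [h])
    obtain ⟨q, hq, hqW⟩ := hW W x [] rfl
    have hL : treeOrder p s (W ++ [x]) = insertAfter q x (treeOrder p s W) := by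
      simp [treeOrder, List.foldl_append, hq]
    rw [hL]
    generalize treeOrder p s W = L at ih'
    have hqL : q ∈ L := (ih'.mem_iff q).2 hqW
    have hxL : x ∉ L := fun h => ((ih'.mem_iff x).1 h).elim hxs.1 hxs.2
    have hperm := perm_insertAfter (x := x) hqL
    have hmem : ∀ v, v ∈ insertAfter q x L ↔ v = x ∨ v ∈ L := fun v => by
      rw [hperm.mem_iff, List.mem_cons]
    have hsL : s ∈ L := (ih'.mem_iff s).2 (Or.inl rfl)
    have hne : ∀ a ∈ L, a ≠ x := by
      rintro a ha rfl
      exact hxL ha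
    have hidx := fun a (ha : a ∈ L) => idxOf_insertAfter hqL hxL ha
    have hidx' := idxOf_insertAfter_self hqL hxL
    have hlt : ∀ a ∈ L, ∀ b ∈ L, ((insertAfter q x L).idxOf a < (insertAfter q x L).idxOf b ↔
        L.idxOf a < L.idxOf b) := fun a ha b hb => by
      rw [hidx a ha, hidx b hb]
      split_ifs <;> omega
    have hltx : ∀ a ∈ L, ((insertAfter q x L).idxOf a < (insertAfter q x L).idxOf x ↔
        L.idxOf a ≤ L.idxOf q) := fun a ha => by
      rw [hidx a ha, hidx']
      split_ifs <;> omega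
    have hxlt : ∀ a ∈ L, ((insertAfter q x L).idxOf x < (insertAfter q x L).idxOf a ↔
        L.idxOf q < L.idxOf a) := fun a ha => by
      rw [hidx a ha, hidx']
      split_ifs <;> omega
    have hWL : ∀ a ∈ L, a ≠ s → a ∈ W := fun a ha has => ((ih'.mem_iff a).1 ha).resolve_left has
    refine ⟨?_, ?_, ?_, ?_, ?_⟩
    · rw [hperm.nodup_iff, List.nodup_cons]
      exact ⟨hxL, ih'.nodup⟩
    · intro v
      rw [hmem, ih'.mem_iff]
      simp
      tauto
    · rw [hidx s hsL, ih'.start]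
      simp
    · intro v q' hv hq'
      rcases (hmem v).1 hv with rfl | hv
      · obtain rfl : q = q' := by simpa [hq] using hq'
        exact ⟨(hmem q).2 (Or.inr hqL), (hltx q hqL).2 le_rfl⟩
      · obtain ⟨h1, h2⟩ := ih'.parent_mem hv hq'
        exact ⟨(hmem q').2 (Or.inr h1), (hlt q' h1 v hv).2 h2⟩
    · intro v w q' hv hw hvw hq' hqv
      rcases (hmem v).1 hv with rfl | hv'
      · rcases (hmem w).1 hw with rfl | hw
        · omega
        · refine ⟨q, hq, ?_⟩
          have hq'L := (ih'.parent_mem hw hq').1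
          rcases ((hltx q' hq'L).1 hqv).lt_or_eq with h1 | h1
          · exact Or.inl ((hlt q' hq'L q hqL).2 h1)
          · refine Or.inr ⟨(List.idxOf_inj hq'L).1 h1, ?_⟩
            have hws : w ≠ s := by
              rintro rfl
              simp [hps] at hq'
            exact idxOf_lt_of_append hxs.2 (hWL w hw hws)
      · rcases (hmem w).1 hw with rfl | hw
        · obtain rfl : q = q' := by simpa [hq] using hq'
          have h1 := (hltx v hv').1 hvw
          have h2 := (hlt q hqL v hv').1 hqv
          omega
        · have hq'L := (ih'.parent_mem hw hq').1
          obtain ⟨r, hr, h⟩ := ih'.lt_or_eq hv' hw ((hlt v hv' w hw).1 hvw) hq'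
            ((hlt q' hq'L v hv').1 hqv)
          have hrL := (ih'.parent_mem hv' hr).1
          refine ⟨r, hr, h.imp (hlt q' hq'L r hrL).2 fun h => ⟨h.1, ?_⟩⟩
          have hws : w ≠ s := by
            rintro rfl
            simp [hps] at hq'
          have hvs : v ≠ s := by
            rintro rfl
            simp [hps] at hr
          rw [List.idxOf_append_of_mem (hWL w hw hws), List.idxOf_append_of_mem (hWL v hv' hvs)]
          exact h.2

end InsertAfter

/-! ### Correctness: the depth first order of the tree is the LexDFS order of the graph -/

section Correctness

variable {V : Type*} [DecidableEq V]

/-- `u` is a neighbour of `w` to the left of `w` in `π`. -/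
def LeftAdj (G : SimpleGraph V) (π : List V) (u w : V) : Prop :=
  G.Adj u w ∧ π.idxOf u < π.idxOf w

/-- The order of the vertices in the partition computed by the ordering procedure. -/
def TieBreakLT (G : SimpleGraph V) (ρ π β : List V) (x y : V) : Prop :=
  LexGT β (LeftAdj G π · x) (LeftAdj G π · y) ∨
    ((∀ u, LeftAdj G π u x ↔ LeftAdj G π u y) ∧ ρ.idxOf y < ρ.idxOf x)

theorem TieBreakLT.asymm {G : SimpleGraph V} {ρ π β : List V} {x y : V}
    (h : TieBreakLT G ρ π β x y) : ¬ TieBreakLT G ρ π β y x := by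
  rintro (h' | h') <;> rcases h with h | h
  · exact h.asymm h'
  · exact h'.not_forall_iff fun u _ => (h.1 u).symm
  · exact h.not_forall_iff fun u _ => (h'.1 u).symm
  · have := h.2
    have := h'.2
    omega

/-- `s :: W` is the vertex order computed by the ordering procedure, before it is reversed. -/
structure IsTieBreakOrder (G : SimpleGraph V) (s : V) (ρ π β W : List V) : Prop where
  order : IsVertexOrder (s :: W)
  pairwise : W.Pairwise (TieBreakLT G ρ π β)

theorem IsTieBreakOrder.eq {G : SimpleGraph V} {s : V} {ρ π β W W' : List V}
    (h : IsTieBreakOrder G s ρ π β W) (h' : IsTieBreakOrder G s ρ π β W') : W = W' := by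
  refine List.Perm.eq_of_pairwise (fun a b _ _ h1 h2 => absurd h2 h1.asymm) h.pairwise h'.pairwise ?_
  have h1 := List.nodup_cons.1 h.order.1
  have h2 := List.nodup_cons.1 h'.order.1
  rw [List.perm_ext_iff_of_nodup h1.2 h2.2]
  intro a
  have h3 := h.order.2 a
  have h4 := h'.order.2 a
  rw [List.mem_cons] at h3 h4
  constructor
  · intro ha
    refine h4.resolve_left ?_
    rintro rfl
    exact h1.1 ha
  · intro ha
    refine h3.resolve_left ?_
    rintro rfl
    exact h2.1 ha

theorem IsTieBreakOrder.mem {G : SimpleGraph V} {s : V} {ρ π B W : List V}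
    (hW : IsTieBreakOrder G s ρ π B W) (v : V) :
    v = s ∨ v ∈ W.reverse := by
  simpa using hW.order.2 v

theorem List.Pairwise.rel_of_idxOf_lt {R : V → V → Prop} {l : List V} (h : l.Pairwise R) {a b : V}
    (hb : b ∈ l) (hab : l.idxOf a < l.idxOf b) : R a b := by
  have h1 := List.idxOf_lt_length_of_mem hb
  have := List.pairwise_iff_getElem.1 h (l.idxOf a) (l.idxOf b) (hab.trans h1) h1 hab
  simpa using this

variable {G : SimpleGraph V} [DecidableRel G.Adj] {s : V} {ρ π B W : List V}

/-- The parent of `x` is a left neighbour of `x` but not of itself, and the other left neighbours of `x`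
and of the parent precede the parent in `B`. So `x` precedes its parent in the tie-breaking list. -/
theorem IsCliqueOrder.tieBreakLT_parent (h : IsCliqueOrder G s ρ π)
    (hB : IsTopological (lastInParent G π) B) {x q : V} (hq : lastInParent G π x = some q) :
    TieBreakLT G ρ π B.reverse x q := by
  refine Or.inl (lexGT_iff.2 ?_)
  obtain ⟨A, C, hAC, -, -, -, hC⟩ := hB.order.exists_split q
  refine ⟨C.reverse, q, A.reverse, by simp [hAC], ⟨h.adj_parent hq, h.parent_lt hq⟩,
    fun h' => G.irrefl h'.1, fun u hu => iff_of_false ?_ ?_⟩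
  · rintro ⟨h1, h2⟩
    rw [List.mem_reverse, hC] at hu
    rcases h.eq_or_adj_parent hq h1 h2 with rfl | ⟨h3, h4⟩
    · omega
    · have := (h.idxOf_lt_iff hB h3).2 h4
      omega
  · rintro ⟨h1, h2⟩
    rw [List.mem_reverse, hC] at hu
    have := (h.idxOf_lt_iff hB h1).2 h2
    omega

/-- In the tie-break order, which is read from right to left, each vertex comes after its parent. -/
theorem IsCliqueOrder.parent_mem_of_split (h : IsCliqueOrder G s ρ π)
    (hB : IsTopological (lastInParent G π) B) (hW : IsTieBreakOrder G s ρ π B.reverse W)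
    {A C : List V} {x : V} (hx : W.reverse = A ++ x :: C) :
    ∃ q, lastInParent G π x = some q ∧ (q = s ∨ q ∈ A) := by
  have hsW := List.nodup_cons.1 hW.order.1
  have hxs : x ≠ s := by
    rintro rfl
    refine hsW.1 ?_
    rw [← List.mem_reverse, hx]
    simp
  obtain ⟨q, hq⟩ := h.exists_parent hxs
  refine ⟨q, hq, ?_⟩
  by_contra hcon
  push Not at hcon
  have hWx : W = C.reverse ++ x :: A.reverse := by
    rw [← List.reverse_reverse W, hx]
    simp
  have hqC : q ∈ C.reverse := by
    have := hW.order.2 q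
    rw [hWx] at this
    simp only [List.mem_cons, List.mem_append, List.mem_reverse] at this ⊢
    rcases this with h1 | h1 | h1 | h1
    · exact absurd h1 hcon.1
    · exact h1
    · exact absurd h1.symm (h.adj_parent hq).ne'
    · exact absurd h1 hcon.2
  have hp := hW.pairwise
  rw [hWx, List.pairwise_append] at hp
  exact (h.tieBreakLT_parent hB hq).asymm (hp.2.2 q hqC x (by simp))

theorem IsCliqueOrder.isTreeOrder (h : IsCliqueOrder G s ρ π)
    (hB : IsTopological (lastInParent G π) B) (hW : IsTieBreakOrder G s ρ π B.reverse W) :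
    IsTreeOrder (lastInParent G π) s W.reverse (treeOrder (lastInParent G π) s W.reverse) := by
  have hsW := List.nodup_cons.1 hW.order.1
  exact isTreeOrder_treeOrder h.parent_start (List.nodup_cons.2 (by simpa using hsW))
    fun A x C hx => h.parent_mem_of_split hB hW hx

theorem IsTreeOrder.isTopological {p : V → Option V} {W L : List V} (hL : IsTreeOrder p s W L)
    (hW : ∀ v, v = s ∨ v ∈ W) : IsTopological p L :=
  have hmem : ∀ v, v ∈ L := fun v => (hL.mem_iff v).2 (hW v)
  ⟨⟨hL.nodup, hmem⟩, fun {v _} hq => (hL.parent_mem (hmem v) hq).2⟩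

theorem lastInTree_adj_iff {u v : V} : (lastInTree G π).Adj u v ↔
    lastInParent G π u = some v ∨ lastInParent G π v = some u := Iff.rfl

variable {L : List V}

/-- The first unvisited vertex `c` on the tree path from the root to an unvisited vertex `w`. -/
theorem IsCliqueOrder.exists_top_ancestor (h : IsCliqueOrder G s ρ π)
    (hT : IsTopological (lastInParent G π) L) {vis : List V} (hs : s ∈ vis)
    (hvis : ∀ u ∈ vis, ∀ w ∉ vis, L.idxOf u < L.idxOf w) {w : V} (hw : w ∉ vis) :
    ∃ c ∉ vis, (∃ q ∈ vis, lastInParent G π c = some q) ∧ π.idxOf c ≤ π.idxOf w ∧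
      (∀ u ∈ vis, G.Adj u w → G.Adj u c) ∧
      ∀ u, π.idxOf u < π.idxOf c → G.Adj u w → G.Adj u c := by
  induction hk : π.idxOf w using Nat.strong_induction_on generalizing w with
  | _ k ih =>
  subst hk
  have hws : w ≠ s := by
    rintro rfl
    exact hw hs
  obtain ⟨q, hq⟩ := h.exists_parent hws
  by_cases hqv : q ∈ vis
  · exact ⟨w, hw, ⟨q, hqv, hq⟩, le_rfl, fun _ _ h => h, fun _ _ h => h⟩
  · have hlt := h.parent_lt hq
    obtain ⟨c, hc, hcq, hle, h1, h2⟩ := ih _ hlt hqv rfl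
    refine ⟨c, hc, hcq, hle.trans hlt.le, fun u hu huw => h1 u hu ?_, fun u hu huw => h2 u hu ?_⟩
    · refine ((h.eq_or_adj_parent hq huw
        ((h.idxOf_lt_iff hT huw).1 (hvis u hu w hw))).resolve_left ?_).1
      rintro rfl
      exact hqv hu
    · refine ((h.eq_or_adj_parent hq huw (by omega)).resolve_left ?_).1
      rintro rfl
      omega

variable [Fintype V]

theorem label_dfs_eq_singleton {H : SimpleGraph V} [DecidableRel H.Adj] {vis : List V} {w q : V}
    (hn : vis.Nodup) (hq : q ∈ vis) (h : ∀ u ∈ vis, H.Adj u w ↔ u = q) :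
    dfs.label H s vis w = [vis.idxOf q + 1] := by
  induction vis using List.reverseRecOn with
  | nil => simp at hq
  | append_singleton vis u ih =>
    rw [SearchRule.label_append_singleton]
    by_cases huq : u = q
    · have hu : u ∉ vis := fun hu => by
        rw [List.nodup_append] at hn
        exact hn.2.2 u hu u (by simp) rfl
      rw [if_pos ((h u (by simp)).2 huq), ← huq, List.idxOf_append_of_notMem hu]
      simp [dfs]
    · have hqv : q ∈ vis := by
        simp only [List.mem_append, List.mem_singleton] at hq
        exact hq.resolve_right (Ne.symm huq)
      rw [if_neg (mt (h u (by simp)).1 huq), ih hn.of_append_left hqv fun v hv => h v (by simp [hv]),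
        List.idxOf_append_of_mem hqv]

/-- The label of an unvisited vertex records only its parent in the tree. So a depth first search
visits the unvisited children of the most recently visited vertex first, and among them the
rightmost in `τ`; this is the child that has been inserted last. -/
theorem IsCliqueOrder.dfs_plus_eq (h : IsCliqueOrder G s ρ π)
    (hW : IsTieBreakOrder G s ρ π B.reverse W)
    (hL : IsTreeOrder (lastInParent G π) s W.reverse L) :
    dfs.plus (lastInTree G π) s (s :: W).reverse = L := by
  have hT := hL.isTopological hW.mem
  have hsW := List.nodup_cons.1 hW.order.1
  refine SearchRule.plus_eq_of_forall hW.order.reverse hT.order fun vis v rest hvis w hw => ?_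
  have hO := hT.order
  rw [hvis] at hO
  have hwv : L.idxOf v < L.idxOf w := by
    rw [hvis]
    exact hO.mem_right.1 hw
  have hvisL : ∀ u, u ∈ vis ↔ L.idxOf u < L.idxOf v := fun u => by
    rw [hvis]
    exact hO.mem_left
  have hws : w ≠ s := ne_start_of_idxOf_lt hL.start hwv
  -- the only possible visited neighbour of an unvisited vertex is its parent
  have hadj : ∀ x, ¬ L.idxOf x < L.idxOf v → ∀ u ∈ vis, (lastInTree G π).Adj u x →
      lastInParent G π x = some u := by
    intro x hx u hu hux
    refine (lastInTree_adj_iff.1 hux).resolve_left fun h' => ?_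
    have := hT.parent_lt h'
    have := (hvisL u).1 hu
    omega
  have hlabel : ∀ x q, ¬ L.idxOf x < L.idxOf v → lastInParent G π x = some q → q ∈ vis →
      dfs.label (lastInTree G π) s vis x = [L.idxOf q + 1] := by
    intro x q hx hq hqvis
    rw [label_dfs_eq_singleton hO.1.of_append_left hqvis fun u hu =>
      ⟨fun h' => ?_, fun h' => ?_⟩, hvis, List.idxOf_append_of_mem hqvis]
    · have := hadj x hx u hu h'
      rw [hq] at this
      simpa using this.symm
    · rw [h']
      exact lastInTree_adj_iff.2 (Or.inr hq)
  by_cases hvs : v = s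
  · left
    have hvis0 : vis = [] := List.eq_nil_iff_forall_not_mem.2 fun u hu => by
      have := (hvisL u).1 hu
      rw [hvs, hL.start] at this
      omega
    rw [hvis0, SearchRule.label_nil, SearchRule.label_nil, if_pos hvs, if_neg hws]
    exact List.nil_lt_cons _ _
  · obtain ⟨r, hr⟩ := h.exists_parent hvs
    have hrvis : r ∈ vis := (hvisL r).2 (hT.parent_lt hr)
    obtain ⟨q, hq⟩ := h.exists_parent hws
    rw [hlabel v r (lt_irrefl _) hr hrvis]
    by_cases hqvis : q ∈ vis
    · rw [hlabel w q (by omega) hq hqvis]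
      obtain ⟨r', hr', h'⟩ := hL.lt_or_eq (hT.order.2 v) (hT.order.2 w) hwv hq ((hvisL q).1 hqvis)
      obtain rfl : r = r' := by simpa [hr] using hr'
      rcases h' with h' | ⟨rfl, h'⟩
      · exact Or.inl (List.Lex.rel (by omega))
      · refine Or.inr ⟨rfl, ?_⟩
        rw [List.reverse_cons, List.idxOf_append_of_mem ((hW.mem w).resolve_left hws),
          List.idxOf_append_of_mem ((hW.mem v).resolve_left hvs)]
        exact h'.le
    · left
      rw [SearchRule.label_eq_nil_of_forall_not_adj vis hws fun u hu hux => ?_]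
      · exact List.nil_lt_cons _ _
      · have := hadj w (by omega) u hu hux
        rw [hq] at this
        simp only [Option.some.injEq] at this
        exact hqvis (this ▸ hu)

/-- An unvisited vertex `w` does not beat the first unvisited vertex `c` on its tree path, and `c` does
not beat the next vertex `v` of the depth first order of the tree. -/
theorem IsCliqueOrder.lexDFS_plus_eq (h : IsCliqueOrder G s ρ π) (hρ : IsVertexOrder ρ)
    (hB : IsTopological (lastInParent G π) B) (hW : IsTieBreakOrder G s ρ π B.reverse W)
    (hL : IsTreeOrder (lastInParent G π) s W.reverse L) :
    lexDFS.plus G s ρ = L := by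
  have hT := hL.isTopological hW.mem
  refine SearchRule.plus_eq_of_forall hρ hT.order fun vis v rest hvis w hw => ?_
  have hO := hT.order
  rw [hvis] at hO
  have hwv : L.idxOf v < L.idxOf w := by
    rw [hvis]
    exact hO.mem_right.1 hw
  have hvisL : ∀ u, u ∈ vis ↔ L.idxOf u < L.idxOf v := fun u => by
    rw [hvis]
    exact hO.mem_left
  have hws : w ≠ s := ne_start_of_idxOf_lt hL.start hwv
  by_cases hvs : v = s
  · left
    have hvis0 : vis = [] := List.eq_nil_iff_forall_not_mem.2 fun u hu => by
      have := (hvisL u).1 hu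
      rw [hvs, hL.start] at this
      omega
    rw [hvis0, SearchRule.label_nil, SearchRule.label_nil, if_pos hvs, if_neg hws]
    exact List.nil_lt_cons _ _
  have hsvis : s ∈ vis := by
    rw [hvisL, hL.start]
    have := mt hT.order.idxOf_inj.1 hvs
    rw [hL.start] at this
    omega
  have hwvis : w ∉ vis := fun h' => by
    have := (hvisL w).1 h'
    omega
  obtain ⟨c, hc, ⟨q, hqvis, hq⟩, hcw, hsub, hsub'⟩ := h.exists_top_ancestor hT hsvis
    (fun u hu x hx => by
      have := (hvisL u).1 hu
      have := mt (hvisL x).2 hx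
      omega) hwvis
  have hcs : c ≠ s := h.ne_start_of_parent hq
  -- neighbours of a vertex to its left lie to the left of it in `L`, too
  have hleft : ∀ {u x : V}, u ∈ vis → x ∉ vis → G.Adj u x → LeftAdj G π u x := by
    intro u x hu hx hux
    refine ⟨hux, (h.idxOf_lt_iff hT hux).1 ?_⟩
    have := (hvisL u).1 hu
    have := mt (hvisL x).2 hx
    omega
  have hleq : ∀ {u x y : V}, lastInParent G π x = some y → LeftAdj G π u x →
      L.idxOf u ≤ L.idxOf y := by
    intro u x y hy hu
    rcases h.eq_or_adj_parent hy hu.1 hu.2 with rfl | ⟨h1, h2⟩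
    · exact le_rfl
    · exact ((h.idxOf_lt_iff hT h1).2 h2).le
  have hvv : v ∉ vis := fun h' => lt_irrefl _ ((hvisL v).1 h')
  -- comparison of `c` with `v`, which are children of visited vertices
  have hcv : lexDFS.label G s vis c < lexDFS.label G s vis v ∨
      (lexDFS.label G s vis c = lexDFS.label G s vis v ∧ ρ.idxOf c ≤ ρ.idxOf v) := by
    by_cases hcv : c = v
    · exact Or.inr ⟨by rw [hcv], by rw [hcv]⟩
    have hvc : L.idxOf v < L.idxOf c :=
      lt_of_le_of_ne (not_lt.1 (mt (hvisL c).2 hc)) fun he => hcv (hT.order.idxOf_inj.1 he).symm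
    obtain ⟨r, hr, h'⟩ := hL.lt_or_eq (hT.order.2 v) (hT.order.2 c) hvc hq ((hvisL q).1 hqvis)
    have hrvis : r ∈ vis := (hvisL r).2 (hT.parent_lt hr)
    have hvisO : vis.Nodup := hO.1.of_append_left
    have hvisidx : ∀ u ∈ vis, vis.idxOf u = L.idxOf u := fun u hu => by
      rw [hvis, List.idxOf_append_of_mem hu]
    rcases h' with h' | ⟨rfl, h'⟩
    · left
      refine SearchRule.label_lexDFS_lt vis hvs hcs (lexGT_iff.2 ?_)
      obtain ⟨A, C, hAC⟩ := List.append_of_mem hrvis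
      refine ⟨C.reverse, r, A.reverse, by simp [hAC], h.adj_parent hr, fun hrc => ?_, fun u hu => ?_⟩
      · have := hleq hq (hleft hrvis hc hrc)
        omega
      · have hu' : u ∈ vis := by
          rw [hAC]
          simp at hu
          simp [hu]
        have hru : L.idxOf r < L.idxOf u := by
          have hA : r ∉ A ∧ u ∉ A ∧ u ≠ r := by
            rw [hAC, List.nodup_append, List.nodup_cons] at hvisO
            rw [List.mem_reverse] at hu
            refine ⟨fun h' => hvisO.2.2 r h' r (by simp) rfl,
              fun h' => hvisO.2.2 u h' u (by simp [hu]) rfl, ?_⟩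
            rintro rfl
            exact hvisO.2.1.1 hu
          rw [← hvisidx r hrvis, ← hvisidx u hu', hAC, List.idxOf_append_of_notMem hA.1,
            List.idxOf_append_of_notMem hA.2.1, List.idxOf_cons_self,
            List.idxOf_cons_ne _ hA.2.2.symm]
          omega
        refine iff_of_false (fun huv => ?_) fun huc => ?_
        · have := hleq hr (hleft hu' hvv huv)
          omega
        · have := hleq hq (hleft hu' hc huc)
          omega
    · have hlt : TieBreakLT G ρ π B.reverse v c := by
        have h1 : c ∈ W := by simpa using (hW.mem c).resolve_left hcs
        have h2 : v ∈ W := by simpa using (hW.mem v).resolve_left hvs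
        refine hW.pairwise.rel_of_idxOf_lt h1 ?_
        have hW' := (List.nodup_cons.1 hW.order.1).2
        obtain ⟨W₁, W₂, hW12⟩ := List.append_of_mem h2
        rw [hW12] at h' h1 hW' ⊢
        rw [List.nodup_append, List.nodup_cons] at hW'
        have hv1 : v ∉ W₁ := fun h' => hW'.2.2 v h' v (by simp) rfl
        simp only [List.mem_append, List.mem_cons] at h1
        rcases h1 with h1 | h1 | h1
        · exfalso
          have h3 : c ∉ W₂.reverse ++ [v] := by
            simp only [List.mem_append, List.mem_reverse, List.mem_singleton]
            rintro (h4 | h4)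
            · exact hW'.2.2 c h1 c (by simp [h4]) rfl
            · exact hcv h4
          rw [List.reverse_append, List.reverse_cons, List.idxOf_append_of_notMem h3,
            List.idxOf_append_of_mem (a := v) (by simp)] at h'
          have := List.idxOf_lt_length_of_mem (a := v) (l := W₂.reverse ++ [v]) (by simp)
          omega
        · exact absurd h1 hcv
        · have h3 : c ∉ W₁ := fun h4 => hW'.2.2 c h4 c (by simp [h1]) rfl
          rw [List.idxOf_append_of_notMem hv1, List.idxOf_append_of_notMem h3, List.idxOf_cons_self,
            List.idxOf_cons_ne _ (Ne.symm hcv)]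
          omega
      rcases hlt with hlt | ⟨h1, h2⟩
      · left
        refine SearchRule.label_lexDFS_lt vis hvs hcs (lexGT_iff.2 ?_)
        obtain ⟨D₁, u, D₂, hD, hu1, hu2, hu3⟩ := lexGT_iff.1 hlt
        have huL : L.idxOf u < L.idxOf v := (h.idxOf_lt_iff hT hu1.1).2 hu1.2
        have huvis := (hvisL u).2 huL
        have huq : LeftAdj G π u q := by
          refine (h.eq_or_adj_parent hr hu1.1 hu1.2).resolve_left ?_
          rintro rfl
          exact hu2 ⟨h.adj_parent hq, h.parent_lt hq⟩
        have hDB : ∀ x, B.idxOf u < B.idxOf x → x ∈ D₁ := by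
          intro x hx
          have hBr := hB.order.reverse
          rw [hD] at hBr
          rw [hBr.mem_left, ← hD, hB.order.idxOf_reverse_lt]
          exact hx
        obtain ⟨A, C, hAC⟩ := List.append_of_mem huvis
        have hAn : u ∉ A := fun h' => by
          rw [hAC, List.nodup_append] at hvisO
          exact hvisO.2.2 u h' u (by simp) rfl
        refine ⟨C.reverse, u, A.reverse, by simp [hAC], hu1.1, fun huc => hu2 (hleft huvis hc huc),
          fun x hx => ?_⟩
        have hx' : x ∈ vis := by
          rw [hAC]
          simp at hx
          simp [hx]
        have hux : L.idxOf u < L.idxOf x := by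
          have hA : x ∉ A ∧ x ≠ u := by
            rw [hAC, List.nodup_append, List.nodup_cons] at hvisO
            rw [List.mem_reverse] at hx
            refine ⟨fun h' => hvisO.2.2 x h' x (by simp [hx]) rfl, ?_⟩
            rintro rfl
            exact hvisO.2.1.1 hx
          rw [← hvisidx u huvis, ← hvisidx x hx', hAC, List.idxOf_append_of_notMem hAn,
            List.idxOf_append_of_notMem hA.1, List.idxOf_cons_self,
            List.idxOf_cons_ne _ hA.2.symm]
          omega
        have hxu : x ≠ u := by
          rintro rfl
          omega
        -- `x` and `u` lie in a clique, so `B` orders them like `L`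
        have key : G.Adj u x → (LeftAdj G π x v ↔ LeftAdj G π x c) := fun hadj => by
          refine hu3 x (hDB x ?_)
          rw [h.idxOf_lt_iff hB hadj, ← h.idxOf_lt_iff hT hadj]
          exact hux
        constructor
        · intro hxv
          have h3 := hleft hx' hvv hxv
          exact ((key (h.clique hu1.1 hu1.2 h3.1 h3.2 hxu.symm)).1 h3).1
        · intro hxc
          have h3 := hleft hx' hc hxc
          rcases h.eq_or_adj_parent hq h3.1 h3.2 with rfl | h4
          · exact h.adj_parent hr
          · exact ((key (h.clique huq.1 huq.2 h4.1 h4.2 hxu.symm)).2 h3).1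
      · right
        refine ⟨SearchRule.label_congr lexDFS vis hcs hvs fun u hu => ⟨fun h3 => ?_, fun h3 => ?_⟩,
          h2.le⟩
        · exact ((h1 u).2 (hleft hu hc h3)).1
        · exact ((h1 u).1 (hleft hu hvv h3)).1
  rcases lexGT_trichotomy vis.reverse (fun u => G.Adj u w) (fun u => G.Adj u c) with h1 | h1 | h1
  · obtain ⟨D₁, u, D₂, hD, hu1, hu2, -⟩ := lexGT_iff.1 h1
    have : u ∈ vis := by
      rw [← List.mem_reverse, hD]
      simp
    exact absurd (hsub u this hu1) hu2
  · left
    have h2 := SearchRule.label_lexDFS_lt vis hcs hws h1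
    exact hcv.elim h2.trans fun h3 => h3.1 ▸ h2
  · have h2 : lexDFS.label G s vis w = lexDFS.label G s vis c :=
      SearchRule.label_congr lexDFS vis hws hcs fun u hu => h1 u (by simpa using hu)
    rw [h2]
    refine hcv.imp_right fun h3 => ⟨h3.1, le_trans ?_ h3.2⟩
    rcases eq_or_lt_of_le hcw with h4 | h4
    · rw [h.order.idxOf_inj.1 h4]
    · refine h.tie hcs h4 fun u hu => ⟨fun huc => ?_, hsub' u hu⟩
      have huvis : u ∈ vis := by
        rw [hvisL]
        have h5 := hleq hq ⟨huc, hu⟩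
        have h6 := (hvisL q).1 hqvis
        omega
      exact (h1 u (by simpa using huvis)).2 huc

end Correctness

/-! ### The ordering procedure -/

section Partition

variable {V : Type*} [DecidableEq V]

/-- The ordered partition `Q` arranges the vertices by their memberships in the sets `S u`, `u ∈ D`,
compared lexicographically. -/
structure IsLexPartition (D : List V) (S : V → V → Prop) (Q : List (Finset V)) : Prop where
  nonempty : ∀ q ∈ Q, q.Nonempty
  same : ∀ q ∈ Q, ∀ x ∈ q, ∀ y ∈ q, ∀ u ∈ D, S u x ↔ S u y
  pairwise : Q.Pairwise fun q q' => ∀ x ∈ q, ∀ y ∈ q', LexGT D (S · x) (S · y)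
  exists_mem : ∀ x, ∃ q ∈ Q, x ∈ q

theorem IsLexPartition.refine {D : List V} {S : V → V → Prop} {Q : List (Finset V)}
    (h : IsLexPartition D S Q) (v : V) (T : Finset V) (hT : ∀ w, w ∈ T ↔ S v w) :
    IsLexPartition (D ++ [v]) S (refinePartition Q T) := by
  have hsub : ∀ q q', q' ∈ (if (q ∩ T).Nonempty ∧ (q \ T).Nonempty then [q ∩ T, q \ T] else [q]) →
      q' ⊆ q := by
    intro q q' hq'
    split at hq'
    · simp only [List.mem_cons, List.not_mem_nil, or_false] at hq'
      rcases hq' with rfl | rfl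
      · exact Finset.inter_subset_left
      · exact Finset.sdiff_subset
    · simp only [List.mem_cons, List.not_mem_nil, or_false] at hq'
      exact hq'.subset
  refine ⟨fun q' hq' => ?_, fun q' hq' x hx y hy u hu => ?_, ?_, fun x => ?_⟩
  · obtain ⟨q, hq, hq'⟩ := List.mem_flatMap.1 hq'
    split at hq'
    · rename_i hne
      simp only [List.mem_cons, List.not_mem_nil, or_false] at hq'
      rcases hq' with rfl | rfl
      · exact hne.1
      · exact hne.2
    · simp only [List.mem_cons, List.not_mem_nil, or_false] at hq'
      exact hq' ▸ h.nonempty q hq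
  · obtain ⟨q, hq, hq'⟩ := List.mem_flatMap.1 hq'
    rw [List.mem_append, List.mem_singleton] at hu
    rcases hu with hu | rfl
    · exact h.same q hq x (hsub q q' hq' hx) y (hsub q q' hq' hy) u hu
    · rw [← hT, ← hT]
      split at hq'
      · simp only [List.mem_cons, List.not_mem_nil, or_false] at hq'
        rcases hq' with rfl | rfl
        · simp only [Finset.mem_inter] at hx hy
          exact iff_of_true hx.2 hy.2
        · simp only [Finset.mem_sdiff] at hx hy
          exact iff_of_false hx.2 hy.2
      · rename_i hne
        simp only [List.mem_cons, List.not_mem_nil, or_false] at hq'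
        subst hq'
        by_contra hcon
        refine hne ?_
        by_cases hxT : x ∈ T
        · have hyT : y ∉ T := fun hyT => hcon (iff_of_true hxT hyT)
          exact ⟨⟨x, by simp [hx, hxT]⟩, ⟨y, by simp [hy, hyT]⟩⟩
        · have hyT : y ∈ T := by
            by_contra hyT
            exact hcon (iff_of_false hxT hyT)
          exact ⟨⟨y, by simp [hy, hyT]⟩, ⟨x, by simp [hx, hxT]⟩⟩
  · refine List.pairwise_flatMap.2 ⟨fun q hq => ?_, h.pairwise.imp fun {q₁ q₂} h12 => ?_⟩
    · split
      · refine List.pairwise_pair.2 fun x hx y hy => lexGT_append_singleton.2 (Or.inr ?_)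
        simp only [Finset.mem_inter, Finset.mem_sdiff] at hx hy
        rw [← hT, ← hT]
        exact ⟨h.same q hq x hx.1 y hy.1, hx.2, hy.2⟩
      · exact List.pairwise_singleton _ _
    · intro q₁' h1 q₂' h2 x hx y hy
      exact lexGT_append_singleton.2 (Or.inl (h12 x (hsub _ _ h1 hx) y (hsub _ _ h2 hy)))
  · obtain ⟨q, hq, hxq⟩ := h.exists_mem x
    by_cases hne : (q ∩ T).Nonempty ∧ (q \ T).Nonempty
    · by_cases hxT : x ∈ T
      · exact ⟨q ∩ T, List.mem_flatMap.2 ⟨q, hq, by simp [hne]⟩, by simp [hxq, hxT]⟩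
      · exact ⟨q \ T, List.mem_flatMap.2 ⟨q, hq, by simp [hne]⟩, by simp [hxq, hxT]⟩
    · exact ⟨q, List.mem_flatMap.2 ⟨q, hq, by simp [hne]⟩, hxq⟩

variable [Fintype V]

/-- Successive refinement of the trivial partition by the sets `T v`, for `v` in `D`, sorts the vertices
lexicographically. -/
theorem isLexPartition_foldl [Nonempty V] (D : List V) (T : V → Finset V) :
    IsLexPartition D (fun u w => w ∈ T u)
      (D.foldl (fun Q v => refinePartition Q (T v)) [Finset.univ]) := by
  induction D using List.reverseRecOn with
  | nil => refine ⟨by simp, by simp, by simp, by simp⟩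
  | append_singleton D v ih =>
    rw [List.foldl_append]
    exact ih.refine v (T v) fun w => Iff.rfl

theorem IsVertexOrder.pairwise_reverse {V : Type*} [DecidableEq V] {ρ : List V}
    (hρ : IsVertexOrder ρ) : ρ.reverse.Pairwise fun a b => ρ.idxOf b < ρ.idxOf a := by
  rw [List.pairwise_reverse]
  have := pairwise_idxOf_of_append (A := ρ) (B := []) (by simpa using hρ.1)
  simpa using this

variable {G : SimpleGraph V} [DecidableRel G.Adj] {s : V} {ρ π B : List V}

/-- The tie-break order of the ordering procedure is the lexicographic order of the sets of left
neighbours in `π`. -/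
theorem IsCliqueOrder.exists_orderingTieBreak_eq (h : IsCliqueOrder G s ρ π)
    (hρ : IsVertexOrder ρ) (hB : IsTopological (lastInParent G π) B) :
    ∃ W, IsTieBreakOrder G s ρ π B.reverse W ∧
      orderingTieBreak G s ρ B.reverse = (s :: W).reverse := by
  have : Nonempty V := ⟨s⟩
  have hQ := isLexPartition_foldl B.reverse fun v =>
    ((leftOf B.reverse v).filter (fun w => G.Adj v w)).toFinset
  change IsLexPartition _ _ (orderingPartition G B.reverse) at hQ
  have hS : (fun u w => w ∈ ((leftOf B.reverse u).filter (fun w => G.Adj u w)).toFinset) =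
      LeftAdj G π := by
    funext u w
    simp only [List.mem_toFinset, List.mem_filter, mem_leftOf hB.order.reverse,
      hB.order.idxOf_reverse_lt, decide_eq_true_eq, LeftAdj, eq_iff_iff]
    rw [and_comm]
    exact and_congr_right fun huw => h.idxOf_lt_iff hB huw
  rw [hS] at hQ
  unfold orderingTieBreak
  generalize orderingPartition G B.reverse = Q at hQ
  have hmem : ∀ u, u ∈ B.reverse := hB.order.reverse.2
  have hs : ∀ q ∈ Q, s ∈ q → q = {s} := by
    intro q hq hsq
    ext x
    rw [Finset.mem_singleton]
    refine ⟨fun hx => ?_, fun hx => hx ▸ hsq⟩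
    by_contra hxs
    obtain ⟨r, hr⟩ := h.exists_parent hxs
    have := ((hQ.same q hq x hx s hsq r (hmem r)).1 ⟨h.adj_parent hr, h.parent_lt hr⟩).2
    rw [h.start] at this
    omega
  have hQn : Q.Nodup := by
    refine List.Pairwise.imp_of_mem (fun {q q'} hq _ hqq' heq => ?_) hQ.pairwise
    obtain ⟨x, hx⟩ := hQ.nonempty q hq
    have := hqq' x hx x (heq ▸ hx)
    exact this.asymm this
  have hpw : ((Q.erase {s}).flatMap fun q => ρ.reverse.filter (fun v => v ∈ q)).Pairwise
      (TieBreakLT G ρ π B.reverse) := by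
    refine List.pairwise_flatMap.2 ⟨fun q hq => ?_, ?_⟩
    · refine List.Pairwise.imp_of_mem (fun {x y} hx hy hxy => Or.inr ⟨fun u => ?_, hxy⟩)
        (hρ.pairwise_reverse.filter _)
      exact hQ.same q (List.mem_of_mem_erase hq) x (by simpa using (List.mem_filter.1 hx).2)
        y (by simpa using (List.mem_filter.1 hy).2) u (hmem u)
    · refine List.Pairwise.imp (fun {q q'} hqq' => ?_)
        (hQ.pairwise.sublist (List.erase_sublist (l := Q) (a := {s})))
      exact fun x hx y hy => Or.inl <| hqq' x (by simpa using (List.mem_filter.1 hx).2) y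
        (by simpa using (List.mem_filter.1 hy).2)
  have hfs : (ρ.reverse.filter fun v => v ∈ ({s} : Finset V)) = [s] := by
    have h1 : (ρ.reverse.filter fun v => v ∈ ({s} : Finset V)).Nodup := hρ.reverse.1.filter _
    have h2 : ∀ v, v ∈ (ρ.reverse.filter fun v => v ∈ ({s} : Finset V)) ↔ v = s := fun v => by
      simp [hρ.2 v]
    refine List.perm_singleton.1 ((List.perm_ext_iff_of_nodup h1 (List.nodup_singleton s)).2 ?_)
    simpa using fun v => h2 v
  refine ⟨_, ⟨⟨List.nodup_cons.2 ⟨fun hsW => ?_, ?_⟩, fun v => ?_⟩, hpw⟩, ?_⟩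
  · obtain ⟨q, hq, hsq⟩ := List.mem_flatMap.1 hsW
    have h1 := (List.mem_filter.1 hsq).2
    rw [hQn.mem_erase_iff] at hq
    exact hq.1 (hs q hq.2 (by simpa using h1))
  · refine List.Pairwise.imp (fun {x y} hxy => ?_) hpw
    rintro rfl
    exact hxy.asymm hxy
  · rw [List.mem_cons]
    by_cases hv : v = s
    · exact Or.inl hv
    · right
      obtain ⟨q, hq, hvq⟩ := hQ.exists_mem v
      refine List.mem_flatMap.2 ⟨q, ?_, by simp [hρ.2 v, hvq]⟩
      rw [hQn.mem_erase_iff]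
      refine ⟨?_, hq⟩
      rintro rfl
      exact hv (Finset.mem_singleton.1 hvq)
  · rw [List.flatMap_cons, hfs]
    rfl

/-- Breadth first search of the last-in tree visits parents before their children. -/
theorem IsCliqueOrder.isTopological_of_bfs (h : IsCliqueOrder G s ρ π)
    (hB : bfs.IsSearchOrder (lastInTree G π) s B) : IsTopological (lastInParent G π) B := by
  have hbfs : bfs.start (Fintype.card V) ≠ [] := by simp [bfs]
  have hcross : ∀ (A : List V) (v : V), s ∈ A → v ∉ A → ∃ u ∈ A, ∃ x ∉ A,
      (lastInTree G π).Adj u x := by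
    intro A v hs hv
    induction hk : π.idxOf v using Nat.strong_induction_on generalizing v with
    | _ k ih =>
    have hvs : v ≠ s := by
      rintro rfl
      exact hv hs
    obtain ⟨q, hq⟩ := h.exists_parent hvs
    by_cases hqA : q ∈ A
    · exact ⟨q, hqA, v, hv, Or.inr hq⟩
    · exact ih _ (hk ▸ h.parent_lt hq) q hqA rfl
  refine ⟨hB.1, fun {v q} hq => ?_⟩
  induction hk : B.idxOf v using Nat.strong_induction_on generalizing v q with
  | _ k ih =>
  subst hk
  obtain ⟨u, hu, huv⟩ := hB.exists_adj_lt hbfs (fun i l => by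
    simp only [bfs]
    split <;> simp [*]) hcross (h.ne_start_of_parent hq)
  rcases hu with hu | hu
  · obtain rfl : q = u := by simpa [hq] using hu
    exact huv
  · have := ih _ huv hu rfl
    omega

end Partition

section Run

variable {V : Type*} [Fintype V] [DecidableEq V] {G : SimpleGraph V} [DecidableRel G.Adj] {s : V}
  {ρ π β τ σ : List V}

/-- The orders of a run of the algorithm in terms of insertions into the last-in tree. -/
theorem IsRun.exists_tieBreakOrder (h : IsValidInput G s ρ) (hrun : IsRun G s ρ π β τ σ) :
    ∃ W, IsTieBreakOrder G s ρ π β W ∧ τ = (s :: W).reverse ∧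
      IsTreeOrder (lastInParent G π) s W.reverse σ ∧ σ = lexDFS.plus G s ρ := by
  obtain ⟨rfl, hβ, rfl, rfl⟩ := hrun
  have hC := isCliqueOrder_lexBFS_plus h
  have hB := hC.isTopological_of_bfs hβ
  obtain ⟨W, hW, hτ⟩ := hC.exists_orderingTieBreak_eq h.order hB
  have hL := hC.isTreeOrder hB hW
  rw [List.reverse_reverse] at hW hτ
  rw [hτ, hC.dfs_plus_eq (B := β.reverse) (by rwa [List.reverse_reverse]) hL]
  exact ⟨W, hW, rfl, hL, (hC.lexDFS_plus_eq h.order hB (by rwa [List.reverse_reverse]) hL).symm⟩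

theorem exists_isRun (h : IsValidInput G s ρ) : ∃ π β τ σ : List V, IsRun G s ρ π β τ σ := by
  refine ⟨_, (bfs.plus (lastInTree G (lexBFS.plus G s ρ)) s ρ).reverse, _, _, rfl, ?_, rfl, rfl⟩
  rw [List.reverse_reverse]
  exact SearchRule.plus_isSearchOrder h.order

theorem IsRun.eq_lexDFS_plus (h : IsValidInput G s ρ) (hrun : IsRun G s ρ π β τ σ) :
    σ = lexDFS.plus G s ρ ∧ IsVertexOrder σ ∧ σ.head? = some s := by
  obtain ⟨W, hW, -, hσ, heq⟩ := hrun.exists_tieBreakOrder h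
  refine ⟨heq, (hσ.isTopological hW.mem).order, ?_⟩
  have hs := (hσ.isTopological hW.mem).order.2 s
  have h0 := hσ.start
  rcases σ with _ | ⟨a, l⟩
  · simp at hs
  · by_contra hne
    rw [List.idxOf_cons_ne _ (by simpa using hne)] at h0
    omega

end Run

/-! ### Programs of the random access machine -/

namespace RAM

namespace Store

/-- Assign the value `k` to the variable `x`. -/
def setVar (st : Store) (x k : ℕ) : Store :=
  { st with var := Function.update st.var x k }

/-- Write the value `k` into cell `i` of the array `a`. -/
def setArr (st : Store) (a i k : ℕ) : Store :=
  { st with arr := Function.update st.arr a (Function.update (st.arr a) i k) }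

@[simp]
theorem setVar_var (st : Store) (x k y : ℕ) :
    (st.setVar x k).var y = if y = x then k else st.var y :=
  Function.update_apply st.var x k y

@[simp]
theorem setVar_arr (st : Store) (x k : ℕ) : (st.setVar x k).arr = st.arr := rfl

@[simp]
theorem setArr_var (st : Store) (a i k : ℕ) : (st.setArr a i k).var = st.var := rfl

@[simp]
theorem setArr_arr (st : Store) (a i k b : ℕ) :
    (st.setArr a i k).arr b = if b = a then Function.update (st.arr a) i k else st.arr b :=
  Function.update_apply st.arr a _ b

theorem setVar_comm (st : Store) {x y : ℕ} (h : x ≠ y) (k l : ℕ) :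
    (st.setVar x k).setVar y l = (st.setVar y l).setVar x k := by
  simp [setVar, Function.update_comm h]

theorem setVar_self (st : Store) (x : ℕ) : st.setVar x (st.var x) = st := by
  simp [setVar]

end Store

namespace Prog

/-- The variables that a program may change. -/
def vars : Prog → List ℕ
  | skip => []
  | assign x _ => [x]
  | write _ _ _ => []
  | seq p q => p.vars ++ q.vars
  | ite _ p q => p.vars ++ q.vars
  | loop _ p => p.vars

/-- The arrays that a program may change. -/
def arrs : Prog → List ℕ
  | skip => []
  | assign _ _ => []
  | write a _ _ => [a]
  | seq p q => p.arrs ++ q.arrs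
  | ite _ p q => p.arrs ++ q.arrs
  | loop _ p => p.arrs

/-- The programs without loops. -/
def LoopFree : Prog → Prop
  | skip => True
  | assign _ _ => True
  | write _ _ _ => True
  | seq p q => p.LoopFree ∧ q.LoopFree
  | ite _ p q => p.LoopFree ∧ q.LoopFree
  | loop _ _ => False

open Classical in
/-- The result of a program without loops. (A loop is treated like `skip`.) -/
noncomputable def exec : Prog → Store → Store
  | skip, st => st
  | assign x e, st => st.setVar x (e.eval st)
  | write a i e, st => st.setArr a (i.eval st) (e.eval st)
  | seq p q, st => q.exec (p.exec st)
  | ite b p q, st => if b.Holds st then p.exec st else q.exec st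
  | loop _ _, st => st

/-- An upper bound for the running time of a program without loops. -/
def maxCost : Prog → ℕ
  | skip => 1
  | assign _ e => e.cost + 1
  | write _ i e => i.cost + e.cost + 1
  | seq p q => p.maxCost + q.maxCost
  | ite b p q => b.cost + max p.maxCost q.maxCost
  | loop _ _ => 0

end Prog

theorem Runs.var_eq {p : Prog} {st st' : Store} {t : ℕ} (h : Runs p st t st') {x : ℕ}
    (hx : x ∉ p.vars) : st'.var x = st.var x := by
  induction h with
  | skip => rfl
  | assign y e st =>
    simp only [Prog.vars, List.mem_singleton] at hx
    simp [hx]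
  | write => rfl
  | seq _ _ ih1 ih2 =>
    simp only [Prog.vars, List.mem_append, not_or] at hx
    rw [ih2 hx.2, ih1 hx.1]
  | ite_true _ _ ih =>
    simp only [Prog.vars, List.mem_append, not_or] at hx
    exact ih hx.1
  | ite_false _ _ ih =>
    simp only [Prog.vars, List.mem_append, not_or] at hx
    exact ih hx.2
  | loop_true _ _ _ ih1 ih2 => rw [ih2 hx, ih1 hx]
  | loop_false => rfl

theorem Runs.arr_eq {p : Prog} {st st' : Store} {t : ℕ} (h : Runs p st t st') {a : ℕ}
    (ha : a ∉ p.arrs) : st'.arr a = st.arr a := by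
  induction h with
  | skip => rfl
  | assign => rfl
  | write b i e st =>
    simp only [Prog.arrs, List.mem_singleton] at ha
    simp [ha]
  | seq _ _ ih1 ih2 =>
    simp only [Prog.arrs, List.mem_append, not_or] at ha
    rw [ih2 ha.2, ih1 ha.1]
  | ite_true _ _ ih =>
    simp only [Prog.arrs, List.mem_append, not_or] at ha
    exact ih ha.1
  | ite_false _ _ ih =>
    simp only [Prog.arrs, List.mem_append, not_or] at ha
    exact ih ha.2
  | loop_true _ _ _ ih1 ih2 => rw [ih2 ha, ih1 ha]
  | loop_false => rfl

theorem exists_runs_exec {p : Prog} (hp : p.LoopFree) (st : Store) :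
    ∃ t ≤ p.maxCost, Runs p st t (p.exec st) := by
  induction p generalizing st with
  | skip => exact ⟨1, le_rfl, .skip st⟩
  | assign x e => exact ⟨_, le_rfl, .assign x e st⟩
  | write a i e => exact ⟨_, le_rfl, .write a i e st⟩
  | seq p q ihp ihq =>
    obtain ⟨t, ht, h⟩ := ihp hp.1 st
    obtain ⟨t', ht', h'⟩ := ihq hp.2 (p.exec st)
    exact ⟨t + t', Nat.add_le_add ht ht', .seq h h'⟩
  | ite b p q ihp ihq =>
    by_cases hb : b.Holds st
    · obtain ⟨t, ht, h⟩ := ihp hp.1 st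
      refine ⟨b.cost + t, Nat.add_le_add_left (ht.trans (le_max_left _ _)) _, ?_⟩
      simp only [Prog.exec, if_pos hb]
      exact .ite_true hb h
    · obtain ⟨t, ht, h⟩ := ihq hp.2 st
      refine ⟨b.cost + t, Nat.add_le_add_left (ht.trans (le_max_right _ _)) _, ?_⟩
      simp only [Prog.exec, if_neg hb]
      exact .ite_false hb h
  | loop b p => exact hp.elim

/-- Started in `st`, the program `p` halts after at most `m` units of time in a store with the
property `Q`. -/
def RunsWithin (p : Prog) (st : Store) (m : ℕ) (Q : Store → Prop) : Prop :=
  ∃ t ≤ m, ∃ st', Runs p st t st' ∧ Q st'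

namespace RunsWithin

variable {p q : Prog} {st : Store} {m m' : ℕ} {Q Q' : Store → Prop}

theorem mono (h : RunsWithin p st m Q) (hm : m ≤ m') (hQ : ∀ st', Q st' → Q' st') :
    RunsWithin p st m' Q' := by
  obtain ⟨t, ht, st', h1, h2⟩ := h
  exact ⟨t, ht.trans hm, st', h1, hQ _ h2⟩

theorem of_exec (hp : p.LoopFree) (hm : p.maxCost ≤ m) (h : Q (p.exec st)) :
    RunsWithin p st m Q := by
  obtain ⟨t, ht, hr⟩ := exists_runs_exec hp st
  exact ⟨t, ht.trans hm, _, hr, h⟩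

theorem seq (h : RunsWithin p st m Q) (h' : ∀ st', Q st' → RunsWithin q st' m' Q') :
    RunsWithin (.seq p q) st (m + m') Q' := by
  obtain ⟨t, ht, st', h1, h2⟩ := h
  obtain ⟨t', ht', st'', h3, h4⟩ := h' st' h2
  exact ⟨t + t', Nat.add_le_add ht ht', st'', .seq h1 h3, h4⟩

theorem seq_le {k : ℕ} (h : RunsWithin p st m Q) (hk : m + m' ≤ k)
    (h' : ∀ st', Q st' → RunsWithin q st' m' Q') : RunsWithin (.seq p q) st k Q' :=
  (h.seq h').mono hk fun _ h => h

/-- A program does not change the variables and arrays that it does not mention. -/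
theorem frame (h : RunsWithin p st m Q) : RunsWithin p st m fun st' => Q st' ∧
    (∀ x ∉ p.vars, st'.var x = st.var x) ∧ ∀ a ∉ p.arrs, st'.arr a = st.arr a := by
  obtain ⟨t, ht, st', h1, h2⟩ := h
  exact ⟨t, ht, st', h1, h2, fun x hx => h1.var_eq hx, fun a ha => h1.arr_eq ha⟩

/-- The rule for loops that go through a list. -/
theorem loop_list {α : Type*} {b : Test} (l : List α) (f : α → ℕ) {I : List α → Store → Prop}
    (hb : ∀ d a t st, l = d ++ a :: t → I d st → b.Holds st) (hend : ∀ st, I l st → ¬ b.Holds st)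
    (hstep : ∀ d a t st, l = d ++ a :: t → I d st → RunsWithin p st (f a) (I (d ++ [a])))
    (h : I [] st) :
    RunsWithin (.loop b p) st ((l.map fun a => f a + b.cost).sum + b.cost) (I l) := by
  have key : ∀ (t d : List α) (st : Store), l = d ++ t → I d st →
      RunsWithin (.loop b p) st ((t.map fun a => f a + b.cost).sum + b.cost) (I l) := by
    intro t
    induction t with
    | nil =>
      intro d st hl hI
      rw [List.append_nil] at hl
      subst hl
      exact ⟨b.cost, by simp, st, .loop_false (hend st hI), hI⟩
    | cons a t ih =>
      intro d st hl hI
      obtain ⟨c, hc, st', h1, h2⟩ := hstep d a t st hl hI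
      obtain ⟨c', hc', st'', h3, h4⟩ := ih (d ++ [a]) st' (by simp [hl]) h2
      refine ⟨b.cost + c + c', ?_, st'', .loop_true (hb d a t st hl hI) h1 h3, h4⟩
      simp only [List.map_cons, List.sum_cons]
      omega
  exact key l [] st rfl h

end RunsWithin

/-! ### Loops over adjacency lists -/

/-- For each entry of the list of the vertex in variable `4` in the array `a`, whose cells are
delimited by array `1`, load the entry into variable `5` and execute `p`. Variable `3` is the
counter. -/
def forAdj (a : ℕ) (p : Prog) : Prog :=
  .seq (.assign 3 (.read 1 (.var 4)))
    (.loop (.lt (.var 3) (.read 1 (.succ (.var 4))))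
      (.seq (.assign 5 (.read a (.var 3))) (.seq (.assign 3 (.succ (.var 3))) p)))

section

variable {V : Type*} [Fintype V] {e : V ≃ Fin (Fintype.card V)}

/-- Array `a` holds the list `N` of neighbours of `v` in the cells delimited by array `1`. -/
def HoldsAdj (e : V ≃ Fin (Fintype.card V)) (st : Store) (a : ℕ) (v : V) (N : List V) : Prop :=
  st.arr 1 ((e v : ℕ) + 1) = st.arr 1 (e v) + N.length ∧
    ∀ (k : ℕ) (h : k < N.length), st.arr a (st.arr 1 (e v) + k) = (e N[k] : ℕ)

theorem HoldsAdj.congr {st st' : Store} {a : ℕ} {v : V} {N : List V} (h : HoldsAdj e st a v N)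
    (h1 : st'.arr 1 = st.arr 1) (ha : st'.arr a = st.arr a) : HoldsAdj e st' a v N := by
  unfold HoldsAdj at *
  rwa [h1, ha]

/-- Loop rule: if each pass over an entry of the list `N` takes time `C` and extends the invariant by
that entry, then the loop establishes the invariant for `N`. By `hI`, the invariant does not depend on
the loop variables `3` and `5`. The `15` accounts for the loop control. -/
theorem runsWithin_forAdj {a : ℕ} {p : Prog} {st : Store} {v : V} {N : List V} (C : ℕ)
    (I : List V → Store → Prop) (hN : HoldsAdj e st a v N) (h4 : st.var 4 = (e v : ℕ))
    (hp3 : 3 ∉ p.vars) (hp4 : 4 ∉ p.vars) (hp1 : 1 ∉ p.arrs) (hpa : a ∉ p.arrs) (h0 : I [] st)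
    (hI : ∀ d (st : Store) x y, I d st →
      I d ((st.setVar 3 x).setVar 5 y))
    (hstep : ∀ d w t st', N = d ++ w :: t → I d st' → st'.var 5 = (e w : ℕ) →
      (∀ x ∉ 3 :: 5 :: p.vars, st'.var x = st.var x) → (∀ b ∉ p.arrs, st'.arr b = st.arr b) →
      RunsWithin p st' C (I (d ++ [w]))) :
    RunsWithin (forAdj a p) st ((C + 15) * (N.length + 1)) (I N) := by
  have hloop := RunsWithin.loop_list (p := .seq (.assign 5 (.read a (.var 3)))
      (.seq (.assign 3 (.succ (.var 3))) p)) (b := .lt (.var 3) (.read 1 (.succ (.var 4))))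
    (st := st.setVar 3 (st.arr 1 (st.var 4))) N (fun _ => C + 6)
    (I := fun d st' => I d st' ∧ st'.var 3 = st.arr 1 (e v) + d.length ∧
      (∀ x ∉ 3 :: 5 :: p.vars, st'.var x = st.var x) ∧ ∀ b ∉ p.arrs, st'.arr b = st.arr b)
    ?_ ?_ ?_ ?_
  · have h1 := (RunsWithin.of_exec (p := .assign 3 (.read 1 (.var 4))) (st := st) (m := 3)
      (Q := fun st' => st' = st.setVar 3 (st.arr 1 (st.var 4)))
      trivial (by simp [Prog.maxCost, Expr.cost]) rfl).seq
        (q := .loop (.lt (.var 3) (.read 1 (.succ (.var 4))))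
          (.seq (.assign 5 (.read a (.var 3))) (.seq (.assign 3 (.succ (.var 3))) p)))
        (fun st' hst' => hst' ▸ hloop)
    refine h1.mono ?_ fun st' h => h.1
    simp only [List.map_const', List.sum_replicate, Test.cost, Expr.cost, smul_eq_mul]
    ring_nf
    omega
  · rintro d w t st' hd ⟨-, h3, hv, ha⟩
    simp only [Test.Holds, Expr.eval]
    rw [hv 4 (by simp [hp4]), ha 1 hp1, h4, hN.1, h3, hd]
    simp
  · rintro st' ⟨-, h3, hv, ha⟩
    simp only [Test.Holds, Expr.eval]
    rw [hv 4 (by simp [hp4]), ha 1 hp1, h4, hN.1, h3]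
    simp
  · rintro d w t st' hd ⟨hId, h3, hv, ha⟩
    have hw : st'.arr a (st'.var 3) = (e w : ℕ) := by
      rw [h3, ha a hpa, hN.2 d.length (by simp [hd])]
      simp [hd]
    have hstep' := hstep d w t ((st'.setVar 3 (st'.var 3 + 1)).setVar 5 (e w)) hd
      (hI d st' _ _ hId) (by simp) (fun x hx => by
        have := hv x hx
        simp only [List.mem_cons, not_or] at hx
        rw [← this]
        simp [hx.1, hx.2.1]) (fun b hb => ha b hb)
    have hpre : RunsWithin (.assign 5 (.read a (.var 3))) st' 3 fun st₁ =>
        st₁ = st'.setVar 5 (e w) :=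
      .of_exec trivial (by simp [Prog.maxCost, Expr.cost]) (by simp [Prog.exec, Expr.eval, hw])
    refine (hpre.seq (m' := 3 + C) (Q' := fun st₂ => I (d ++ [w]) st₂ ∧
      st₂.var 3 = st.arr 1 (e v) + (d ++ [w]).length ∧
      (∀ x ∉ 3 :: 5 :: p.vars, st₂.var x = st.var x) ∧ ∀ b ∉ p.arrs, st₂.arr b = st.arr b)
      fun st₁ hst₁ => ?_).mono (by omega) fun _ h => h
    subst hst₁
    refine RunsWithin.seq (Q := fun st₁ => st₁ = (st'.setVar 3 (st'.var 3 + 1)).setVar 5 (e w))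
      (.of_exec trivial (by simp [Prog.maxCost, Expr.cost]) ?_) ?_
    · simp only [Prog.exec, Expr.eval]
      rw [Store.setVar_comm _ (by decide)]
      simp
    · rintro st₁ rfl
      refine hstep'.frame.mono le_rfl fun st₂ h => ⟨h.1, ?_, fun x hx => ?_, fun b hb => ?_⟩
      · rw [h.2.1 3 hp3]
        simp [h3]
        ring
      · have hx' := hx
        simp only [List.mem_cons, not_or] at hx'
        rw [h.2.1 x hx'.2.2, ← hv x hx]
        simp [hx'.1, hx'.2.1]
      · rw [h.2.2 b hb, ← ha b hb]
        rfl
  · refine ⟨?_, by simp [h4], fun x hx => ?_, fun _ _ => rfl⟩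
    · have := hI [] st (st.arr 1 (st.var 4)) (st.var 5) h0
      rw [Store.setVar_comm _ (by decide), Store.setVar_self] at this
      exact this
    · simp only [List.mem_cons, not_or] at hx
      simp [hx.1]

end

end RAM

/-! ### Loops over vertex orders -/

namespace RAM

/-- For each entry of the list in the array `a`, whose length is in variable `0`, from left to right,
load the entry into variable `4` and execute `p`. Variable `2` is the counter. -/
def forUp (a : ℕ) (p : Prog) : Prog :=
  .seq (.assign 2 (.const 0)) (.loop (.lt (.var 2) (.var 0))
    (.seq (.seq (.assign 4 (.read a (.var 2))) (.assign 2 (.succ (.var 2)))) p))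

/-- For each entry of the list in the array `a`, whose length is in variable `0`, from right to left,
load the entry into variable `4` and execute `p`. Variable `2` is the counter. -/
def forDown (a : ℕ) (p : Prog) : Prog :=
  .seq (.assign 2 (.var 0)) (.loop (.lt (.const 0) (.var 2))
    (.seq (.seq (.assign 2 (.pred (.var 2))) (.assign 4 (.read a (.var 2)))) p))

section

variable {V : Type*} [Fintype V] {e : V ≃ Fin (Fintype.card V)}

/-- The common part of the rules for `forUp` and `forDown`: the counter has the value `val k` after
`k` rounds. -/
theorem runsWithin_forEach {init pre p : Prog} {b : Test} {st : Store} (l : List V) (f : V → ℕ)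
    (val : ℕ → ℕ) (I : List V → Store → Prop) {a : ℕ}
    (hinit : ∀ st' : Store, st'.var 0 = st.var 0 → init.exec st' = st'.setVar 2 (val 0))
    (hb : ∀ k ≤ l.length, ∀ st' : Store, st'.var 0 = st.var 0 → st'.var 2 = val k →
      (b.Holds st' ↔ k < l.length))
    (hpre : ∀ k (h : k < l.length), ∀ st' : Store, st'.arr a = st.arr a → st'.var 2 = val k →
      pre.exec st' = (st'.setVar 2 (val (k + 1))).setVar 4 (e l[k]))
    (hfree : init.LoopFree ∧ pre.LoopFree) (hc : init.maxCost + b.cost + pre.maxCost ≤ 11)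
    (hp2 : 2 ∉ p.vars) (hp0 : 0 ∉ p.vars) (hpa : a ∉ p.arrs)
    (h0 : I [] st)
    (hI : ∀ d (st : Store) x y, I d st → I d ((st.setVar 2 x).setVar 4 y))
    (hstep : ∀ d v t st', l = d ++ v :: t → I d st' → st'.var 4 = (e v : ℕ) →
      st'.var 2 = val (d.length + 1) →
      (∀ x ∉ 2 :: 4 :: p.vars, st'.var x = st.var x) → (∀ a ∉ p.arrs, st'.arr a = st.arr a) →
      RunsWithin p st' (f v) (I (d ++ [v]))) :
    RunsWithin (.seq init (.loop b (.seq pre p))) st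
      ((l.map f).sum + 11 * l.length + 11) (I l) := by
  have hloop := RunsWithin.loop_list (p := .seq pre p) (b := b) (st := st.setVar 2 (val 0)) l
    (fun v => pre.maxCost + f v)
    (I := fun d st' => I d st' ∧ st'.var 2 = val d.length ∧
      (∀ x ∉ 2 :: 4 :: p.vars, st'.var x = st.var x) ∧ ∀ b ∉ p.arrs, st'.arr b = st.arr b)
    ?_ ?_ ?_ ?_
  · refine ((RunsWithin.of_exec hfree.1 le_rfl (Q := (· = st.setVar 2 (val 0)))
      (hinit st rfl)).seq fun st' hst' => hst' ▸ hloop).mono ?_ fun st' h => h.1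
    have hsum : (l.map fun a => pre.maxCost + f a + b.cost).sum =
        (l.map f).sum + (pre.maxCost + b.cost) * l.length := by
      clear * -
      induction l with
      | nil => simp
      | cons a l ih =>
        simp only [List.map_cons, List.sum_cons, ih, List.length_cons]
        ring
    have : (pre.maxCost + b.cost) * l.length ≤ 11 * l.length :=
      Nat.mul_le_mul_right _ (by omega)
    rw [hsum]
    omega
  · rintro d v t st' hd ⟨-, h2, hv, -⟩
    rw [hb d.length (by simp [hd]) st' (hv 0 (by simp [hp0])) h2, hd]
    simp
  · rintro st' ⟨-, h2, hv, -⟩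
    rw [hb l.length le_rfl st' (hv 0 (by simp [hp0])) h2]
    exact lt_irrefl _
  · rintro d v t st' hd ⟨hId, h2, hv, ha⟩
    have hpre' := hpre d.length (by simp [hd]) st' (ha a hpa) h2
    have hdv : l[d.length]'(by simp [hd]) = v := by simp [hd]
    rw [hdv] at hpre'
    refine (RunsWithin.of_exec hfree.2 le_rfl
      (Q := (· = (st'.setVar 2 (val (d.length + 1))).setVar 4 (e v))) hpre').seq ?_
    rintro _ rfl
    refine (hstep d v t _ hd (hI d st' _ _ hId) (by simp) (by simp) (fun x hx => ?_)
      (fun b hb => ha b hb)).frame.mono le_rfl fun st₂ h => ⟨h.1, ?_, fun x hx => ?_, fun b hb => ?_⟩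
    · rw [← hv x hx]
      simp only [List.mem_cons, not_or] at hx
      simp [hx.1, hx.2.1]
    · rw [h.2.1 2 hp2]
      simp
    · rw [← hv x hx]
      simp only [List.mem_cons, not_or] at hx
      rw [h.2.1 x hx.2.2]
      simp [hx.1, hx.2.1]
    · rw [h.2.2 b hb, ← ha b hb]
      rfl
  · refine ⟨?_, by simp, fun x hx => ?_, fun _ _ => rfl⟩
    · have := hI [] st (val 0) (st.var 4) h0
      rwa [Store.setVar_comm _ (by decide), Store.setVar_self] at this
    · simp only [List.mem_cons, not_or] at hx
      simp [hx.1]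

/-- Loop rule: if the pass over the entry `v` of the list `l` takes time `f v` and extends the invariant
by that entry, then the loop establishes the invariant for `l`. By `hI`, the invariant does not depend
on the loop variables `2` and `4`. -/
theorem runsWithin_forUp {a : ℕ} {p : Prog} {st : Store} (l : List V) (f : V → ℕ)
    (I : List V → Store → Prop) (hl : HoldsList e st a l) (hn : st.var 0 = l.length)
    (hp2 : 2 ∉ p.vars) (hp0 : 0 ∉ p.vars) (hpa : a ∉ p.arrs) (h0 : I [] st)
    (hI : ∀ d (st : Store) x y, I d st → I d ((st.setVar 2 x).setVar 4 y))
    (hstep : ∀ d v t st', l = d ++ v :: t → I d st' → st'.var 4 = (e v : ℕ) →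
      st'.var 2 = d.length + 1 →
      (∀ x ∉ 2 :: 4 :: p.vars, st'.var x = st.var x) → (∀ a ∉ p.arrs, st'.arr a = st.arr a) →
      RunsWithin p st' (f v) (I (d ++ [v]))) :
    RunsWithin (forUp a p) st ((l.map f).sum + 11 * l.length + 11) (I l) := by
  refine runsWithin_forEach l f id I (a := a) (fun st' _ => rfl) (fun k _ st' h0 h2 => ?_)
    (fun k hk st' ha h2 => ?_) ⟨trivial, trivial, trivial⟩
    (by simp [Prog.maxCost, Test.cost, Expr.cost]) hp2 hp0 hpa h0 hI hstep
  · simp only [Test.Holds, Expr.eval]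
    rw [h2, h0, hn]
    rfl
  · simp only [Prog.exec, Expr.eval]
    rw [Store.setVar_comm _ (by decide)]
    simp only [id_eq] at h2
    simp [h2, ha, hl k hk]

/-- The analogue of `runsWithin_forUp` for the loop that goes through the list from right to left. -/
theorem runsWithin_forDown {a : ℕ} {p : Prog} {st : Store} (l : List V) (f : V → ℕ)
    (I : List V → Store → Prop) (hl : HoldsList e st a l) (hn : st.var 0 = l.length)
    (hp2 : 2 ∉ p.vars) (hp0 : 0 ∉ p.vars) (hpa : a ∉ p.arrs) (h0 : I [] st)
    (hI : ∀ d (st : Store) x y, I d st → I d ((st.setVar 2 x).setVar 4 y))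
    (hstep : ∀ d v t st', l.reverse = d ++ v :: t → I d st' → st'.var 4 = (e v : ℕ) →
      (∀ x ∉ 2 :: 4 :: p.vars, st'.var x = st.var x) → (∀ a ∉ p.arrs, st'.arr a = st.arr a) →
      RunsWithin p st' (f v) (I (d ++ [v]))) :
    RunsWithin (forDown a p) st ((l.map f).sum + 11 * l.length + 11) (I l.reverse) := by
  have hsum : (l.reverse.map f).sum = (l.map f).sum := by
    rw [List.map_reverse, List.sum_reverse]
  rw [← hsum, ← List.length_reverse]
  refine runsWithin_forEach l.reverse f (fun k => l.length - k) I (a := a)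
    (fun st' h => by simp [Prog.exec, Expr.eval, h, hn]) (fun k hk st' h0 h2 => ?_)
    (fun k hk st' ha h2 => ?_) ⟨trivial, trivial, trivial⟩
    (by simp [Prog.maxCost, Test.cost, Expr.cost]) hp2 hp0 hpa h0 hI
    fun d v t st' h1 h2 h3 _ h4 h5 => hstep d v t st' h1 h2 h3 h4 h5
  · simp only [Test.Holds, Expr.eval, h2, List.length_reverse]
    omega
  · simp only [Prog.exec, Expr.eval]
    rw [List.length_reverse] at hk
    have h3 : st'.var 2 - 1 = l.length - (k + 1) := by omega
    have h4 := hl (l.length - (k + 1)) (by omega)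
    have h5 : l.length - 1 - k = l.length - (k + 1) := by omega
    simp [h3, ha, h4, List.getElem_reverse, h5]

/-- The cells of the array `1` delimit the adjacency lists. -/
theorem offset_mono {st : Store} {a : ℕ} {N : V → List V} (h : ∀ v, HoldsAdj e st a v (N v)) {i j : ℕ}
    (hij : i ≤ j) (hj : j ≤ Fintype.card V) : st.arr 1 i ≤ st.arr 1 j := by
  induction j, hij using Nat.le_induction with
  | base => exact le_rfl
  | succ j hij ih =>
    have := (h (e.symm ⟨j, hj⟩)).1
    simp only [Equiv.apply_symm_apply] at this
    have := ih (by omega)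
    omega

/-- The segments of an array that belong to different vertices are disjoint. -/
theorem offset_add_ne {st : Store} {a : ℕ} {N : V → List V} (h : ∀ v, HoldsAdj e st a v (N v))
    {v w : V} (hvw : v ≠ w) {i j : ℕ} (hi : i < (N v).length) (hj : j < (N w).length) :
    st.arr 1 (e v) + i ≠ st.arr 1 (e w) + j := by
  have hne : (e v : ℕ) ≠ e w := fun h' => hvw (e.injective (Fin.ext h'))
  have hv := (h v).1
  have hw := (h w).1
  rcases lt_or_gt_of_ne hne with h' | h'
  · have := offset_mono h (i := e v + 1) (j := e w) h' (e w).2.le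
    omega
  · have := offset_mono h (i := e w + 1) (j := e v) h' (e v).2.le
    omega

theorem num_inj {v w : V} : (e v : ℕ) = e w ↔ v = w :=
  ⟨fun h => e.injective (Fin.ext h), fun h => by rw [h]⟩

/-- The lists `N v` list the neighbours of the vertices of `G`. -/
def IsAdjLists {V : Type*} (G : SimpleGraph V) (N : V → List V) : Prop :=
  ∀ v, (N v).Nodup ∧ ∀ w, w ∈ N v ↔ G.Adj v w

theorem IsAdjLists.filter {V : Type*} {G : SimpleGraph V} [DecidableRel G.Adj]
    {l : List V} (hl : IsVertexOrder l) : IsAdjLists G fun v => l.filter fun w => G.Adj v w :=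
  fun v => ⟨hl.1.filter _, fun w => by simp [hl.2 w]⟩

end

section

variable {V : Type*} [Fintype V] [DecidableEq V] {G : SimpleGraph V} [DecidableRel G.Adj] {s : V}
  {ρ : List V} {e : V ≃ Fin (Fintype.card V)}

theorem IsAdjLists.sum_length {N : V → List V} (hN : IsAdjLists G N) {l : List V}
    (hl : IsVertexOrder l) (c : ℕ) : (l.map fun v => c * ((N v).length + 1)).sum =
      c * (2 * G.edgeFinset.card + Fintype.card V) := by
  have h1 : ∀ v, (N v).length = G.degree v := fun v => by
    rw [← List.toFinset_card_of_nodup (hN v).1, ← SimpleGraph.card_neighborFinset_eq_degree]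
    congr 1
    ext w
    simp [(hN v).2 w]
  have h2 : (l.map fun v => c * ((N v).length + 1)).sum = ∑ v, c * (G.degree v + 1) := by
    have : l.toFinset = Finset.univ := by
      ext v
      simp [hl.2 v]
    rw [← this, List.sum_toFinset _ hl.1]
    simp [h1]
  rw [h2, ← Finset.mul_sum, Finset.sum_add_distrib, G.sum_degrees_eq_twice_card_edges]
  simp

/-! ### Sorting the adjacency lists -/

/-- Sort the adjacency lists in the array `2` according to the reverse of the order in the array `0`,
and write them into the array `8`: append each vertex, in this order, to the lists of its
neighbours. The array `9` holds the positions after the last entries written so far. -/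
def sortAdj : Prog :=
  .seq (forDown 0 (.write 9 (.var 4) (.read 1 (.var 4))))
    (forDown 0 (forAdj 2 (.seq (.write 8 (.read 9 (.var 5)) (.var 4))
      (.write 9 (.var 5) (.succ (.read 9 (.var 5)))))))

/-- The list `F w` has been written into the segment of `w` in the array `8`. -/
def HoldsBuckets (e : V ≃ Fin (Fintype.card V)) (st : Store) (F : V → List V) : Prop :=
  ∀ w, st.arr 9 (e w) = st.arr 1 (e w) + (F w).length ∧
    ∀ (k : ℕ) (h : k < (F w).length), st.arr 8 (st.arr 1 (e w) + k) = (e (F w)[k] : ℕ)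

theorem HoldsBuckets.append {st : Store} {N F : V → List V} (hN : ∀ v, HoldsAdj e st 2 v (N v))
    (hF : HoldsBuckets e st F) (hlen : ∀ w, (F w).length ≤ (N w).length) {v w : V}
    (hw : (F w).length < (N w).length) :
    HoldsBuckets e ((st.setArr 8 (st.arr 9 (e w)) (e v)).setArr 9 (e w) (st.arr 9 (e w) + 1))
      (Function.update F w (F w ++ [v])) := by
  intro x
  by_cases hx : x = w
  · subst hx
    simp only [Store.setArr_arr, (hF x).1, Function.update_self]
    refine ⟨by simp; ring, fun k hk => ?_⟩
    simp only [List.length_append, List.length_singleton] at hk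
    by_cases hk' : k = (F x).length
    · simp [hk']
    · have := (hF x).2 k (by omega)
      simp [List.getElem_append_left (show k < (F x).length by omega), this, hk']
  · have hxw : (e x : ℕ) ≠ e w := mt num_inj.1 hx
    simp only [Store.setArr_arr, Function.update_of_ne hx]
    refine ⟨by simp [hxw, (hF x).1], fun k hk => ?_⟩
    have h1 := offset_add_ne hN hx (hk.trans_le (hlen x)) hw
    rw [← (hF x).2 k hk, (hF w).1]
    simp [h1]

theorem runsWithin_sortAdj {st : Store} (hρ : IsVertexOrder ρ) (hl : HoldsList e st 0 ρ)
    (hn : st.var 0 = Fintype.card V) {N : V → List V} (hN : IsAdjLists G N)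
    (hadj : ∀ v, HoldsAdj e st 2 v (N v)) :
    RunsWithin sortAdj st (110 * (Fintype.card V + G.edgeFinset.card + 1)) fun st' =>
      ∀ v, HoldsAdj e st' 8 v (ρ.reverse.filter fun w => G.Adj v w) := by
  have hlen := hρ.length_eq
  have hlenN : ∀ v, (N v).length = (ρ.reverse.filter fun w => G.Adj v w).length := fun v => by
    refine List.Perm.length_eq ((List.perm_ext_iff_of_nodup (hN v).1 (hρ.reverse.1.filter _)).2 ?_)
    intro w
    rw [(hN v).2, List.mem_filter]
    simp [hρ.2 w]
  have h1 := runsWithin_forDown (p := .write 9 (.var 4) (.read 1 (.var 4))) ρ (fun _ => 4)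
    (I := fun d st' => ∀ w ∈ d, st'.arr 9 (e w) = st.arr 1 (e w)) hl (hn.trans hlen.symm)
    (by simp [Prog.vars]) (by simp [Prog.vars]) (by simp [Prog.arrs]) (by simp)
    (fun d st x y h => h) ?_
  · refine (h1.frame.seq (m' := 53 * (2 * G.edgeFinset.card + Fintype.card V) +
      11 * Fintype.card V + 11) fun st₁ hst₁ => ?_).mono ?_ fun st' h => h
    · obtain ⟨h9, hv, ha⟩ := hst₁
      have hadj₁ : ∀ v, HoldsAdj e st₁ 2 v (N v) := fun v =>
        (hadj v).congr (ha 1 (by simp [forDown, Prog.arrs])) (ha 2 (by simp [forDown, Prog.arrs]))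
      have h0 : st₁.var 0 = Fintype.card V := (hv 0 (by simp [forDown, Prog.vars])).trans hn
      have hl₁ : HoldsList e st₁ 0 ρ := fun k hk => by
        rw [ha 0 (by simp [forDown, Prog.arrs]), hl k hk]
      have hst1 : st₁.arr 1 = st.arr 1 := ha 1 (by simp [forDown, Prog.arrs])
      have h2 := runsWithin_forDown (p := forAdj 2 (.seq (.write 8 (.read 9 (.var 5)) (.var 4))
        (.write 9 (.var 5) (.succ (.read 9 (.var 5)))))) (st := st₁) ρ
        (fun v => 53 * ((N v).length + 1))
        (I := fun d st' => HoldsBuckets e st' fun w => d.filter fun u => G.Adj w u) hl₁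
        (h0.trans hlen.symm) (by simp [forAdj, Prog.vars]) (by simp [forAdj, Prog.vars])
        (by simp [forAdj, Prog.arrs]) (fun w => ?_) (fun d st x y h => h) ?_
      · rw [hN.sum_length hρ, hlen] at h2
        refine h2.frame.mono le_rfl fun st' h v => ⟨?_, fun k hk => ?_⟩
        · rw [h.2.2 1 (by simp [forAdj, forDown, Prog.arrs]), ← hlenN, (hadj₁ v).1]
        · exact (h.1 v).2 k hk
      · rw [h9 w (by simpa using hρ.2 w), hst1]
        simp
      · intro d v t st' hd hI h4 hvar harr
        have hst' : ∀ v, HoldsAdj e st' 2 v (N v) := fun v =>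
          (hadj₁ v).congr (harr 1 (by simp [forAdj, Prog.arrs])) (harr 2 (by simp [forAdj, Prog.arrs]))
        have hvd : v ∉ d := fun h' => by
          have := hρ.reverse.1
          rw [hd, List.nodup_append] at this
          exact this.2.2 v h' v (by simp) rfl
        have hnd : d.Nodup := by
          have := hρ.reverse.1
          rw [hd] at this
          exact this.of_append_left
        -- the lists after the vertices in `M` have been handled
        let F : List V → V → List V := fun M w =>
          (d.filter fun u => G.Adj w u) ++ if w ∈ M then [v] else []
        have hFlen : ∀ M : List V, (∀ w ∈ M, G.Adj v w) → ∀ w, (F M w).length ≤ (N w).length := by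
          intro M hM w
          refine (List.subperm_of_subset ?_ ?_).length_le
          · by_cases hw : w ∈ M
            · simp only [F, if_pos hw]
              rw [List.nodup_append]
              exact ⟨hnd.filter _, by simp, fun a ha b hb hab => hvd (by
                rw [List.mem_singleton] at hb
                rw [← hb, ← hab]
                exact List.mem_of_mem_filter ha)⟩
            · simpa [F, hw] using hnd.filter _
          · intro u hu
            rw [(hN w).2]
            by_cases hw : w ∈ M
            · simp only [F, if_pos hw, List.mem_append, List.mem_filter, List.mem_singleton,
                decide_eq_true_eq] at hu
              rcases hu with hu | rfl
              · exact hu.2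
              · exact (hM w hw).symm
            · simp only [F, if_neg hw, List.append_nil, List.mem_filter, decide_eq_true_eq] at hu
              exact hu.2
        refine (runsWithin_forAdj 38 (fun M st' => HoldsBuckets e st' (F M)) (hst' v) h4
          (by simp [Prog.vars]) (by simp [Prog.vars]) (by simp [Prog.arrs]) (by simp [Prog.arrs])
          (by simpa [F] using hI) (fun d st x y h => h) ?_).mono (by omega) fun st'' h => ?_
        · intro M w t' st'' hM hI' h5 hvar' harr'
          have hMadj : ∀ x ∈ M ++ [w], G.Adj v x := fun x hx => by
            rw [← (hN v).2, hM]
            simp only [List.mem_append, List.mem_cons] at hx ⊢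
            tauto
          have hwM : w ∉ M := fun h' => by
            have := (hN v).1
            rw [hM, List.nodup_append] at this
            exact this.2.2 w h' w (by simp) rfl
          have hFw : Function.update (F M) w (F M w ++ [v]) = F (M ++ [w]) := by
            funext x
            by_cases hx : x = w
            · subst hx
              simp [F, hwM]
            · simp [F, hx]
          refine .of_exec ⟨trivial, trivial⟩ (by simp [Prog.maxCost, Expr.cost]) ?_
          have hst'' : ∀ v, HoldsAdj e st'' 2 v (N v) := fun v =>
            (hst' v).congr (harr' 1 (by simp [Prog.arrs])) (harr' 2 (by simp [Prog.arrs]))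
          have h4' : st''.var 4 = (e v : ℕ) := (hvar' 4 (by simp [Prog.vars])).trans h4
          have := hI'.append hst'' (hFlen M fun x hx => hMadj x (by simp [hx])) (v := v) (w := w) ?_
          · rw [hFw] at this
            simpa [Prog.exec, Expr.eval, h5, h4'] using this
          · have h6 := hFlen _ hMadj w
            rw [← hFw] at h6
            simp at h6
            omega
        · have : F (N v) = fun w => (d ++ [v]).filter fun u => G.Adj w u := by
            funext w
            simp only [F, List.filter_append, (hN v).2, G.adj_comm v w]
            by_cases hw : G.Adj w v <;> simp [hw]
          rwa [this] at h
    · simp only [hlen, List.map_const', List.sum_replicate, smul_eq_mul]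
      omega
  · intro d v t st' hd hI h4 hvar harr
    refine .of_exec trivial (by simp [Prog.maxCost, Expr.cost]) ?_
    intro w hw
    have h1 := harr 1 (by simp [Prog.arrs])
    simp only [List.mem_append, List.mem_singleton] at hw
    simp only [Prog.exec, Expr.eval, Store.setArr_arr, if_true, h4, h1]
    by_cases hwv : w = v
    · simp [hwv]
    · have : (e w : ℕ) ≠ e v := mt num_inj.1 hwv
      simp [this, hI w (hw.resolve_right hwv)]

end

end RAM

/-! ### Breadth first orders of trees -/

section BreadthFirst

variable {V : Type*} [DecidableEq V]

/-- The children of `u` in the list `N u`. -/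
def childrenIn (p : V → Option V) (N : V → List V) (u : V) : List V :=
  (N u).filter fun w => p w = some u

theorem mem_childrenIn {p : V → Option V} {N : V → List V}
    (hN : ∀ {v q : V}, p v = some q → v ∈ N q) {u v : V} :
    v ∈ childrenIn p N u ↔ p v = some u := by
  simp only [childrenIn, List.mem_filter, decide_eq_true_eq, and_iff_right_iff_imp]
  exact hN

variable [Fintype V]

/-- A queue that starts with the root and to which the children of its entries are appended, one entry
after the other, finally lists all vertices. -/
theorem exists_queue_order {p : V → Option V} {s : V} {π : List V} (hπ : IsTopological p π)
    (hps : p s = none) (hp : ∀ v, v ≠ s → ∃ q, p v = some q) {N : V → List V}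
    (hNn : ∀ v, (N v).Nodup) (hN : ∀ {v q : V}, p v = some q → v ∈ N q) :
    ∃ B, IsTopological p B ∧ B = s :: B.flatMap (childrenIn p N) := by
  have key : ∀ i ≤ Fintype.card V, ∃ B : List V, B.Nodup ∧ i ≤ B.length ∧
      B = s :: (B.take i).flatMap (childrenIn p N) ∧
      ∀ v ∈ B, ∀ q, p v = some q → q ∈ B ∧ B.idxOf q < B.idxOf v := by
    intro i
    induction i with
    | zero =>
      intro _
      refine ⟨[s], by simp, by simp, by simp, fun v hv q hq => ?_⟩
      rw [List.mem_singleton] at hv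
      simp [hv, hps] at hq
    | succ i ih =>
      intro hi
      obtain ⟨B, hB, hiB, hBe, hBt⟩ := ih (by omega)
      -- if all entries have been processed, then no vertex is missing
      have hlt : i < B.length := by
        by_contra hlt
        have hall : ∀ v, v ∈ B := by
          intro v
          induction hk : π.idxOf v using Nat.strong_induction_on generalizing v with
          | _ k ih =>
          by_cases hv : v = s
          · rw [hBe, hv]
            simp
          · obtain ⟨q, hq⟩ := hp v hv
            rw [hBe, List.take_of_length_le (by omega), List.mem_cons, List.mem_flatMap]
            exact Or.inr ⟨q, ih _ (hk ▸ hπ.parent_lt hq) q rfl, (mem_childrenIn hN).2 hq⟩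
        have := IsVertexOrder.length_eq ⟨hB, hall⟩
        omega
      have hu : B[i] ∉ B.take i := fun h => by
        have := hB
        rw [← List.take_append_drop i B, List.drop_eq_getElem_cons hlt, List.nodup_append] at this
        exact this.2.2 _ h B[i] List.mem_cons_self rfl
      have hdisj : ∀ v ∈ childrenIn p N B[i], v ∉ B := by
        intro v hv hvB
        rw [mem_childrenIn hN] at hv
        rw [hBe, List.mem_cons, List.mem_flatMap] at hvB
        rcases hvB with rfl | ⟨u, hu', hvu⟩
        · simp [hps] at hv
        · rw [mem_childrenIn hN, hv] at hvu
          simp only [Option.some.injEq] at hvu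
          exact hu (hvu ▸ hu')
      refine ⟨B ++ childrenIn p N B[i], ?_, by simp; omega, ?_, ?_⟩
      · rw [List.nodup_append]
        exact ⟨hB, (hNn _).filter _, fun a ha b hb hab => hdisj b hb (hab ▸ ha)⟩
      · have : (B ++ childrenIn p N B[i]).take (i + 1) = B.take i ++ [B[i]] := by
          rw [List.take_append_of_le_length (by omega), List.take_succ_eq_append_getElem hlt]
        rw [this, List.flatMap_append, ← List.cons_append, ← hBe]
        simp
      · intro v hv q hq
        rw [List.mem_append] at hv
        by_cases hvB : v ∈ B
        · obtain ⟨h1, h2⟩ := hBt v hvB q hq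
          rw [List.idxOf_append_of_mem h1, List.idxOf_append_of_mem hvB]
          exact ⟨by simp [h1], h2⟩
        · have h1 := (mem_childrenIn hN).1 (hv.resolve_left hvB)
          obtain rfl : q = B[i] := by simpa [hq] using h1
          have h2 : B[i] ∈ B := List.getElem_mem hlt
          rw [List.idxOf_append_of_mem h2, List.idxOf_append_of_notMem hvB]
          have := List.idxOf_lt_length_of_mem h2
          exact ⟨by simp, by omega⟩
  obtain ⟨B, hB, hlen, hBe, hBt⟩ := key _ le_rfl
  have hall : ∀ v, v ∈ B := fun v => by
    have : B.toFinset = Finset.univ := by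
      rw [← Finset.card_eq_iff_eq_univ]
      refine le_antisymm (Finset.card_le_univ _) ?_
      rwa [List.toFinset_card_of_nodup hB]
    rw [← List.mem_toFinset, this]
    exact Finset.mem_univ v
  rw [List.take_of_length_le (IsVertexOrder.length_eq ⟨hB, hall⟩).le] at hBe
  exact ⟨B, ⟨⟨hB, hall⟩, fun {v q} hq => (hBt v (hall v) q hq).2⟩, hBe⟩

theorem label_bfs_eq_singleton {H : SimpleGraph V} [DecidableRel H.Adj] {s : V} {vis : List V}
    {w q : V} (hw : w ≠ s) (hn : vis.Nodup) (hq : q ∈ vis) (h : ∀ u ∈ vis, H.Adj u w ↔ u = q) :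
    bfs.label H s vis w = [Fintype.card V - (vis.idxOf q + 1)] := by
  induction vis using List.reverseRecOn with
  | nil => simp at hq
  | append_singleton vis u ih =>
    rw [SearchRule.label_append_singleton]
    by_cases huq : u = q
    · have hu : u ∉ vis := fun hu => by
        rw [List.nodup_append] at hn
        exact hn.2.2 u hu u (by simp) rfl
      rw [if_pos ((h u (by simp)).2 huq), ← huq, List.idxOf_append_of_notMem hu,
        SearchRule.label_eq_nil_of_forall_not_adj vis hw fun v hv hvw => ?_]
      · simp [bfs]
      · have := (h v (by simp [hv])).1 hvw
        exact hu (huq ▸ this ▸ hv)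
    · have hqv : q ∈ vis := by
        simp only [List.mem_append, List.mem_singleton] at hq
        exact hq.resolve_right (Ne.symm huq)
      rw [if_neg (mt (h u (by simp)).1 huq), ih hn.of_append_left hqv fun v hv => h v (by simp [hv]),
        List.idxOf_append_of_mem hqv]

variable {G : SimpleGraph V} [DecidableRel G.Adj] {s : V} {ρ π B : List V}

/-- The order in which the vertices leave the queue is a breadth first search order. -/
theorem IsCliqueOrder.isSearchOrder_bfs (h : IsCliqueOrder G s ρ π)
    (hT : IsTopological (lastInParent G π) B) {N : V → List V}
    (hN : ∀ {v q : V}, lastInParent G π v = some q → v ∈ N q)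
    (hB : B = s :: B.flatMap (childrenIn (lastInParent G π) N)) :
    bfs.IsSearchOrder (lastInTree G π) s B := by
  refine ⟨hT.order, fun vis v rest hvis w hw => ?_⟩
  have hO := hT.order
  rw [hvis] at hO
  have hwv : B.idxOf v < B.idxOf w := by
    rw [hvis]
    exact hO.mem_right.1 hw
  have hvisB : ∀ u, u ∈ vis ↔ B.idxOf u < B.idxOf v := fun u => by
    rw [hvis]
    exact hO.mem_left
  have hs0 : B.idxOf s = 0 := by
    rw [hB]
    simp
  have hws : w ≠ s := ne_start_of_idxOf_lt hs0 hwv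
  by_cases hvs : v = s
  · have hvis0 : vis = [] := List.eq_nil_iff_forall_not_mem.2 fun u hu => by
      have := (hvisB u).1 hu
      rw [hvs, hs0] at this
      omega
    rw [hvis0, SearchRule.label_nil, SearchRule.label_nil, if_pos hvs, if_neg hws]
    exact (List.nil_lt_cons _ _).le
  · have hadj : ∀ x, ¬ B.idxOf x < B.idxOf v → ∀ u ∈ vis, (lastInTree G π).Adj u x →
        lastInParent G π x = some u := by
      intro x hx u hu hux
      refine (lastInTree_adj_iff.1 hux).resolve_left fun h' => ?_
      have := hT.parent_lt h'
      have := (hvisB u).1 hu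
      omega
    have hlabel : ∀ x q, x ≠ s → ¬ B.idxOf x < B.idxOf v → lastInParent G π x = some q → q ∈ vis →
        bfs.label (lastInTree G π) s vis x = [Fintype.card V - (B.idxOf q + 1)] := by
      intro x q hxs hx hq hqvis
      rw [label_bfs_eq_singleton hxs hO.1.of_append_left hqvis fun u hu =>
        ⟨fun h' => ?_, fun h' => ?_⟩, hvis, List.idxOf_append_of_mem hqvis]
      · have := hadj x hx u hu h'
        rw [hq] at this
        simpa using this.symm
      · rw [h']
        exact lastInTree_adj_iff.2 (Or.inr hq)
    obtain ⟨r, hr⟩ := h.exists_parent hvs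
    obtain ⟨q, hq⟩ := h.exists_parent hws
    by_cases hqvis : q ∈ vis
    · -- the children of different vertices are in the same order as these vertices
      have hpw : (B.flatMap (childrenIn (lastInParent G π) N)).Pairwise fun a b =>
          ∀ r q, lastInParent G π a = some r → lastInParent G π b = some q →
            B.idxOf r ≤ B.idxOf q := by
        refine List.pairwise_flatMap.2 ⟨fun u _ => ?_, ?_⟩
        · refine List.Pairwise.imp_of_mem (R := fun _ _ => True) (fun {a b} ha hb _ r q hr hq => ?_)
            (List.pairwise_of_forall fun _ _ => trivial)
          rw [mem_childrenIn hN] at ha hb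
          have h1 : r = u := by simpa [hr] using ha
          have h2 : q = u := by simpa [hq] using hb
          rw [h1, h2]
        · have hBp := pairwise_idxOf_of_append (A := B) (B := []) (by simpa using hT.order.1)
          rw [List.append_nil] at hBp
          refine hBp.imp fun {u u'} huu' a ha b hb r q hr hq => ?_
          rw [mem_childrenIn hN] at ha hb
          have h1 : r = u := by simpa [hr] using ha
          have h2 : q = u' := by simpa [hq] using hb
          rw [h1, h2]
          exact huu'.le
      have hle : B.idxOf r ≤ B.idxOf q := by
        have h1 : ∀ x, x ≠ s → B.idxOf x =
            (B.flatMap (childrenIn (lastInParent G π) N)).idxOf x + 1 := fun x hx => by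
          conv_lhs => rw [hB, List.idxOf_cons_ne _ (Ne.symm hx)]
        have h2 := h1 v hvs
        have h3 := h1 w hws
        have h4 : w ∈ B.flatMap (childrenIn (lastInParent G π) N) := by
          have := hT.order.2 w
          rw [hB] at this
          exact (List.mem_cons.1 this).resolve_left hws
        exact hpw.rel_of_idxOf_lt h4 (by omega) r q hr hq
      have hrvis : r ∈ vis := (hvisB r).2 (hle.trans_lt ((hvisB q).1 hqvis))
      rw [hlabel v r hvs (lt_irrefl _) hr hrvis, hlabel w q hws (by omega) hq hqvis]
      rcases (show Fintype.card V - (B.idxOf q + 1) ≤ Fintype.card V - (B.idxOf r + 1) by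
        omega).lt_or_eq with h1 | h1
      · exact le_of_lt (List.Lex.rel h1)
      · rw [h1]
    · rw [SearchRule.label_eq_nil_of_forall_not_adj vis hws fun u hu hux => ?_]
      · rcases bfs.label (lastInTree G π) s vis v with _ | ⟨a, l⟩
        · exact le_rfl
        · exact (List.nil_lt_cons a l).le
      · have := hadj w (by omega) u hu hux
        rw [hq] at this
        simp only [Option.some.injEq] at this
        exact hqvis (this ▸ hu)

end BreadthFirst

namespace RAM

section

variable {V : Type*} [Fintype V] {e : V ≃ Fin (Fintype.card V)}

/-- Array `a` holds the list `B`, from right to left, and variable `6` is the position of its last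
entry. -/
def HoldsQueue (e : V ≃ Fin (Fintype.card V)) (st : Store) (a : ℕ) (B : List V) : Prop :=
  st.var 6 = Fintype.card V - B.length ∧
    ∀ (k : ℕ) (h : k < B.length), st.arr a (Fintype.card V - 1 - k) = (e B[k] : ℕ)

theorem HoldsQueue.append {st : Store} {a : ℕ} {B : List V} (h : HoldsQueue e st a B)
    (hB : B.length < Fintype.card V) (w : V) :
    HoldsQueue e ((st.setVar 6 (st.var 6 - 1)).setArr a (st.var 6 - 1) (e w)) a (B ++ [w]) := by
  refine ⟨?_, fun k hk => ?_⟩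
  · simp only [Store.setArr_var, Store.setVar_var, if_true, List.length_append,
      List.length_singleton, h.1]
    omega
  · simp only [Store.setArr_arr, Store.setVar_arr, if_true, h.1]
    simp only [List.length_append, List.length_singleton] at hk
    by_cases hk' : k = B.length
    · subst hk'
      have h6 : Fintype.card V - 1 - B.length = Fintype.card V - B.length - 1 := by omega
      rw [h6]
      simp
    · have h6 : Fintype.card V - 1 - k ≠ Fintype.card V - B.length - 1 := by omega
      rw [Function.update_of_ne h6, h.2 k (by omega), List.getElem_append_left (by omega)]

theorem HoldsQueue.holdsList {st : Store} {a : ℕ} {B : List V} (h : HoldsQueue e st a B)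
    (hB : B.length = Fintype.card V) : HoldsList e st a B.reverse := by
  intro i hi
  rw [List.length_reverse] at hi
  have := h.2 (B.length - 1 - i) (by omega)
  rw [List.getElem_reverse, ← this]
  congr 1
  omega

end

section

variable {V : Type*} [Fintype V] [DecidableEq V] {G : SimpleGraph V} [DecidableRel G.Adj] {s : V}
  {ρ π : List V} {e : V ≃ Fin (Fintype.card V)}

/-! ### Computing the last-in tree -/

/-- Compute the parents in the last-in tree of the order in the array `3`: the array `19` holds the
last visited neighbours. The parent of the start vertex is set to `n`. -/
def findParents : Prog :=
  .seq (.write 19 (.var 1) (.var 0)) (forUp 3 (.seq (.write 4 (.var 4) (.read 19 (.var 4)))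
    (forAdj 2 (.write 19 (.var 5) (.var 4)))))

/-- Array `4` holds the parents in the last-in tree of `π`. -/
def HoldsParents (G : SimpleGraph V) [DecidableRel G.Adj] (e : V ≃ Fin (Fintype.card V)) (s : V)
    (π : List V) (st : Store) : Prop :=
  (∀ v q, lastInParent G π v = some q → st.arr 4 (e v) = (e q : ℕ)) ∧
    st.arr 4 (e s) = Fintype.card V

theorem runsWithin_findParents {st : Store} (hπ : IsVertexOrder π) (hs : π.idxOf s = 0)
    (hl : HoldsList e st 3 π) (hn : st.var 0 = Fintype.card V) (h1 : st.var 1 = (e s : ℕ))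
    {N : V → List V} (hN : IsAdjLists G N) (hadj : ∀ v, HoldsAdj e st 2 v (N v)) :
    RunsWithin findParents st (100 * (Fintype.card V + G.edgeFinset.card + 1))
      (HoldsParents G e s π) := by
  have hlen := hπ.length_eq
  have hmain := runsWithin_forUp (st := st.setArr 19 (e s) (Fintype.card V))
    (p := .seq (.write 4 (.var 4) (.read 19 (.var 4))) (forAdj 2 (.write 19 (.var 5) (.var 4)))) π
    (fun v => 25 * ((N v).length + 1)) (a := 3)
    (I := fun d st' => (∀ w q, d.reverse.find? (fun u => G.Adj w u) = some q →
        st'.arr 19 (e w) = (e q : ℕ)) ∧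
      (∀ v ∈ d, ∀ q, lastInParent G π v = some q → st'.arr 4 (e v) = (e q : ℕ)) ∧
      (d = [] → st'.arr 19 (e s) = Fintype.card V) ∧
      (s ∈ d → st'.arr 4 (e s) = Fintype.card V))
    hl (hn.trans hlen.symm) (by simp [forAdj, Prog.vars]) (by simp [forAdj, Prog.vars])
    (by simp [forAdj, Prog.arrs]) (by simp) (fun d st x y h => h) ?_
  · rw [hN.sum_length hπ, hlen] at hmain
    refine ((RunsWithin.of_exec (p := .write 19 (.var 1) (.var 0)) (st := st) trivial le_rfl
      (Q := (· = st.setArr 19 (e s) (Fintype.card V))) ?_).seq fun st' hst' => hst' ▸ hmain).mono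
      ?_ fun st' h => ⟨fun v => h.2.1 v (hπ.2 v), h.2.2.2 (hπ.2 s)⟩
    · simp [Prog.exec, Expr.eval, h1, hn]
    · simp only [Prog.maxCost, Expr.cost]
      omega
  · intro d v t st' hd hI h4 _ hvar harr
    obtain ⟨hI1, hI2, hI3, hI4⟩ := hI
    have hvd : v ∉ d := fun h' => by
      have := hπ.1
      rw [hd, List.nodup_append] at this
      exact this.2.2 v h' v (by simp) rfl
    have hpar : lastInParent G π v = d.reverse.find? (fun u => G.Adj v u) := by
      rw [lastInParent, hd, leftOf_append hvd]
    have hds : s ∉ d ↔ d = [] := by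
      refine ⟨fun h' => ?_, fun h' => by simp [h']⟩
      rcases d with _ | ⟨a, d⟩
      · rfl
      · by_cases ha : a = s
        · exact absurd List.mem_cons_self (ha ▸ h')
        · rw [hd, List.cons_append, List.idxOf_cons_ne _ ha] at hs
          omega
    refine RunsWithin.seq_le (m := 5) (m' := 19 * ((N v).length + 1))
      (Q := (· = st'.setArr 4 (e v) (st'.arr 19 (e v))))
      (.of_exec trivial (by simp [Prog.maxCost, Expr.cost])
        (by simp [Prog.exec, Expr.eval, h4])) (by omega) ?_
    rintro _ rfl
    refine (runsWithin_forAdj (v := v) (N := N v) (a := 2)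
      (p := .write 19 (.var 5) (.var 4)) 4 (fun M st₁ =>
        (∀ w ∈ M, st₁.arr 19 (e w) = (e v : ℕ)) ∧
        ∀ w ∉ M, ∀ q, d.reverse.find? (fun u => G.Adj w u) = some q → st₁.arr 19 (e w) = (e q : ℕ))
      ?_ (by simpa using h4) (by simp [Prog.vars]) (by simp [Prog.vars]) (by simp [Prog.arrs])
      (by simp [Prog.arrs]) ?_ (fun d st x y h => h) ?_).frame.mono le_rfl fun st₂ h₂ => ?_
    · refine (hadj v).congr ?_ ?_
      · simpa using harr 1 (by simp [forAdj, Prog.arrs])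
      · simpa using harr 2 (by simp [forAdj, Prog.arrs])
    · simpa using hI1
    · intro M w t' st₁ hM hI' h5 hvar' harr'
      refine .of_exec trivial (by simp [Prog.maxCost, Expr.cost]) ?_
      have h4' : st₁.var 4 = (e v : ℕ) := by
        rw [hvar' 4 (by simp [Prog.vars])]
        simpa using h4
      simp only [Prog.exec, Expr.eval, h5, h4', Store.setArr_arr, if_true, List.mem_append,
        List.mem_singleton]
      refine ⟨fun x hx => ?_, fun x hx q hq => ?_⟩
      · by_cases hxw : x = w
        · simp [hxw]
        · have : (e x : ℕ) ≠ e w := mt num_inj.1 hxw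
          simp [this, hI'.1 x (hx.resolve_right hxw)]
      · push Not at hx
        have : (e x : ℕ) ≠ e w := mt num_inj.1 hx.2
        simp [this, hI'.2 x hx.1 q hq]
    · obtain ⟨⟨hM1, hM2⟩, -, ha₂⟩ := h₂
      have h4₂ : st₂.arr 4 = (st'.setArr 4 (e v) (st'.arr 19 (e v))).arr 4 :=
        ha₂ 4 (by simp [forAdj, Prog.arrs])
      refine ⟨fun w q hq => ?_, fun w hw q hq => ?_, by simp, fun hsd => ?_⟩
      · rw [List.reverse_append, List.reverse_singleton, List.singleton_append] at hq
        by_cases hw : G.Adj w v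
        · rw [List.find?_cons_of_pos (by simpa using hw)] at hq
          simp only [Option.some.injEq] at hq
          rw [← hq]
          exact hM1 w (((hN v).2 w).2 hw.symm)
        · rw [List.find?_cons_of_neg (by simpa using hw)] at hq
          exact hM2 w (fun h' => hw (((hN v).2 w).1 h').symm) q hq
      · rw [h4₂]
        by_cases hwv : w = v
        · subst hwv
          simp [hI1 w q (hpar ▸ hq)]
        · have h3 : (e w : ℕ) ≠ e v := mt num_inj.1 hwv
          simp only [List.mem_append, List.mem_singleton] at hw
          simp [h3, hI2 w (hw.resolve_right hwv) q hq]
      · rw [h4₂]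
        by_cases hsv : s = v
        · subst hsv
          simp [hI3 (hds.1 hvd)]
        · have h3 : (e s : ℕ) ≠ e v := mt num_inj.1 hsv
          simp only [List.mem_append, List.mem_singleton] at hsd
          simp [h3, hI4 (hsd.resolve_right hsv)]

theorem HoldsParents.eq_iff {st : Store} (h : HoldsParents G e s π st) (hC : IsCliqueOrder G s ρ π)
    {v q : V} : st.arr 4 (e v) = (e q : ℕ) ↔ lastInParent G π v = some q := by
  refine ⟨fun h' => ?_, h.1 v q⟩
  by_cases hv : v = s
  · rw [hv, h.2] at h'
    have := (e q).2
    omega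
  · obtain ⟨r, hr⟩ := hC.exists_parent hv
    rw [h.1 v r hr, num_inj] at h'
    rw [hr, h']

/-! ### Breadth first search of the tree -/

/-- Breadth first search of the tree whose parent function is in the array `4`. The queue is written
into the array `5` from right to left. Variable `2` is the position of the vertex that is processed,
and variable `6` is the position of the last entry of the queue. -/
def bfsTree : Prog :=
  .seq (.seq (.assign 6 (.pred (.var 0))) (.seq (.write 5 (.var 6) (.var 1)) (.assign 2 (.var 0))))
    (.loop (.lt (.const 0) (.var 2))
      (.seq (.seq (.assign 2 (.pred (.var 2))) (.assign 4 (.read 5 (.var 2))))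
        (forAdj 2 (.ite (.eq (.read 4 (.var 5)) (.var 4))
          (.seq (.assign 6 (.pred (.var 6))) (.write 5 (.var 6) (.var 5))) .skip))))

theorem runsWithin_bfsTree {st : Store} (hC : IsCliqueOrder G s ρ π)
    (hp : HoldsParents G e s π st) (hn : st.var 0 = Fintype.card V) (h1 : st.var 1 = (e s : ℕ))
    {N : V → List V} (hN : IsAdjLists G N) (hadj : ∀ v, HoldsAdj e st 2 v (N v)) :
    RunsWithin bfsTree st (150 * (Fintype.card V + G.edgeFinset.card + 1)) fun st' =>
      ∃ β, bfs.IsSearchOrder (lastInTree G π) s β.reverse ∧ HoldsList e st' 5 β := by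
  have hNp : ∀ {v q : V}, lastInParent G π v = some q → v ∈ N q := fun {v q} hq =>
    ((hN q).2 v).2 (hC.adj_parent hq)
  obtain ⟨B, hB, hBe⟩ := exists_queue_order hC.isTopological hC.parent_start
    (fun v hv => hC.exists_parent hv) (fun v => (hN v).1) hNp
  have hlen := hB.order.length_eq
  have hpos : 0 < Fintype.card V := Fintype.card_pos_iff.2 ⟨s⟩
  have hloop := RunsWithin.loop_list
    (st := ((st.setVar 6 (Fintype.card V - 1)).setArr 5 (Fintype.card V - 1) (e s)).setVar 2
      (Fintype.card V))
    (b := .lt (.const 0) (.var 2))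
    (p := (.seq (.seq (.assign 2 (.pred (.var 2))) (.assign 4 (.read 5 (.var 2))))
        (forAdj 2 (.ite (.eq (.read 4 (.var 5)) (.var 4))
          (.seq (.assign 6 (.pred (.var 6))) (.write 5 (.var 6) (.var 5))) .skip)))) B
    (fun v => 40 * ((N v).length + 1))
    (I := fun d st' => HoldsQueue e st' 5 (s :: d.flatMap (childrenIn (lastInParent G π) N)) ∧
      st'.var 2 = Fintype.card V - d.length ∧ HoldsParents G e s π st' ∧
      ∀ v, HoldsAdj e st' 2 v (N v)) ?_ ?_ ?_ ?_
  · have hpre : RunsWithin (.seq (.assign 6 (.pred (.var 0))) (.seq (.write 5 (.var 6) (.var 1))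
        (.assign 2 (.var 0)))) st 10 (· = ((st.setVar 6 (Fintype.card V - 1)).setArr 5
          (Fintype.card V - 1) (e s)).setVar 2 (Fintype.card V)) :=
      .of_exec ⟨trivial, trivial, trivial⟩ (by simp [Prog.maxCost, Expr.cost])
        (by simp [Prog.exec, Expr.eval, h1, hn])
    have hsum : (B.map fun v => 40 * ((N v).length + 1) +
        (Test.lt (.const 0) (.var 2)).cost).sum ≤
        (B.map fun v => 43 * ((N v).length + 1)).sum := by
      refine List.sum_le_sum fun v _ => ?_
      simp only [Test.cost, Expr.cost]
      omega
    rw [hN.sum_length hB.order] at hsum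
    refine (hpre.seq fun st' hst' => hst' ▸ hloop).mono ?_ fun st' h => ⟨B.reverse, ?_, ?_⟩
    · simp only [Test.cost, Expr.cost] at hsum ⊢
      omega
    · rw [List.reverse_reverse]
      exact hC.isSearchOrder_bfs hB hNp hBe
    · rw [← hBe] at h
      exact h.1.holdsList hlen
  · rintro d v t st' hd ⟨-, h2, -, -⟩
    have : d.length < B.length := by
      rw [hd]
      simp
    simp only [Test.Holds, Expr.eval, h2]
    omega
  · rintro st' ⟨-, h2, -, -⟩
    simp only [Test.Holds, Expr.eval, h2]
    omega
  · rintro d v t st' hd ⟨hq, h2, hpar, hadj'⟩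
    have hBd : B = s :: d.flatMap (childrenIn (lastInParent G π) N) ++
        (v :: t).flatMap (childrenIn (lastInParent G π) N) := by
      rw [List.cons_append, ← List.flatMap_append, ← hd]
      exact hBe
    have hdlt : d.length < (s :: d.flatMap (childrenIn (lastInParent G π) N)).length := by
      -- as long as there are vertices to be processed, the next one is in the queue
      by_contra hle
      have h3 : v ∈ s :: d.flatMap (childrenIn (lastInParent G π) N) ∨
          lastInParent G π v = some v ∨ ∃ u ∈ t, lastInParent G π v = some u := by
        have := hB.order.2 v
        rw [hBd, List.mem_append, List.flatMap_cons, List.mem_append, mem_childrenIn hNp] at this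
        refine this.imp_right fun h => h.imp_right fun h => ?_
        obtain ⟨u, hu, hvu⟩ := List.mem_flatMap.1 h
        exact ⟨u, hu, (mem_childrenIn hNp).1 hvu⟩
      have hO := hB.order
      rcases h3 with h3 | h3 | ⟨u, hu, h3⟩
      · have h4 := List.idxOf_lt_length_of_mem h3
        have h5 : B.idxOf v < d.length := by
          rw [hBd, List.idxOf_append_of_mem h3]
          omega
        rw [hd] at h5 hO
        have h6 : v ∉ d := fun h' => lt_irrefl _ (hO.mem_left.1 h')
        rw [List.idxOf_append_of_notMem h6] at h5
        omega
      · have := hB.parent_lt h3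
        omega
      · have h4 := hB.parent_lt h3
        rw [hd] at h4 hO
        have := hO.mem_right.1 hu
        omega
    have hv : st'.arr 5 (st'.var 2 - 1) = (e v : ℕ) := by
      have h3 := hq.2 d.length hdlt
      have h4 : (s :: d.flatMap (childrenIn (lastInParent G π) N))[d.length]'hdlt = v := by
        have h5 : B[d.length]? = some v := by
          rw [hd]
          simp
        rw [hBd, List.getElem?_append_left hdlt, List.getElem?_eq_getElem hdlt] at h5
        simpa using h5
      rw [h4] at h3
      rw [← h3, h2]
      congr 1
      omega
    refine RunsWithin.seq_le (m := 6) (m' := 29 * ((N v).length + 1))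
      (Q := (· = (st'.setVar 2 (Fintype.card V - (d.length + 1))).setVar 4 (e v)))
      (.of_exec ⟨trivial, trivial⟩ (by simp [Prog.maxCost, Expr.cost]) ?_) (by omega) ?_
    · simp only [Prog.exec, Expr.eval]
      have h3 : st'.var 2 - 1 = Fintype.card V - (d.length + 1) := by omega
      rw [h3] at hv
      simp [hv, h3]
    · rintro _ rfl
      refine (runsWithin_forAdj (v := v) (N := N v) (a := 2)
        (st := (st'.setVar 2 (Fintype.card V - (d.length + 1))).setVar 4 (e v))
        (p := .ite (.eq (.read 4 (.var 5)) (.var 4))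
          (.seq (.assign 6 (.pred (.var 6))) (.write 5 (.var 6) (.var 5))) .skip) 14 (fun M st₁ =>
          HoldsQueue e st₁ 5 (s :: d.flatMap (childrenIn (lastInParent G π) N) ++
            M.filter fun w => lastInParent G π w = some v))
        (hadj' v) (by simp) (by simp [Prog.vars]) (by simp [Prog.vars]) (by simp [Prog.arrs])
        (by simp [Prog.arrs]) (by rw [List.filter_nil, List.append_nil]; exact hq)
        (fun d st x y h => h) ?_).frame.mono le_rfl
        fun st₂ h₂ => ⟨?_, ?_, ?_, fun w => ?_⟩
      · intro M w t' st₁ hM hI' h5 hvar' harr'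
        refine RunsWithin.of_exec ?_ ?_ ?_
        · exact ⟨⟨trivial, trivial⟩, trivial⟩
        · simp [Prog.maxCost, Test.cost, Expr.cost]
        have h4 : st₁.var 4 = (e v : ℕ) := by
          rw [hvar' 4 (by simp [Prog.vars])]
          simp
        have hpw : st₁.arr 4 (e w) = (e v : ℕ) ↔ lastInParent G π w = some v := by
          rw [harr' 4 (by simp [Prog.arrs])]
          exact hpar.eq_iff hC
        simp only [Prog.exec, Test.Holds, Expr.eval, h5, h4, hpw]
        by_cases hw : lastInParent G π w = some v
        · rw [if_pos hw, List.filter_append, ← List.append_assoc]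
          generalize hQ : s :: d.flatMap (childrenIn (lastInParent G π) N) ++
            M.filter (fun w => lastInParent G π w = some v) = Q at hI'
          have hQlen : Q.length < Fintype.card V := by
            rw [← hlen, hBd, ← hQ, List.flatMap_cons, childrenIn, hM]
            simp [hw]
          simp only [List.filter_cons, hw, decide_true, if_true, List.filter_nil]
          simpa [h5] using hI'.append hQlen w
        · rw [if_neg hw, List.filter_append]
          simpa [hw] using hI'
      · rw [List.flatMap_append, ← List.cons_append]
        simpa [childrenIn] using h₂.1
      · rw [h₂.2.1 2 (by simp [forAdj, Prog.vars])]
        simp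
      · have h3 := h₂.2.2 4 (by simp [forAdj, Prog.arrs])
        exact ⟨fun v q hq => by rw [h3]; exact hpar.1 v q hq, by rw [h3]; exact hpar.2⟩
      · exact (hadj' w).congr (h₂.2.2 1 (by simp [forAdj, Prog.arrs]))
          (h₂.2.2 2 (by simp [forAdj, Prog.arrs]))
  · refine ⟨⟨by simp, fun k hk => ?_⟩, by simp, hp, hadj⟩
    obtain rfl : k = 0 := by simpa using hk
    simp

end

end RAM

/-! ### Linked lists -/

section LinkedList

/-- The last entry of `a :: L`. -/
def lastFrom (a : ℕ) : List ℕ → ℕ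
  | [] => a
  | x :: L => lastFrom x L

/-- The entries of `L` follow the cell `a` in the linked list with successor function `nx`. -/
def Linked (nx : ℕ → ℕ) (a : ℕ) : List ℕ → Prop
  | [] => True
  | x :: L => nx a = x ∧ Linked nx x L

theorem lastFrom_append (a : ℕ) (L M : List ℕ) :
    lastFrom a (L ++ M) = lastFrom (lastFrom a L) M := by
  induction L generalizing a with
  | nil => rfl
  | cons x L ih => exact ih x

theorem lastFrom_mem (a : ℕ) (L : List ℕ) : lastFrom a L ∈ a :: L := by
  induction L generalizing a with
  | nil => simp [lastFrom]
  | cons x L ih => exact List.mem_cons_of_mem _ (ih x)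

variable {nx nx' : ℕ → ℕ}

theorem linked_append {a : ℕ} {L M : List ℕ} :
    Linked nx a (L ++ M) ↔ Linked nx a L ∧ Linked nx (lastFrom a L) M := by
  induction L generalizing a with
  | nil => simp [Linked, lastFrom]
  | cons x L ih => simp [Linked, lastFrom, ih, and_assoc]

theorem Linked.congr {a : ℕ} {L : List ℕ} (h : Linked nx a L) (hn : (a :: L).Nodup)
    (hnx : ∀ y ∈ a :: L, y ≠ lastFrom a L → nx' y = nx y) : Linked nx' a L := by
  induction L generalizing a with
  | nil => trivial
  | cons x L ih =>
    rw [List.nodup_cons] at hn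
    refine ⟨(hnx a List.mem_cons_self ?_).trans h.1, ih h.2 hn.2 fun y hy hyl =>
      hnx y (List.mem_cons_of_mem _ hy) hyl⟩
    intro ha
    rw [ha] at hn
    exact hn.1 (lastFrom_mem x L)

theorem Linked.insert {a x p : ℕ} {L M : List ℕ} (h : Linked nx a (L ++ M))
    (hn : (a :: (L ++ M)).Nodup) (hx : x ∉ a :: (L ++ M)) (hp : lastFrom a L = p) :
    Linked (Function.update (Function.update nx x (nx p)) p x) a (L ++ x :: M) := by
  rw [← List.cons_append] at hn hx
  rw [List.mem_append, not_or] at hx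
  have hpL : p ∈ a :: L := hp ▸ lastFrom_mem a L
  have hxp : x ≠ p := fun hxp => hx.1 (hxp ▸ hpL)
  rw [linked_append] at h ⊢
  rw [hp] at h ⊢
  rw [List.nodup_append] at hn
  refine ⟨h.1.congr hn.1 fun y hy hyp => ?_, Function.update_self .., ?_⟩
  · have hyx : y ≠ x := fun hyx => hx.1 (hyx ▸ hy)
    rw [hp] at hyp
    rw [Function.update_of_ne hyp, Function.update_of_ne hyx]
  · rcases M with _ | ⟨y, M⟩
    · trivial
    · refine ⟨?_, h.2.2.congr hn.2.1 fun z hz _ => ?_⟩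
      · rw [Function.update_of_ne hxp, Function.update_self]
        exact h.2.1
      · have hzx : z ≠ x := fun hzx => hx.2 (hzx ▸ hz)
        rw [Function.update_of_ne (hn.2.2 p hpL z hz).symm, Function.update_of_ne hzx]

theorem Linked.getElem {a : ℕ} {L : List ℕ} (h : Linked nx a L) {k : ℕ} (hk : k < L.length) :
    nx ((a :: L)[k]'(by simp; omega)) = (a :: L)[k + 1]'(by simpa using hk) := by
  induction L generalizing a k with
  | nil => simp at hk
  | cons x L ih =>
    rcases k with _ | k
    · exact h.1
    · simpa using ih h.2 (k := k) (by simpa using hk)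

end LinkedList

/-! ### Depth first search of the tree -/

section

variable {V : Type*} [DecidableEq V]

theorem treeOrder_append_singleton {p : V → Option V} {s : V} {W : List V} {x q : V}
    (hq : p x = some q) : treeOrder p s (W ++ [x]) = insertAfter q x (treeOrder p s W) := by
  simp [treeOrder, List.foldl_append, hq]

theorem treeOrder_append_root {p : V → Option V} {s : V} (hps : p s = none) (W : List V) :
    treeOrder p s (W ++ [s]) = treeOrder p s W := by
  simp [treeOrder, List.foldl_append, hps]

end

namespace RAM

variable {V : Type*} [Fintype V] [DecidableEq V] {G : SimpleGraph V} [DecidableRel G.Adj] {s : V}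
  {ρ π B W : List V} {e : V ≃ Fin (Fintype.card V)}

/-- Depth first search of the tree whose parent function is in the array `4`: go through the order in
the array `6` and insert each vertex after its parent into a linked list, whose successor function is
in the array `18`; then write the list into the array `7`. -/
def dfsTree : Prog :=
  .seq (forUp 6 (.ite (.eq (.var 4) (.var 1)) .skip
      (.seq (.write 18 (.var 4) (.read 18 (.read 4 (.var 4))))
        (.write 18 (.read 4 (.var 4)) (.var 4)))))
    (.seq (.assign 6 (.var 1))
      (forUp 6 (.seq (.write 7 (.pred (.var 2)) (.var 6)) (.assign 6 (.read 18 (.var 6))))))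

theorem runsWithin_dfsTree {st : Store} (hC : IsCliqueOrder G s ρ π)
    (hB : IsTopological (lastInParent G π) B) (hW : IsTieBreakOrder G s ρ π B.reverse W)
    (hp : HoldsParents G e s π st) (hn : st.var 0 = Fintype.card V) (h1 : st.var 1 = (e s : ℕ))
    (hl : HoldsList e st 6 (s :: W).reverse) :
    RunsWithin dfsTree st (100 * (Fintype.card V + G.edgeFinset.card + 1)) fun st' =>
      HoldsList e st' 7 (treeOrder (lastInParent G π) s W.reverse) := by
  set p := lastInParent G π with hpdef
  have hτ := hW.order.reverse
  have hlen := hτ.length_eq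
  have hps : p s = none := hC.parent_start
  have htree : treeOrder p s (s :: W).reverse = treeOrder p s W.reverse := by
    rw [List.reverse_cons, treeOrder_append_root hps]
  have hsW := List.nodup_cons.1 hW.order.1
  -- `s` is the last vertex
  have hsplit : ∀ d v t, (s :: W).reverse = d ++ v :: t → v ≠ s → ∃ t', W.reverse = d ++ v :: t' := by
    intro d v t ht hvs
    rw [List.reverse_cons] at ht
    rcases List.eq_nil_or_concat t with rfl | ⟨t', b, rfl⟩
    · have := List.append_inj_right' ht rfl
      simp only [List.cons.injEq, and_true] at this
      exact absurd this.symm hvs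
    · refine ⟨t', List.append_inj_left' (t₁ := [s]) (t₂ := [b]) ?_ rfl⟩
      simpa using ht
  have hparent : ∀ A x C, W.reverse = A ++ x :: C → ∃ q, p x = some q ∧ (q = s ∨ q ∈ A) :=
    fun A x C hx => hC.parent_mem_of_split hB hW hx
  have hL := hC.isTreeOrder hB hW
  have hfirst := runsWithin_forUp (st := st) (e := e) (a := 6) (p := .ite (.eq (.var 4) (.var 1)) .skip
      (.seq (.write 18 (.var 4) (.read 18 (.read 4 (.var 4))))
        (.write 18 (.read 4 (.var 4)) (.var 4)))) (s :: W).reverse (fun _ => 15)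
    (I := fun d st' => ∃ L, treeOrder p s d = s :: L ∧
      Linked (st'.arr 18) (e s) (L.map fun v => (e v : ℕ))) hl (hn.trans hlen.symm)
    (by simp [Prog.vars]) (by simp [Prog.vars]) (by simp [Prog.arrs]) ⟨[], rfl, trivial⟩
    (fun d st x y h => h) ?_
  · refine RunsWithin.seq_le hfirst.frame (m' := 40 * Fintype.card V + 40) ?_ ?_
    · simp only [hlen, List.map_const', List.sum_replicate, smul_eq_mul]
      omega
    · rintro st₁ ⟨⟨L, hLe, hlink⟩, hvar, harr⟩
      rw [htree] at hLe
      have hlenL : (s :: L).length = Fintype.card V := by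
        rw [← hLe]
        exact (hL.isTopological hW.mem).order.length_eq
      rw [hLe]
      have h0₁ : st₁.var 0 = Fintype.card V := (hvar 0 (by simp [forUp, Prog.vars])).trans hn
      have h1₁ : st₁.var 1 = (e s : ℕ) := (hvar 1 (by simp [forUp, Prog.vars])).trans h1
      have hl₁ : HoldsList e st₁ 6 (s :: W).reverse := fun k hk => by
        rw [harr 6 (by simp [forUp, Prog.arrs]), hl k hk]
      refine RunsWithin.seq_le (m := 2) (m' := 30 * Fintype.card V + 30)
        (Q := (· = st₁.setVar 6 (e s)))
        (.of_exec trivial le_rfl (by simp [Prog.exec, Expr.eval, h1₁])) (by omega) ?_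
      rintro _ rfl
      refine (runsWithin_forUp (st := st₁.setVar 6 (e s)) (e := e) (a := 6)
        (p := .seq (.write 7 (.pred (.var 2)) (.var 6)) (.assign 6 (.read 18 (.var 6))))
        (s :: W).reverse (fun _ => 10)
        (I := fun d st' => (∀ k (hk : k < (s :: L).length), k < d.length →
            st'.arr 7 k = (e (s :: L)[k] : ℕ)) ∧
          ∀ hd : d.length < (s :: L).length, st'.var 6 = (e (s :: L)[d.length] : ℕ))
        hl₁ (h0₁.trans hlen.symm) (by simp [Prog.vars]) (by simp [Prog.vars]) (by simp [Prog.arrs])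
        ⟨by simp, by simp⟩ (fun d st x y h => h) ?_).mono ?_ fun st' h k hk => ?_
      · rintro d v t st' hd ⟨hI1, hI2⟩ h4 h2 hvar' harr'
        refine .of_exec ⟨trivial, trivial⟩ (by simp [Prog.maxCost, Expr.cost]) ?_
        have hdlt : d.length < (s :: L).length := by
          rw [hlenL, ← hlen, hd]
          simp
        have h18 : st'.arr 18 = st₁.arr 18 := harr' 18 (by simp [Prog.arrs])
        simp only [Prog.exec, Expr.eval, h2, Nat.add_sub_cancel, hI2 hdlt, Store.setArr_arr,
          Store.setVar_arr, Store.setVar_var, if_true, h18]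
        refine ⟨fun k hk hkd => ?_, fun hd' => ?_⟩
        · simp only [List.length_append, List.length_singleton] at hkd
          by_cases hk' : k = d.length
          · subst hk'
            simp
          · rw [Function.update_of_ne hk', hI1 k hk (by omega)]
        · have h3 := hlink.getElem (k := d.length) (by simpa using hd')
          have h5 : ∀ j (hj : j < (s :: L).length), ((e s : ℕ) :: L.map fun v => (e v : ℕ))[j]'(by
              simpa using hj) = (e (s :: L)[j] : ℕ) := fun j hj => by
            rcases j with _ | j <;> simp
          rw [h5 _ hdlt, h5 (d.length + 1) (by simpa using hd')] at h3
          simpa [hI2 hdlt] using h3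
      · simp only [hlen, List.map_const', List.sum_replicate, smul_eq_mul]
        omega
      · exact h.1 k hk (by rw [hlen, ← hlenL]; exact hk)
  · rintro d v t st' hd ⟨L, hLe, hlink⟩ h4 - hvar harr
    refine RunsWithin.of_exec ?_ ?_ ?_
    · exact ⟨trivial, trivial, trivial⟩
    · simp [Prog.maxCost, Test.cost, Expr.cost]
    have h1' : st'.var 1 = (e s : ℕ) := (hvar 1 (by simp [Prog.vars])).trans h1
    have hp4 : st'.arr 4 = st.arr 4 := harr 4 (by simp [Prog.arrs])
    simp only [Prog.exec, Test.Holds, Expr.eval, h4, h1', num_inj]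
    by_cases hvs : v = s
    · rw [if_pos hvs]
      rw [hvs, treeOrder_append_root hps]
      exact ⟨L, hLe, hlink⟩
    · obtain ⟨t', ht'⟩ := hsplit d v t hd hvs
      obtain ⟨q, hq, hqd⟩ := hparent d v t' ht'
      have hnd : (s :: (d ++ v :: t')).Nodup := by
        rw [← ht', List.nodup_cons]
        simpa using hsW
      have hnd' : (s :: d).Nodup := by
        rw [← List.cons_append] at hnd
        exact hnd.of_append_left
      have hvd : v ∉ d := fun h' => by
        rw [List.nodup_cons, List.nodup_append] at hnd
        exact hnd.2.2.2 v h' v List.mem_cons_self rfl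
      have htd := isTreeOrder_treeOrder hps hnd' fun A x C hx =>
        hparent A x (C ++ v :: t') (by rw [ht', hx]; simp)
      rw [hLe] at htd
      have hqL : q ∈ s :: L := (htd.mem_iff q).2 hqd
      have hvL : v ∉ s :: L := fun h' => ((htd.mem_iff v).1 h').elim hvs hvd
      rw [if_neg hvs, treeOrder_append_singleton hq, hLe]
      simp only [Store.setArr_arr, if_true, (by decide : (4 : ℕ) ≠ 18), if_false, hp4, h4, hp.1 v q hq,
        Store.setArr_var]
      obtain ⟨A, C, hAC, hqA⟩ : ∃ A C, s :: L = A ++ q :: C ∧ q ∉ A := by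
        obtain ⟨A, C, h⟩ := List.append_of_mem hqL
        refine ⟨A, C, h, fun h' => ?_⟩
        have := htd.nodup
        rw [h, List.nodup_append] at this
        exact this.2.2 q h' q List.mem_cons_self rfl
      rw [hAC, insertAfter_append hqA]
      have hnum : ((s :: L).map fun v => (e v : ℕ)).Nodup :=
        htd.nodup.map fun a b hab => num_inj.1 hab
      have hvnum : (e v : ℕ) ∉ (s :: L).map fun v => (e v : ℕ) := fun h' => by
        obtain ⟨u, hu, huv⟩ := List.mem_map.1 h'
        exact hvL (num_inj.1 huv ▸ hu)
      rcases A with _ | ⟨a, A⟩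
      · simp only [List.nil_append, List.cons.injEq] at hAC
        obtain ⟨rfl, rfl⟩ := hAC
        exact ⟨v :: L, rfl, hlink.insert (L := []) (M := L.map _) hnum hvnum rfl⟩
      · simp only [List.cons_append, List.cons.injEq] at hAC
        obtain ⟨rfl, rfl⟩ := hAC
        refine ⟨A ++ q :: v :: C, rfl, ?_⟩
        have h3 : (A ++ q :: C).map (fun v => (e v : ℕ)) =
            (A ++ [q]).map (fun v => (e v : ℕ)) ++ C.map fun v => (e v : ℕ) := by simp
        rw [List.map_cons, h3] at hnum hvnum
        rw [h3] at hlink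
        have := hlink.insert hnum hvnum (p := e q) (by simp [lastFrom_append, lastFrom])
        simpa using this

end RAM

/-! ### Doubly linked lists -/

/-- The list `L` is stored as a doubly linked list with successor function `nx` and predecessor
function `pv` between the sentinels `a` and `b`. -/
structure DoublyLinked (nx pv : ℕ → ℕ) (a b : ℕ) (L : List ℕ) : Prop where
  nodup : (a :: (L ++ [b])).Nodup
  next : Linked nx a (L ++ [b])
  prev : Linked pv b (L.reverse ++ [a])

theorem Linked.remove {nx : ℕ → ℕ} {a x p : ℕ} {L M : List ℕ} (h : Linked nx a (L ++ x :: M))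
    (hn : (a :: (L ++ x :: M)).Nodup) (hp : lastFrom a L = p) :
    Linked (Function.update nx p (nx x)) a (L ++ M) := by
  rw [← List.cons_append] at hn
  have hpL : p ∈ a :: L := hp ▸ lastFrom_mem a L
  rw [linked_append] at h ⊢
  rw [hp] at h ⊢
  rw [List.nodup_append] at hn
  refine ⟨h.1.congr hn.1 fun y hy hyp => ?_, ?_⟩
  · rw [hp] at hyp
    exact Function.update_of_ne hyp ..
  · rcases M with _ | ⟨y, M⟩
    · trivial
    · refine ⟨by rw [Function.update_self]; exact h.2.2.1, h.2.2.2.congr ?_ fun z hz _ => ?_⟩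
      · exact (List.nodup_cons.1 hn.2.1).2
      · exact Function.update_of_ne (hn.2.2 p hpL z (List.mem_cons_of_mem _ hz)).symm ..

/-- The successor of `x` is the head of `M`, or the final sentinel `b` if `M` is empty. -/
theorem Linked.eq_lastFrom_reverse {nx : ℕ → ℕ} {a b x : ℕ} {L M : List ℕ}
    (h : Linked nx a (L ++ x :: (M ++ [b]))) : nx x = lastFrom b M.reverse := by
  rw [linked_append] at h
  rcases M with _ | ⟨y, M⟩
  · exact h.2.2.1
  · rw [List.reverse_cons, lastFrom_append]
    exact h.2.2.1

namespace DoublyLinked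

variable {nx pv : ℕ → ℕ} {a b w f : ℕ} {A C : List ℕ}

theorem symm {L : List ℕ} (h : DoublyLinked nx pv a b L) : DoublyLinked pv nx b a L.reverse := by
  refine ⟨?_, h.prev, by rw [List.reverse_reverse]; exact h.next⟩
  have := List.nodup_reverse.2 h.nodup
  simpa using this

theorem next_eq (h : DoublyLinked nx pv a b (A ++ w :: C)) : nx w = lastFrom b C.reverse := by
  have := h.next
  rw [List.append_assoc, List.cons_append] at this
  exact this.eq_lastFrom_reverse

theorem prev_eq (h : DoublyLinked nx pv a b (A ++ w :: C)) : pv w = lastFrom a A := by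
  have := h.symm
  rw [List.reverse_append, List.reverse_cons, List.append_assoc, List.singleton_append] at this
  simpa using this.next_eq

theorem remove (h : DoublyLinked nx pv a b (A ++ w :: C)) :
    DoublyLinked (Function.update nx (pv w) (nx w)) (Function.update pv (nx w) (pv w)) a b
      (A ++ C) := by
  have key : ∀ {nx pv : ℕ → ℕ} {a b : ℕ} {A C : List ℕ}, DoublyLinked nx pv a b (A ++ w :: C) →
      Linked (Function.update nx (pv w) (nx w)) a (A ++ C ++ [b]) := by
    intro nx pv a b A C h
    have h1 := h.next
    have h2 := h.nodup
    rw [List.append_assoc, List.cons_append] at h1 h2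
    rw [List.append_assoc]
    exact h1.remove h2 h.prev_eq.symm
  refine ⟨h.nodup.sublist ?_, key h, ?_⟩
  · refine List.Sublist.cons_cons _ (List.Sublist.append_right ?_ _)
    exact List.Sublist.append_left (List.sublist_cons_self w C) A
  · have h1 := h.symm
    rw [List.reverse_append, List.reverse_cons, List.append_assoc, List.singleton_append] at h1
    rw [List.reverse_append]
    exact key h1

theorem insert_before (h : DoublyLinked nx pv a b (A ++ f :: C))
    (hw : w ∉ a :: (A ++ f :: C ++ [b])) :
    DoublyLinked (Function.update (Function.update nx w (nx (pv f))) (pv f) w)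
      (Function.update (Function.update pv w (pv f)) f w) a b (A ++ w :: f :: C) := by
  have h1 := h.next
  have h2 := h.nodup
  refine ⟨?_, ?_, ?_⟩
  · have hperm : (a :: (A ++ w :: f :: C ++ [b])).Perm (w :: a :: (A ++ f :: C ++ [b])) := by
      refine List.Perm.trans (List.Perm.cons a ?_) (List.Perm.swap w a _)
      rw [List.append_assoc, List.append_assoc]
      exact List.perm_middle
    rw [hperm.nodup_iff, List.nodup_cons]
    exact ⟨hw, h2⟩
  · rw [List.append_assoc] at h1 h2 hw ⊢
    exact h1.insert h2 hw h.prev_eq.symm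
  · have h3 := h.symm
    have h4 := h3.next
    have h5 := h3.nodup
    have h6 : w ∉ b :: ((A ++ f :: C).reverse ++ [a]) := by
      simp only [List.mem_cons, List.mem_append, List.mem_reverse, List.not_mem_nil, or_false,
        not_or] at hw ⊢
      tauto
    have e1 : (A ++ f :: C).reverse ++ [a] = (C.reverse ++ [f]) ++ (A.reverse ++ [a]) := by simp
    have e2 : (A ++ w :: f :: C).reverse ++ [a] = (C.reverse ++ [f]) ++ w :: (A.reverse ++ [a]) := by
      simp
    rw [e1] at h4 h5 h6
    rw [e2]
    exact h4.insert h5 h6 (by simp [lastFrom_append, lastFrom])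

theorem next_head {x : ℕ} {L : List ℕ} (h : DoublyLinked nx pv a b (x :: L)) : nx a = x :=
  h.next.1

end DoublyLinked

/-! ### Partition refinement -/

section Refinement

variable {V : Type*}

/-- The class of `x` comes before the class of `y` in the partition that has been refined with the
sets `S u` for the elements `u` of `D`, and, finally, with `M`. -/
def ClassLT (D : List V) (S : V → V → Prop) (M : List V) (x y : V) : Prop :=
  LexGT D (S · x) (S · y) ∨ ((∀ u ∈ D, S u x ↔ S u y) ∧ x ∈ M ∧ y ∉ M)

/-- `x` and `y` are in the same class of the partition that has been refined with the sets `S u` for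
the elements `u` of `D`, and, finally, with `M`. -/
def SameClass (D : List V) (S : V → V → Prop) (M : List V) (x y : V) : Prop :=
  (∀ u ∈ D, S u x ↔ S u y) ∧ (x ∈ M ↔ y ∈ M)

variable {D : List V} {S : V → V → Prop} {M : List V} {x y z : V}

theorem SameClass.symm (h : SameClass D S M x y) : SameClass D S M y x :=
  ⟨fun u hu => (h.1 u hu).symm, h.2.symm⟩

theorem SameClass.trans (h : SameClass D S M x y) (h' : SameClass D S M y z) :
    SameClass D S M x z :=
  ⟨fun u hu => (h.1 u hu).trans (h'.1 u hu), h.2.trans h'.2⟩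

theorem ClassLT.asymm (h : ClassLT D S M x y) : ¬ ClassLT D S M y x := by
  rintro (h' | h') <;> rcases h with h | h
  · exact h.asymm h'
  · exact h'.not_forall_iff fun u hu => (h.1 u hu).symm
  · exact h.not_forall_iff fun u hu => (h'.1 u hu).symm
  · exact h.2.2 h'.2.1

theorem ClassLT.trans_same (h : ClassLT D S M x y) (h' : SameClass D S M y z) :
    ClassLT D S M x z := by
  rcases h with h | h
  · exact Or.inl (h.congr (fun _ _ => Iff.rfl) h'.1)
  · exact Or.inr ⟨fun u hu => (h.1 u hu).trans (h'.1 u hu), h.2.1, mt h'.2.2 h.2.2⟩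

theorem SameClass.trans_lt (h : SameClass D S M x y) (h' : ClassLT D S M y z) :
    ClassLT D S M x z := by
  rcases h' with h' | h'
  · exact Or.inl (h'.congr (fun u hu => (h.1 u hu).symm) fun _ _ => Iff.rfl)
  · exact Or.inr ⟨fun u hu => (h.1 u hu).trans (h'.1 u hu), h.2.2 h'.2.1, h'.2.2⟩

theorem ClassLT.not_same (h : ClassLT D S M x y) : ¬ SameClass D S M x y := fun h' =>
  (h.trans_same h'.symm).asymm (h.trans_same h'.symm)

variable [DecidableEq V]

/-- The order of the elements in the refined partition: inside of a class, they are in the reverse of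
the order `ρ`. -/
def RefineLT (ρ D : List V) (S : V → V → Prop) (M : List V) (x y : V) : Prop :=
  ClassLT D S M x y ∨ (SameClass D S M x y ∧ ρ.idxOf y < ρ.idxOf x)

/-- `L` is the order of its elements in the refined partition, and `cl` gives the numbers of the
classes. -/
structure IsRefined (ρ D : List V) (S : V → V → Prop) (M L : List V) (cl : V → ℕ) : Prop where
  nodup : L.Nodup
  sorted : L.Pairwise (RefineLT ρ D S M)
  same_iff : ∀ x ∈ L, ∀ y ∈ L, cl x = cl y ↔ SameClass D S M x y

/-- For each class, `fst` gives the number of its first element. -/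
def HoldsFirst (num : V → ℕ) (ρ L : List V) (cl : V → ℕ) (fst : ℕ → ℕ) : Prop :=
  ∀ x ∈ L, ∃ f ∈ L, fst (cl x) = num f ∧ cl f = cl x ∧
    ∀ y ∈ L, cl y = cl x → ρ.idxOf y ≤ ρ.idxOf f

variable {ρ L : List V} {cl : V → ℕ} {w : V}

theorem IsRefined.congr {D' M' : List V} {S' : V → V → Prop} (h : IsRefined ρ D S M L cl)
    (hlt : ∀ x ∈ L, ∀ y ∈ L, ClassLT D S M x y → ClassLT D' S' M' x y)
    (hsame : ∀ x ∈ L, ∀ y ∈ L, SameClass D S M x y ↔ SameClass D' S' M' x y) :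
    IsRefined ρ D' S' M' L cl :=
  ⟨h.nodup, h.sorted.imp_of_mem fun {x y} hx hy hxy =>
    hxy.imp (hlt x hx y hy) (And.imp_left (hsame x hx y hy).1),
    fun x hx y hy => (h.same_iff x hx y hy).trans (hsame x hx y hy)⟩

theorem IsRefined.sublist {L' : List V} (h : IsRefined ρ D S M L cl) (hL : L'.Sublist L) :
    IsRefined ρ D S M L' cl :=
  ⟨h.nodup.sublist hL, h.sorted.sublist hL,
    fun x hx y hy => h.same_iff x (hL.subset hx) y (hL.subset hy)⟩

/-- If the first element of a class is not the only one, then the next element in the order is the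
second element of the class. -/
theorem IsRefined.exists_next {A C : List V} (h : IsRefined ρ D S M (A ++ w :: C) cl)
    (hmax : ∀ y ∈ A ++ w :: C, cl y = cl w → ρ.idxOf y ≤ ρ.idxOf w)
    (hx : x ∈ A ++ w :: C) (hxw : x ≠ w) (hcx : cl x = cl w) :
    ∃ z C', C = z :: C' ∧ cl z = cl w ∧
      ∀ y ∈ A ++ w :: C, y ≠ w → cl y = cl w → ρ.idxOf y ≤ ρ.idxOf z := by
  have hw : w ∈ A ++ w :: C := by simp
  have hs := h.sorted
  rw [List.pairwise_append, List.pairwise_cons] at hs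
  have hC : ∀ y ∈ A ++ w :: C, y ≠ w → cl y = cl w → y ∈ C := by
    intro y hy hyw hcy
    rw [List.mem_append, List.mem_cons] at hy
    rcases hy with hy | hy | hy
    · rcases hs.2.2 y hy w List.mem_cons_self with h1 | h1
      · exact absurd ((h.same_iff y (by simp [hy]) w hw).1 hcy) h1.not_same
      · have := hmax y (by simp [hy]) hcy
        exact absurd h1.2 (by omega)
    · exact absurd hy hyw
    · exact hy
  have hxC := hC x hx hxw hcx
  rcases C with _ | ⟨z, C⟩
  · simp at hxC
  · rw [List.pairwise_cons] at hs
    have hzL : z ∈ A ++ w :: z :: C := by simp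
    have hcz : cl z = cl w := by
      by_contra hcz
      have h1 : ClassLT D S M w z := (hs.2.1.1 z List.mem_cons_self).resolve_right fun h1 =>
        hcz ((h.same_iff w hw z hzL).2 h1.1).symm
      rw [List.mem_cons] at hxC
      rcases hxC with rfl | hxC
      · exact hcz hcx
      · have h2 := (h.same_iff x hx w hw).1 hcx
        rcases hs.2.1.2.1 x hxC with h3 | h3
        · exact h1.asymm (h3.trans_same h2)
        · exact hcz ((h.same_iff z hzL w hw).2 (h3.1.trans h2))
    refine ⟨z, C, rfl, hcz, fun y hy hyw hcy => ?_⟩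
    have hyC := hC y hy hyw hcy
    rw [List.mem_cons] at hyC
    rcases hyC with rfl | hyC
    · exact le_rfl
    · rcases hs.2.1.2.1 y hyC with h3 | h3
      · exact absurd ((h.same_iff z hzL y hy).1 (hcz.trans hcy.symm)) h3.not_same
      · exact h3.2.le

/-- Move `w` from its class, whose first element is `f`, to the end of the class number `k`, which
precedes it. -/
theorem IsRefined.move (h : IsRefined ρ D S M L cl) (hw : w ∈ L) (hwM : w ∉ M)
    (hM : ∀ x ∈ M, ρ.idxOf w < ρ.idxOf x) {k : ℕ}
    (hk : ∀ x ∈ L, cl x = k ↔ x ∈ M ∧ ∀ u ∈ D, S u x ↔ S u w) {f : V} (hfL : f ∈ L)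
    (hf : cl f = cl w) (hmax : ∀ y ∈ L, cl y = cl w → ρ.idxOf y ≤ ρ.idxOf f) {A R : List V}
    (hsub : (A ++ R).Sublist L) (hperm : (A ++ w :: R).Perm L)
    (hA : ∀ x ∈ A, RefineLT ρ D S M x f) (hR : ∀ y ∈ R, y = f ∨ RefineLT ρ D S M f y) :
    IsRefined ρ D S (M ++ [w]) (A ++ w :: R) (Function.update cl w k) := by
  have hfw : SameClass D S M f w := (h.same_iff f hfL w hw).1 hf
  have hnd : (A ++ w :: R).Nodup := hperm.nodup_iff.2 h.nodup
  have hne : ∀ x ∈ A ++ R, x ≠ w := by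
    rintro x hx rfl
    rw [List.perm_middle.nodup_iff, List.nodup_cons] at hnd
    exact hnd.1 hx
  have hmem : ∀ x, x ≠ w → (x ∈ M ++ [w] ↔ x ∈ M) := fun x hx => by simp [hx]
  have hwM' : w ∈ M ++ [w] := by simp
  have hsame : ∀ x y, x ≠ w → y ≠ w → (SameClass D S M x y ↔ SameClass D S (M ++ [w]) x y) :=
    fun x y hx hy => by rw [SameClass, SameClass, hmem x hx, hmem y hy]
  have hlt : ∀ x y, x ≠ w → y ≠ w → RefineLT ρ D S M x y → RefineLT ρ D S (M ++ [w]) x y :=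
    fun x y hx hy hxy => by
      rw [RefineLT, ClassLT, ← hsame x y hx hy, hmem x hx, hmem y hy]
      exact hxy
  -- the new class of `w` consists of the elements of `M` that cannot be distinguished from `w`
  have hsamew : ∀ x, x ≠ w → (SameClass D S (M ++ [w]) x w ↔ x ∈ M ∧ ∀ u ∈ D, S u x ↔ S u w) :=
    fun x hx => by
      rw [SameClass, hmem x hx]
      simp only [hwM', iff_true]
      tauto
  refine ⟨hnd, ?_, ?_⟩
  · have hs := h.sorted.sublist hsub
    rw [List.pairwise_append] at hs ⊢
    rw [List.pairwise_cons]
    refine ⟨hs.1.imp_of_mem fun {x y} hx hy => hlt x y (hne x (by simp [hx])) (hne y (by simp [hy])),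
      ⟨fun y hy => ?_, hs.2.1.imp_of_mem fun {x y} hx hy =>
        hlt x y (hne x (by simp [hx])) (hne y (by simp [hy]))⟩, fun x hx y hy => ?_⟩
    · have hyw := hne y (by simp [hy])
      have h1 : SameClass D S M w y ∨ ClassLT D S M w y := by
        rcases hR y hy with rfl | h1 | h1
        · exact Or.inl hfw.symm
        · exact Or.inr (hfw.symm.trans_lt h1)
        · exact Or.inl (hfw.symm.trans h1.1)
      rcases h1 with h1 | h1 | h1
      · exact Or.inl (Or.inr ⟨h1.1, hwM', by rw [hmem y hyw]; exact mt h1.2.2 hwM⟩)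
      · exact Or.inl (Or.inl h1)
      · exact absurd h1.2.1 hwM
    · have hxw := hne x (by simp [hx])
      rw [List.mem_cons] at hy
      rcases hy with rfl | hy
      · rcases hA x hx with h1 | h1
        · rcases h1.trans_same hfw with h2 | h2
          · exact Or.inl (Or.inl h2)
          · exact Or.inr ⟨(hsamew x hxw).2 ⟨h2.2.1, h2.1⟩, hM x h2.2.1⟩
        · have hxL : x ∈ L := hsub.subset (by simp [hx])
          have := hmax x hxL (((h.same_iff x hxL f hfL).2 h1.1).trans hf)
          exact absurd h1.2 (by omega)
      · exact hlt x y hxw (hne y (by simp [hy])) (hs.2.2 x hx y hy)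
  · intro x hx y hy
    rw [hperm.mem_iff] at hx hy
    by_cases hxw : x = w <;> by_cases hyw : y = w
    · rw [hxw, hyw]
      exact iff_of_true rfl ⟨fun _ _ => Iff.rfl, Iff.rfl⟩
    · rw [hxw, Function.update_self, Function.update_of_ne hyw, eq_comm, hk y hy, ← hsamew y hyw]
      exact ⟨SameClass.symm, SameClass.symm⟩
    · rw [hyw, Function.update_self, Function.update_of_ne hxw, hk x hx, ← hsamew x hxw]
    · rw [Function.update_of_ne hxw, Function.update_of_ne hyw, h.same_iff x hx y hy, hsame x y hxw hyw]

/-- Moving `w` to the class `k` changes the first element of its old class only if `w` itself was the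
first one, and leaves that of `k` unchanged unless `k` is a new class. -/
theorem HoldsFirst.move {num : V → ℕ} {fst fst' : ℕ → ℕ} (h : HoldsFirst num ρ L cl fst)
    (hw : w ∈ L) (hwM : w ∉ M) (hM : ∀ x ∈ M, ρ.idxOf w < ρ.idxOf x) {k : ℕ}
    (hk : ∀ x ∈ L, cl x = k ↔ x ∈ M ∧ ∀ u ∈ D, S u x ↔ S u w)
    (hfk : (∀ x ∈ L, cl x ≠ k) → fst k = num w) (h1 : ∀ c ≠ cl w, fst' c = fst c)
    (h2 : ∀ x ∈ L, x ≠ w → cl x = cl w → ∃ z ∈ L, z ≠ w ∧ fst' (cl w) = num z ∧ cl z = cl w ∧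
      ∀ y ∈ L, y ≠ w → cl y = cl w → ρ.idxOf y ≤ ρ.idxOf z) :
    HoldsFirst num ρ L (Function.update cl w k) fst' := by
  have hkw : k ≠ cl w := fun h' => hwM ((hk w hw).1 h'.symm).1
  -- the class number `k`
  have hclk : ∃ f ∈ L, fst' k = num f ∧ Function.update cl w k f = k ∧
      ∀ y ∈ L, Function.update cl w k y = k → ρ.idxOf y ≤ ρ.idxOf f := by
    rw [h1 k hkw]
    by_cases hex : ∃ y ∈ L, cl y = k
    · obtain ⟨y, hy, rfl⟩ := hex
      obtain ⟨f, hf, hff, hcf, hmax⟩ := h y hy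
      have hfM := ((hk f hf).1 hcf).1
      have hfw : f ≠ w := fun h' => hwM (h' ▸ hfM)
      refine ⟨f, hf, hff, by rw [Function.update_of_ne hfw, hcf], fun z hz hcz => ?_⟩
      by_cases hzw : z = w
      · rw [hzw]
        exact (hM f hfM).le
      · rw [Function.update_of_ne hzw] at hcz
        exact hmax z hz hcz
    · push Not at hex
      refine ⟨w, hw, hfk hex, Function.update_self .., fun z hz hcz => ?_⟩
      by_cases hzw : z = w
      · rw [hzw]
      · rw [Function.update_of_ne hzw] at hcz
        exact absurd hcz (hex z hz)
  intro x hx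
  by_cases hxk : Function.update cl w k x = k
  · rw [hxk]
    exact hclk
  have hxw : x ≠ w := fun h' => hxk (by rw [h', Function.update_self])
  rw [Function.update_of_ne hxw] at hxk ⊢
  have hother : ∀ y ∈ L, Function.update cl w k y = cl x → y ≠ w ∧ cl y = cl x := by
    intro y hy hcy
    by_cases hyw : y = w
    · rw [hyw, Function.update_self] at hcy
      exact absurd hcy.symm hxk
    · rw [Function.update_of_ne hyw] at hcy
      exact ⟨hyw, hcy⟩
  by_cases hcx : cl x = cl w
  · obtain ⟨z, hz, hzw, hfz, hcz, hmax⟩ := h2 x hx hxw hcx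
    refine ⟨z, hz, by rw [hcx, hfz], by rw [Function.update_of_ne hzw, hcz, hcx], fun y hy hcy => ?_⟩
    obtain ⟨hyw, hcy⟩ := hother y hy hcy
    exact hmax y hy hyw (hcy.trans hcx)
  · obtain ⟨f, hf, hff, hcf, hmax⟩ := h x hx
    have hfw : f ≠ w := fun h' => hcx (by rw [← hcf, h'])
    refine ⟨f, hf, by rw [h1 _ hcx, hff], by rw [Function.update_of_ne hfw, hcf], fun y hy hcy => ?_⟩
    exact hmax y hy (hother y hy hcy).2

theorem HoldsFirst.perm {num : V → ℕ} {fst : ℕ → ℕ} {L' : List V}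
    (h : HoldsFirst num ρ L cl fst) (hL : L'.Perm L) : HoldsFirst num ρ L' cl fst := by
  intro x hx
  obtain ⟨f, hf, h1, h2, h3⟩ := h x (hL.mem_iff.1 hx)
  exact ⟨f, hL.mem_iff.2 hf, h1, h2, fun y hy => h3 y (hL.mem_iff.1 hy)⟩

end Refinement

section Refinement

variable {V : Type*}

/-- The marks of the classes after the vertices in `M` have been moved, when the partition that has
been refined with the sets of the elements of `D` is being refined for `v`. If the class of `x` has
been split, then it has the mark `v`, and `nw` gives the class to which its elements are moved. -/
structure HoldsMarks (num : V → ℕ) (n : ℕ) (v : V) (D : List V) (S : V → V → Prop) (M L : List V)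
    (cl : V → ℕ) (mk nw : ℕ → ℕ) : Prop where
  subset : M ⊆ L
  marked : ∀ x ∈ L, x ∉ M → mk (cl x) = num v →
    ∃ y ∈ M, (∀ u ∈ D, S u y ↔ S u x) ∧ nw (cl x) = cl y
  unmarked : ∀ x ∈ L, x ∉ M → mk (cl x) ≠ num v → ∀ y ∈ M, ¬ ∀ u ∈ D, S u y ↔ S u x
  mem : ∀ x ∈ L, mk (cl x) = n ∨ ∃ u ∈ D ++ [v], mk (cl x) = num u

variable {num : V → ℕ} {n : ℕ} {v w : V} {ρ D M L : List V} {S : V → V → Prop} {cl : V → ℕ}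
  {mk nw : ℕ → ℕ}

theorem HoldsMarks.perm {L' : List V} (h : HoldsMarks num n v D S M L cl mk nw)
    (hL : L'.Perm L) : HoldsMarks num n v D S M L' cl mk nw :=
  ⟨fun _ hx => hL.mem_iff.2 (h.subset hx), fun x hx => h.marked x (hL.mem_iff.1 hx),
    fun x hx => h.unmarked x (hL.mem_iff.1 hx), fun x hx => h.mem x (hL.mem_iff.1 hx)⟩

variable [DecidableEq V]

/-- If the class of `w` has already been split, then `w` joins the existing class of the moved
vertices. -/
theorem HoldsMarks.of_marked (h : HoldsMarks num n v D S M L cl mk nw)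
    (hr : IsRefined ρ D S M L cl) (hw : w ∈ L) (hwM : w ∉ M) (hmk : mk (cl w) = num v) :
    (∀ x ∈ L, cl x = nw (cl w) ↔ x ∈ M ∧ ∀ u ∈ D, S u x ↔ S u w) ∧ (∃ y ∈ L, nw (cl w) = cl y) ∧
      HoldsMarks num n v D S (M ++ [w]) L (Function.update cl w (nw (cl w))) mk nw := by
  obtain ⟨y, hyM, hyw, hky⟩ := h.marked w hw hwM hmk
  have hy := h.subset hyM
  refine ⟨fun x hx => ?_, ⟨y, hy, hky⟩, ?_, ?_, ?_, fun x hx => ?_⟩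
  · rw [hky, hr.same_iff x hx y hy]
    refine ⟨fun h' => ⟨h'.2.2 hyM, fun u hu => (h'.1 u hu).trans (hyw u hu)⟩, fun h' =>
      ⟨fun u hu => (h'.2 u hu).trans (hyw u hu).symm, iff_of_true h'.1 hyM⟩⟩
  · simpa [h.subset] using hw
  · intro x hx hxM hmx
    simp only [List.mem_append, List.mem_singleton, not_or] at hxM
    rw [Function.update_of_ne hxM.2] at hmx ⊢
    obtain ⟨z, hz, hzx, hnz⟩ := h.marked x hx hxM.1 hmx
    have hzw : z ≠ w := fun h' => hwM (h' ▸ hz)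
    exact ⟨z, by simp [hz], hzx, by rw [Function.update_of_ne hzw, hnz]⟩
  · intro x hx hxM hmx z hz hzx
    simp only [List.mem_append, List.mem_singleton, not_or] at hxM hz
    rw [Function.update_of_ne hxM.2] at hmx
    rcases hz with hz | rfl
    · exact h.unmarked x hx hxM.1 hmx z hz hzx
    · have := (hr.same_iff z hw x hx).2 ⟨hzx, iff_of_false hwM hxM.1⟩
      exact hmx (this ▸ hmk)
  · by_cases hxw : x = w
    · rw [hxw, Function.update_self, hky]
      exact h.mem y hy
    · rw [Function.update_of_ne hxw]
      exact h.mem x hx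

theorem HoldsMarks.of_unmarked (h : HoldsMarks num n v D S M L cl mk nw)
    (hr : IsRefined ρ D S M L cl) (hw : w ∈ L) (hwM : w ∉ M) (hmk : mk (cl w) ≠ num v) {k : ℕ}
    (hk : ∀ x ∈ L, cl x < k) :
    (∀ x ∈ L, cl x = k ↔ x ∈ M ∧ ∀ u ∈ D, S u x ↔ S u w) ∧
      HoldsMarks num n v D S (M ++ [w]) L (Function.update cl w k)
        (Function.update (Function.update mk (cl w) (num v)) k n)
        (Function.update nw (cl w) k) := by
  refine ⟨fun x hx => iff_of_false (hk x hx).ne fun h' => h.unmarked w hw hwM hmk x h'.1 h'.2,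
    ?_, ?_, ?_, fun x hx => ?_⟩
  · simpa [h.subset] using hw
  · intro x hx hxM hmx
    simp only [List.mem_append, List.mem_singleton, not_or] at hxM
    rw [Function.update_of_ne hxM.2, Function.update_of_ne (hk x hx).ne] at hmx
    rw [Function.update_of_ne hxM.2]
    by_cases hxw : cl x = cl w
    · refine ⟨w, by simp, ((hr.same_iff w hw x hx).1 hxw.symm).1, ?_⟩
      rw [hxw, Function.update_self, Function.update_self]
    · rw [Function.update_of_ne hxw] at hmx ⊢
      obtain ⟨z, hz, hzx, hnz⟩ := h.marked x hx hxM.1 hmx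
      have hzw : z ≠ w := fun h' => hwM (h' ▸ hz)
      exact ⟨z, by simp [hz], hzx, by rw [Function.update_of_ne hzw, hnz]⟩
  · intro x hx hxM hmx z hz hzx
    simp only [List.mem_append, List.mem_singleton, not_or] at hxM hz
    rw [Function.update_of_ne hxM.2, Function.update_of_ne (hk x hx).ne] at hmx
    by_cases hxw : cl x = cl w
    · exact hmx (by rw [hxw, Function.update_self])
    · rw [Function.update_of_ne hxw] at hmx
      rcases hz with hz | rfl
      · exact h.unmarked x hx hxM.1 hmx z hz hzx
      · exact hxw ((hr.same_iff z hw x hx).2 ⟨hzx, iff_of_false hwM hxM.1⟩).symm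
  · by_cases hxw : x = w
    · rw [hxw, Function.update_self, Function.update_self]
      exact Or.inl rfl
    · rw [Function.update_of_ne hxw, Function.update_of_ne (hk x hx).ne]
      by_cases hcx : cl x = cl w
      · rw [hcx, Function.update_self]
        exact Or.inr ⟨v, by simp, rfl⟩
      · rw [Function.update_of_ne hcx]
        exact h.mem x hx

end Refinement

namespace RAM

/-! ### Partition refinement on the machine -/

/-! The elements of the partition are stored in a doubly linked list, whose pointers are in the arrays
`10` and `11`, with the sentinels `n` and `n + 1`. Array `14` holds the classes of the vertices, and
array `12` holds the first vertices of the classes. Array `15` holds the marks of the classes, and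
array `16` the numbers of the classes that have been split off. Variable `9` is a class number such
that this number and all larger ones are unused. Array `17` is nonzero for the vertices that are not
to be moved. -/

section

variable {V : Type*} [Fintype V] [DecidableEq V] {e : V ≃ Fin (Fintype.card V)}

/-- The partition of `L`, refined with the sets `S u` for `u` in `D` and then with `M`, is in the
store. -/
structure HoldsPartition (e : V ≃ Fin (Fintype.card V)) (st : Store) (ρ D : List V)
    (S : V → V → Prop) (M L : List V) : Prop where
  refined : IsRefined ρ D S M L fun x => st.arr 14 (e x)
  linked : DoublyLinked (st.arr 10) (st.arr 11) (Fintype.card V) (Fintype.card V + 1)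
    (L.map fun x => (e x : ℕ))
  first : HoldsFirst (fun x => (e x : ℕ)) ρ L (fun x => st.arr 14 (e x)) (st.arr 12)
  class_lt : ∀ x ∈ L, st.arr 14 (e x) < st.var 9

theorem HoldsPartition.congr {st st' : Store} {ρ D M L : List V} {S : V → V → Prop}
    (h : HoldsPartition e st ρ D S M L) (h9 : st'.var 9 = st.var 9)
    (ha : ∀ a ∈ [10, 11, 12, 14], st'.arr a = st.arr a) : HoldsPartition e st' ρ D S M L := by
  have h10 := ha 10 (by simp)
  have h11 := ha 11 (by simp)
  have h12 := ha 12 (by simp)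
  have h14 := ha 14 (by simp)
  exact ⟨by rw [h14]; exact h.refined, by rw [h10, h11]; exact h.linked,
    by rw [h12, h14]; exact h.first, by rw [h9, h14]; exact h.class_lt⟩

/-- Load the class of the vertex in variable `5` into variable `6`. If the class has not been split
in the round of the vertex in variable `4`, create a class for the vertices to be moved. -/
def splitClass : Prog :=
  .seq (.assign 6 (.read 14 (.var 5)))
    (.ite (.eq (.read 15 (.var 6)) (.var 4)) .skip
      (.seq (.seq (.write 15 (.var 6) (.var 4)) (.write 15 (.var 9) (.var 0)))
        (.seq (.seq (.write 16 (.var 6) (.var 9)) (.write 12 (.var 9) (.var 5)))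
          (.assign 9 (.succ (.var 9))))))

/-- Move the vertex in variable `5` to the place before the first vertex of the class in
variable `6`. -/
def relink : Prog :=
  .seq (.seq (.seq (.assign 7 (.read 11 (.var 5))) (.assign 8 (.read 10 (.var 5))))
      (.seq (.write 10 (.var 7) (.var 8)) (.write 11 (.var 8) (.var 7))))
    (.seq (.seq (.assign 7 (.read 12 (.var 6))) (.assign 8 (.read 11 (.var 7))))
      (.seq (.seq (.write 10 (.var 5) (.read 10 (.var 8))) (.write 10 (.var 8) (.var 5)))
        (.seq (.write 11 (.var 5) (.var 8)) (.write 11 (.var 7) (.var 5)))))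

/-- Move the vertex in variable `5` from the class in variable `6` to the class that has been split
off. -/
def moveVertex : Prog :=
  .seq (.write 14 (.var 5) (.read 16 (.var 6)))
    (.ite (.eq (.read 12 (.var 6)) (.var 5)) (.write 12 (.var 6) (.read 10 (.var 5))) relink)

/-- Refine the partition with the neighbours of the vertex in variable `4`, except for those that are
excluded by the array `17`. -/
def refine : Prog :=
  forAdj 8 (.ite (.eq (.read 17 (.var 5)) (.const 0)) (.seq splitClass moveVertex) .skip)

theorem update_num (f : ℕ → ℕ) (w : V) (k : ℕ) :
    (fun x => Function.update f (e w : ℕ) k (e x)) = Function.update (fun x => f (e x)) w k := by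
  funext x
  by_cases hx : x = w
  · rw [hx, Function.update_self, Function.update_self]
  · rw [Function.update_of_ne hx, Function.update_of_ne (mt num_inj.1 hx)]

variable {st : Store} {ρ D M L : List V} {S : V → V → Prop} {v w : V}

theorem runsWithin_splitClass (h : HoldsPartition e st ρ D S M L)
    (hm : HoldsMarks (fun x => (e x : ℕ)) (Fintype.card V) v D S M L (fun x => st.arr 14 (e x))
      (st.arr 15) (st.arr 16))
    (hn : st.var 0 = Fintype.card V) (h4 : st.var 4 = (e v : ℕ)) (h5 : st.var 5 = (e w : ℕ))
    (hw : w ∈ L) (hwM : w ∉ M) :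
    RunsWithin splitClass st 30 fun st' => HoldsPartition e st' ρ D S M L ∧
      st'.var 6 = st'.arr 14 (e w) ∧ st'.var 5 = (e w : ℕ) ∧
      (∀ x ∈ L, st'.arr 14 (e x) = st'.arr 16 (st'.var 6) ↔ x ∈ M ∧ ∀ u ∈ D, S u x ↔ S u w) ∧
      ((∀ x ∈ L, st'.arr 14 (e x) ≠ st'.arr 16 (st'.var 6)) →
        st'.arr 12 (st'.arr 16 (st'.var 6)) = (e w : ℕ)) ∧
      st'.arr 16 (st'.var 6) < st'.var 9 ∧
      HoldsMarks (fun x => (e x : ℕ)) (Fintype.card V) v D S (M ++ [w]) L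
        (Function.update (fun x => st'.arr 14 (e x)) w (st'.arr 16 (st'.var 6)))
        (st'.arr 15) (st'.arr 16) := by
  refine RunsWithin.of_exec ?_ ?_ ?_
  · exact ⟨trivial, trivial, ⟨trivial, trivial⟩, ⟨trivial, trivial⟩, trivial⟩
  · simp [splitClass, Prog.maxCost, Test.cost, Expr.cost]
  simp only [splitClass, Prog.exec, Test.Holds, Expr.eval, Store.setVar_var, Store.setVar_arr,
    if_true, (by decide : (4 : ℕ) ≠ 6), if_false, h4, h5]
  by_cases hmk : st.arr 15 (st.arr 14 (e w)) = (e v : ℕ)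
  · rw [if_pos hmk]
    obtain ⟨h1, ⟨y, hy, hky⟩, h2⟩ := hm.of_marked h.refined hw hwM hmk
    refine ⟨⟨h.refined, h.linked, h.first, by simpa using h.class_lt⟩, by simp, by simp [h5],
      by simpa using h1, fun h3 => ?_, ?_, by simpa using h2⟩
    · simp only [Store.setVar_arr, Store.setVar_var, if_true] at h3
      exact absurd hky.symm (h3 y hy)
    · simpa [hky] using h.class_lt y hy
  · rw [if_neg hmk]
    obtain ⟨h1, h2⟩ := hm.of_unmarked h.refined hw hwM hmk h.class_lt
    refine ⟨⟨by simpa using h.refined, by simpa using h.linked, fun x hx => ?_, fun x hx => ?_⟩,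
      by simp, by simp [h5], by simpa using h1, by simp [h5], by simp, by simpa [hn] using h2⟩
    · obtain ⟨f, hf, hff, hcf, hmax⟩ := h.first x hx
      have := (h.class_lt x hx).ne
      exact ⟨f, hf, by simpa [this] using hff, by simpa using hcf, by simpa using hmax⟩
    · have := h.class_lt x hx
      simp
      omega

theorem runsWithin_moveVertex (h : HoldsPartition e st ρ D S M L) (h5 : st.var 5 = (e w : ℕ))
    (h6 : st.var 6 = st.arr 14 (e w)) (hw : w ∈ L) (hwM : w ∉ M)
    (hM : ∀ x ∈ M, ρ.idxOf w < ρ.idxOf x)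
    (hk : ∀ x ∈ L, st.arr 14 (e x) = st.arr 16 (st.var 6) ↔ x ∈ M ∧ ∀ u ∈ D, S u x ↔ S u w)
    (hfk : (∀ x ∈ L, st.arr 14 (e x) ≠ st.arr 16 (st.var 6)) →
      st.arr 12 (st.arr 16 (st.var 6)) = (e w : ℕ))
    (hlt : st.arr 16 (st.var 6) < st.var 9) :
    RunsWithin moveVertex st 50 fun st' => ∃ L', L'.Perm L ∧
      HoldsPartition e st' ρ D S (M ++ [w]) L' ∧ (fun x => st'.arr 14 (e x)) =
        Function.update (fun x => st.arr 14 (e x)) w (st.arr 16 (st.var 6)) := by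
  refine RunsWithin.of_exec ?_ ?_ ?_
  · exact ⟨trivial, trivial, ⟨⟨trivial, trivial⟩, trivial, trivial⟩, ⟨trivial, trivial⟩,
      ⟨trivial, trivial⟩, trivial, trivial⟩
  · simp [moveVertex, relink, Prog.maxCost, Test.cost, Expr.cost]
  obtain ⟨f, hf, hff, hcf, hmax⟩ := h.first w hw
  beta_reduce at hff hcf hmax
  have hcl := update_num (e := e) (st.arr 14) w (st.arr 16 (st.var 6))
  have hlt' : ∀ x ∈ L, Function.update (fun x => st.arr 14 (e x)) w (st.arr 16 (st.var 6)) x <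
      st.var 9 := fun x hx => by
    by_cases hxw : x = w
    · rwa [hxw, Function.update_self]
    · rw [Function.update_of_ne hxw]
      exact h.class_lt x hx
  have hs := h.refined.sorted
  simp only [moveVertex, Prog.exec, Test.Holds, Expr.eval, Store.setArr_var, Store.setArr_arr,
    (by decide : (12 : ℕ) ≠ 14), if_false, h5]
  by_cases hfw : f = w
  · subst hfw
    rw [← h6] at hff
    rw [if_pos hff]
    obtain ⟨A, C, rfl⟩ := List.append_of_mem hw
    rw [List.pairwise_append, List.pairwise_cons] at hs
    refine ⟨A ++ f :: C, List.Perm.refl _, ⟨?_, by simpa using h.linked, ?_, ?_⟩, by simpa using hcl⟩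
    · simp only [Store.setArr_arr, (by decide : (14 : ℕ) ≠ 12), if_false, if_true]
      rw [hcl]
      exact h.refined.move hw hwM hM hk hw rfl hmax
        (List.Sublist.append_left (List.sublist_cons_self f C) A) (List.Perm.refl _)
        (fun x hx => hs.2.2 x hx f List.mem_cons_self) fun y hy => Or.inr (hs.2.1.1 y hy)
    · simp only [Store.setArr_arr, (by decide : (14 : ℕ) ≠ 12), (by decide : (10 : ℕ) ≠ 14),
        if_false, if_true]
      rw [hcl]
      refine h.first.move hw hwM hM hk hfk (fun c hc => ?_) fun x hx hxf hcx => ?_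
      · rw [← h6] at hc
        exact Function.update_of_ne hc ..
      · obtain ⟨z, C', rfl, hcz, hz⟩ := h.refined.exists_next hmax hx hxf hcx
        refine ⟨z, by simp, ?_, ?_, hcz, hz⟩
        · rintro rfl
          have := h.refined.nodup
          rw [List.nodup_append, List.nodup_cons] at this
          exact this.2.1.1 List.mem_cons_self
        · have h7 := h.linked
          rw [List.map_append, List.map_cons] at h7
          rw [← h6, Function.update_self, h7.next_eq]
          simp [lastFrom_append, lastFrom]
    · intro x hx
      have := hlt' x hx
      rw [← hcl] at this
      simpa using this
  · have hff' : st.arr 12 (st.var 6) = (e f : ℕ) := by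
      rw [h6]
      exact hff
    have hnw : (e f : ℕ) ≠ e w := mt num_inj.1 hfw
    rw [if_neg (by rwa [hff'])]
    obtain ⟨A, R, hAR⟩ := List.append_of_mem hf
    -- `f` is the first vertex of its class, hence `w` comes after `f`
    have hwR : w ∈ R := by
      have hwL := hw
      rw [hAR, List.mem_append, List.mem_cons] at hwL
      rcases hwL with hwA | hwf | hwR
      · rw [hAR, List.pairwise_append] at hs
        rcases hs.2.2 w hwA f List.mem_cons_self with h7 | h7
        · exact absurd ((h.refined.same_iff w hw f hf).1 hcf.symm) h7.not_same
        · have := hmax w hw rfl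
          exact absurd h7.2 (by omega)
      · exact absurd hwf.symm hfw
      · exact hwR
    obtain ⟨B, C, hBC⟩ := List.append_of_mem hwR
    have hL : L = (A ++ f :: B) ++ w :: C := by
      rw [hAR, hBC]
      simp
    have hlink := h.linked
    rw [hL, List.map_append, List.map_cons] at hlink
    have hlink₁ := hlink.remove
    rw [List.map_append, List.map_cons, List.append_assoc, List.cons_append] at hlink₁
    have hlink₂ := hlink₁.insert_before (w := e w) ?_
    · have hperm : (A ++ w :: (f :: B ++ C)).Perm L := by
        rw [hL, List.append_assoc]
        exact List.Perm.append_left A List.perm_middle.symm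
      have hsub : (A ++ (f :: B ++ C)).Sublist L := by
        rw [hL, ← List.append_assoc]
        exact List.Sublist.append_left (List.sublist_cons_self w C) _
      rw [hL, List.append_assoc, List.pairwise_append, List.cons_append, List.pairwise_cons] at hs
      refine ⟨A ++ w :: (f :: B ++ C), hperm, ⟨?_, ?_, ?_, ?_⟩, ?_⟩
      · have h7 : (fun x => (relink.exec (st.setArr 14 (e w) (st.arr 16 (st.var 6)))).arr 14 (e x)) =
            Function.update (fun x => st.arr 14 (e x)) w (st.arr 16 (st.var 6)) := by
          rw [← hcl]
          simp [relink, Prog.exec, Expr.eval]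
        rw [h7]
        refine h.refined.move hw hwM hM hk hf hcf hmax hsub hperm
          (fun x hx => hs.2.2 x hx f List.mem_cons_self) fun y hy => ?_
        rw [List.cons_append, List.mem_cons] at hy
        refine hy.imp_right fun hy => hs.2.1.1 y ?_
        simp only [List.mem_append, List.mem_cons] at hy ⊢
        tauto
      · have h7 : (relink.exec (st.setArr 14 (e w) (st.arr 16 (st.var 6)))).arr 10 = Function.update
            (Function.update (Function.update (st.arr 10) (st.arr 11 (e w)) (st.arr 10 (e w))) (e w)
              (Function.update (st.arr 10) (st.arr 11 (e w)) (st.arr 10 (e w))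
                (Function.update (st.arr 11) (st.arr 10 (e w)) (st.arr 11 (e w)) (e f))))
              (Function.update (st.arr 11) (st.arr 10 (e w)) (st.arr 11 (e w)) (e f)) (e w) := by
          simp [relink, Prog.exec, Expr.eval, h5, hff']
        have h8 : (relink.exec (st.setArr 14 (e w) (st.arr 16 (st.var 6)))).arr 11 = Function.update
            (Function.update (Function.update (st.arr 11) (st.arr 10 (e w)) (st.arr 11 (e w))) (e w)
              (Function.update (st.arr 11) (st.arr 10 (e w)) (st.arr 11 (e w)) (e f))) (e f) (e w) := by
          simp [relink, Prog.exec, Expr.eval, h5, hff']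
        rw [h7, h8]
        simpa using hlink₂
      · refine HoldsFirst.perm ?_ hperm
        have h7 : (fun x => (relink.exec (st.setArr 14 (e w) (st.arr 16 (st.var 6)))).arr 14 (e x)) =
            Function.update (fun x => st.arr 14 (e x)) w (st.arr 16 (st.var 6)) := by
          rw [← hcl]
          simp [relink, Prog.exec, Expr.eval]
        have h8 : (relink.exec (st.setArr 14 (e w) (st.arr 16 (st.var 6)))).arr 12 = st.arr 12 := by
          simp [relink, Prog.exec, Expr.eval]
        rw [h7, h8]
        exact h.first.move hw hwM hM hk hfk (fun c _ => rfl) fun x _ _ _ =>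
          ⟨f, hf, hfw, hff, hcf, fun y hy _ hcy => hmax y hy hcy⟩
      · intro x hx
        have := hlt' x (hperm.mem_iff.1 hx)
        rw [← hcl] at this
        simpa [relink, Prog.exec, Expr.eval] using this
      · rw [← hcl]
        simp [relink, Prog.exec, Expr.eval]
    · have h7 := (h.linked).nodup
      have h8 := hlink.nodup
      have hperm : (Fintype.card V :: ((A ++ f :: B).map (fun x => (e x : ℕ)) ++ (e w : ℕ) ::
          C.map (fun x => (e x : ℕ)) ++ [Fintype.card V + 1])).Perm ((e w : ℕ) :: Fintype.card V ::
          ((A ++ f :: B).map (fun x => (e x : ℕ)) ++ C.map (fun x => (e x : ℕ)) ++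
            [Fintype.card V + 1])) := by
        refine List.Perm.trans (List.Perm.cons _ ?_) (List.Perm.swap _ _ _)
        rw [List.append_assoc, List.append_assoc]
        exact List.perm_middle
      rw [hperm.nodup_iff, List.nodup_cons] at h8
      simpa using h8.1

/-- The partition of `L`, refined with the sets `S u` for `u` in `D`, is in the store, and all marks
of the classes are `n` or elements of `D`. -/
structure HoldsRefinement (e : V ≃ Fin (Fintype.card V)) (st : Store) (ρ D : List V)
    (S : V → V → Prop) (L : List V) : Prop where
  partition : HoldsPartition e st ρ D S [] L
  mark : ∀ x ∈ L, st.arr 15 (st.arr 14 (e x)) = Fintype.card V ∨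
    ∃ u ∈ D, st.arr 15 (st.arr 14 (e x)) = (e u : ℕ)

theorem HoldsRefinement.congr {st st' : Store} {ρ D L : List V} {S : V → V → Prop}
    (h : HoldsRefinement e st ρ D S L) (h9 : st'.var 9 = st.var 9)
    (ha : ∀ a ∈ [10, 11, 12, 14, 15], st'.arr a = st.arr a) : HoldsRefinement e st' ρ D S L := by
  refine ⟨h.partition.congr h9 fun a h' => ha a ?_, ?_⟩
  · simp only [List.mem_cons, List.not_mem_nil, or_false] at h' ⊢
    tauto
  · rw [ha 14 (by simp), ha 15 (by simp)]
    exact h.mark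

theorem runsWithin_refine (h : HoldsRefinement e st ρ D S L) (hvD : v ∉ D)
    (hn : st.var 0 = Fintype.card V) (h4 : st.var 4 = (e v : ℕ)) {N : List V}
    (hadj : HoldsAdj e st 8 v N) (hN : N.Pairwise fun x y => ρ.idxOf y < ρ.idxOf x)
    (hL : ∀ w ∈ N, st.arr 17 (e w) = 0 → w ∈ L)
    (hS : ∀ w ∈ L, S v w ↔ w ∈ N ∧ st.arr 17 (e w) = 0) :
    RunsWithin refine st (99 * (N.length + 1)) fun st' =>
      ∃ L', L'.Perm L ∧ HoldsRefinement e st' ρ (D ++ [v]) S L' := by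
  -- the vertices of the list that are moved
  let F : List V → List V := fun M => M.filter fun w => st.arr 17 (e w) = 0
  have hF : ∀ M w, w ∈ F M ↔ w ∈ M ∧ st.arr 17 (e w) = 0 := fun M w => by simp [F]
  refine (runsWithin_forAdj (v := v) (N := N) (a := 8) (st := st)
    (p := .ite (.eq (.read 17 (.var 5)) (.const 0)) (.seq splitClass moveVertex) .skip) 84
    (fun M st' => ∃ L', L'.Perm L ∧ HoldsPartition e st' ρ D S (F M) L' ∧
      HoldsMarks (fun x => (e x : ℕ)) (Fintype.card V) v D S (F M) L' (fun x => st'.arr 14 (e x))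
        (st'.arr 15) (st'.arr 16))
    hadj h4 (by simp [Prog.vars, splitClass, moveVertex, relink])
    (by simp [Prog.vars, splitClass, moveVertex, relink])
    (by simp [Prog.arrs, splitClass, moveVertex, relink])
    (by simp [Prog.arrs, splitClass, moveVertex, relink])
    ?_ ?_ ?_).mono (by omega) ?_
  · refine ⟨L, List.Perm.refl _, h.partition, by simp [F], fun x hx _ hmk => ?_,
      by simp [F], fun x hx => (h.mark x hx).imp_right ?_⟩
    · rcases h.mark x hx with h' | ⟨u, hu, h'⟩
      · rw [h'] at hmk
        have := (e v).2
        omega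
      · rw [h', num_inj] at hmk
        exact absurd (hmk ▸ hu) hvD
    · rintro ⟨u, hu, h'⟩
      exact ⟨u, by simp [hu], h'⟩
  · rintro d st' x y ⟨L', hL', h1, h2⟩
    exact ⟨L', hL', h1.congr (by simp) (by simp), h2⟩
  · rintro M w t st' hM ⟨L', hL', h1, h2⟩ h5 hvar harr
    have h17 : st'.arr 17 = st.arr 17 :=
      harr 17 (by simp [Prog.arrs, splitClass, moveVertex, relink])
    by_cases hw0 : st.arr 17 (e w) = 0
    · have hwN : w ∈ N := by simp [hM]
      have hw : w ∈ L' := hL'.mem_iff.2 (hL w hwN hw0)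
      have hFw : F (M ++ [w]) = F M ++ [w] := by simp [F, List.filter_append, hw0]
      have hMw : ∀ x ∈ F M, ρ.idxOf w < ρ.idxOf x := fun x hx => by
        rw [hM, List.pairwise_append] at hN
        exact hN.2.2 x ((hF M x).1 hx).1 w List.mem_cons_self
      have hwM : w ∉ F M := fun h' => lt_irrefl _ (hMw w h')
      have hrun := RunsWithin.seq (runsWithin_splitClass h1 h2
        ((hvar 0 (by simp [Prog.vars, splitClass, moveVertex, relink])).trans hn)
        ((hvar 4 (by simp [Prog.vars, splitClass, moveVertex, relink])).trans h4) h5 hw hwM).frame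
        (m' := 50) (q := moveVertex) (Q' := fun st' => ∃ L', L'.Perm L ∧
          HoldsPartition e st' ρ D S (F (M ++ [w])) L' ∧
          HoldsMarks (fun x => (e x : ℕ)) (Fintype.card V) v D S (F (M ++ [w])) L'
            (fun x => st'.arr 14 (e x)) (st'.arr 15) (st'.arr 16)) ?_
      · obtain ⟨c, hc, st₂, hr, hQ⟩ := hrun
        refine ⟨_, ?_, st₂, .ite_true ?_ hr, hQ⟩
        · simp only [Test.cost, Expr.cost]
          omega
        · simp [Test.Holds, Expr.eval, h5, h17, hw0]
      · rintro st₁ ⟨⟨h1₁, h6, h5₁, hk, hfk, hlt, h2₁⟩, -, -⟩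
        refine (runsWithin_moveVertex h1₁ h5₁ h6 hw hwM hMw hk hfk hlt).frame.mono le_rfl ?_
        rintro st₂ ⟨⟨L₂, hL₂, h1₂, hcl⟩, -, ha⟩
        rw [hFw]
        refine ⟨L₂, hL₂.trans hL', h1₂, ?_⟩
        rw [hcl, ha 15 (by simp [Prog.arrs, moveVertex, relink]),
          ha 16 (by simp [Prog.arrs, moveVertex, relink])]
        exact h2₁.perm hL₂
    · have hFw : F (M ++ [w]) = F M := by simp [F, List.filter_append, hw0]
      refine ⟨_, ?_, st', .ite_false ?_ (.skip st'), L', hL', ?_, ?_⟩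
      · simp [Test.cost, Expr.cost]
      · simp [Test.Holds, Expr.eval, h5, h17, hw0]
      · rwa [hFw]
      · rwa [hFw]
  · rintro st' ⟨L', hL', h1, h2⟩
    have hSF : ∀ x ∈ L', x ∈ F N ↔ S v x := fun x hx => by
      rw [hF, hS x (hL'.mem_iff.1 hx)]
    refine ⟨L', hL', ⟨h1.refined.congr (fun x hx y hy hxy => Or.inl ?_) fun x hx y hy => ?_,
      h1.linked, h1.first, h1.class_lt⟩, h2.mem⟩
    · rw [ClassLT, hSF x hx, hSF y hy] at hxy
      exact lexGT_append_singleton.2 hxy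
    · rw [SameClass, SameClass, hSF x hx, hSF y hy]
      simp only [List.mem_append, List.mem_singleton, List.not_mem_nil, iff_self, and_true]
      refine ⟨?_, fun h' => ⟨fun u hu => h' u (Or.inl hu), h' v (Or.inr rfl)⟩⟩
      rintro ⟨h3, h4⟩ u (hu | rfl)
      · exact h3 u hu
      · exact h4

end

end RAM

/-! ### The initial partition -/

theorem lastFrom_eq {a b : ℕ} {L R : List ℕ} (h : (a :: L).reverse = b :: R) : lastFrom a L = b := by
  rw [List.reverse_eq_cons_iff] at h
  rcases hR : R.reverse with _ | ⟨c, R'⟩ <;> rw [hR] at h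
  · simp only [List.nil_append, List.cons.injEq] at h
    rw [h.2, ← h.1]
    rfl
  · simp only [List.cons_append, List.cons.injEq] at h
    rw [h.2, lastFrom_append]
    rfl

/-- Append the cell `x` to a doubly linked list with last cell `b`. -/
theorem Linked.append_singleton {nx pv : ℕ → ℕ} {a b x : ℕ} {L R : List ℕ}
    (hn : (a :: (L ++ [x])).Nodup) (hR : (a :: L).reverse = b :: R) (h : Linked nx a L)
    (h' : Linked pv b R) :
    Linked (Function.update nx b x) a (L ++ [x]) ∧ Linked (Function.update pv x b) x (b :: R) := by
  have hb := lastFrom_eq hR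
  rw [← List.cons_append, List.nodup_append] at hn
  have hbR : (b :: R).Nodup := by
    rw [← hR]
    exact List.nodup_reverse.2 hn.1
  refine ⟨linked_append.2 ⟨h.congr hn.1 fun y _ hy => ?_, ?_⟩, Function.update_self ..,
    h'.congr hbR fun y hy _ => ?_⟩
  · rw [hb] at hy
    exact Function.update_of_ne hy ..
  · rw [hb]
    exact ⟨Function.update_self .., trivial⟩
  · rw [← hR, List.mem_reverse] at hy
    exact Function.update_of_ne (hn.2.2 y hy x (by simp)) ..

namespace RAM

section

variable {V : Type*} [Fintype V] [DecidableEq V] {e : V ≃ Fin (Fintype.card V)} {ρ : List V}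

/-- Build the partition with a single class, in the reverse of the order in the array `0`, and set the
entries of the array `17` to `k`. -/
def initPartition (k : ℕ) : Prog :=
  .seq (.assign 6 (.var 0)) (.seq
    (forDown 0 (.seq (.seq (.write 10 (.var 6) (.var 4)) (.write 11 (.var 4) (.var 6)))
      (.seq (.seq (.write 14 (.var 4) (.const 0)) (.write 17 (.var 4) (.const k)))
        (.assign 6 (.var 4)))))
    (.seq (.seq (.write 10 (.var 6) (.succ (.var 0))) (.write 11 (.succ (.var 0)) (.var 6)))
      (.seq (.seq (.write 12 (.const 0) (.read 10 (.var 0))) (.write 15 (.const 0) (.var 0)))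
        (.assign 9 (.const 1)))))

theorem runsWithin_initPartition (k : ℕ) {st : Store} (hρ : IsVertexOrder ρ)
    (hl : HoldsList e st 0 ρ) (hn : st.var 0 = Fintype.card V) (S : V → V → Prop) :
    RunsWithin (initPartition k) st (60 * (Fintype.card V + 1)) fun st' =>
      HoldsRefinement e st' ρ [] S ρ.reverse ∧ ∀ v, st'.arr 17 (e v) = k := by
  have hlen := hρ.length_eq
  have hnum : ∀ d : List V, d.Nodup → (Fintype.card V :: d.map fun v => (e v : ℕ)).Nodup := by
    intro d hd
    rw [List.nodup_cons]
    refine ⟨fun h' => ?_, hd.map fun a b hab => num_inj.1 hab⟩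
    obtain ⟨u, -, hu⟩ := List.mem_map.1 h'
    have := (e u).2
    omega
  have hmain := runsWithin_forDown (st := st.setVar 6 (Fintype.card V)) (e := e) (a := 0)
    (p := .seq (.seq (.write 10 (.var 6) (.var 4)) (.write 11 (.var 4) (.var 6)))
      (.seq (.seq (.write 14 (.var 4) (.const 0)) (.write 17 (.var 4) (.const k)))
        (.assign 6 (.var 4)))) ρ (fun _ => 14)
    (I := fun d st' => ∃ R, (Fintype.card V :: d.map fun v => (e v : ℕ)).reverse = st'.var 6 :: R ∧
      Linked (st'.arr 10) (Fintype.card V) (d.map fun v => (e v : ℕ)) ∧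
      Linked (st'.arr 11) (st'.var 6) R ∧
      ∀ x ∈ d, st'.arr 14 (e x) = 0 ∧ st'.arr 17 (e x) = k) hl (hn.trans hlen.symm)
    (by simp [Prog.vars]) (by simp [Prog.vars]) (by simp [Prog.arrs])
    ⟨[], by simp, trivial, trivial, by simp⟩ (fun d st x y h => h) ?_
  · refine RunsWithin.seq_le (m := 2) (Q := (· = st.setVar 6 (Fintype.card V)))
      (m' := 60 * Fintype.card V + 58)
      (.of_exec trivial (by simp [Prog.maxCost, Expr.cost]) (by simp [Prog.exec, Expr.eval, hn]))
      (by omega) ?_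
    rintro _ rfl
    refine hmain.frame.seq_le (m' := 30) ?_ ?_
    · simp only [hlen, List.map_const', List.sum_replicate, smul_eq_mul]
      omega
    · rintro st₁ ⟨⟨R, hR, hnx, hpv, hd⟩, hvar, harr⟩
      have h0 : st₁.var 0 = Fintype.card V := (hvar 0 (by simp [forDown, Prog.vars])).trans hn
      refine RunsWithin.of_exec ?_ ?_ ?_
      · exact ⟨⟨trivial, trivial⟩, ⟨trivial, trivial⟩, trivial⟩
      · simp [Prog.maxCost, Expr.cost]
      have hnd : (Fintype.card V :: (ρ.reverse.map (fun v => (e v : ℕ)) ++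
          [Fintype.card V + 1])).Nodup := by
        rw [← List.cons_append, List.nodup_append]
        refine ⟨hnum _ hρ.reverse.1, by simp, ?_⟩
        simp only [List.mem_cons, List.mem_map, List.not_mem_nil, or_false]
        rintro _ (rfl | ⟨u, -, rfl⟩) _ rfl
        · omega
        · have := (e u).2
          omega
      obtain ⟨h1, h2⟩ := Linked.append_singleton hnd hR hnx hpv
      have hpw := hρ.pairwise_reverse
      have h14 : ∀ x, st₁.arr 14 (e x) = 0 := fun x => (hd x (by simpa using hρ.2 x)).1
      refine ⟨⟨⟨⟨hρ.reverse.1, hpw.imp fun {a b} hab => Or.inr ⟨⟨by simp, by simp⟩, hab⟩, ?_⟩,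
        ⟨hnd, ?_, ?_⟩, ?_, ?_⟩, ?_⟩, ?_⟩
      · intro x _ y _
        exact iff_of_true (by simp [Prog.exec, Expr.eval, h14]) ⟨by simp, by simp⟩
      · simpa [Prog.exec, Expr.eval, h0] using h1
      · rw [← List.reverse_cons, hR]
        simpa [Prog.exec, Expr.eval, h0] using h2
      · intro x hx
        rcases hL : ρ.reverse with _ | ⟨f, L⟩
        · simp [hL] at hx
        · rw [hL] at hpw h1
          refine ⟨f, by simp, ?_, by simp [Prog.exec, Expr.eval, h14], fun y hy _ => ?_⟩
          · have := h1.1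
            simpa [Prog.exec, Expr.eval, h14, h0] using this
          · rw [List.mem_cons] at hy
            rcases hy with rfl | hy
            · exact le_rfl
            · exact (List.rel_of_pairwise_cons hpw hy).le
      · intro x _
        simp [Prog.exec, Expr.eval, h14]
      · intro x _
        simp [Prog.exec, Expr.eval, h14, h0]
      · intro v
        simpa [Prog.exec, Expr.eval] using (hd v (by simpa using hρ.2 v)).2
  · rintro d v t st' hd ⟨R, hR, hnx, hpv, hdv⟩ h4 hvar harr
    refine RunsWithin.of_exec ?_ ?_ ?_
    · exact ⟨⟨trivial, trivial⟩, ⟨trivial, trivial⟩, trivial⟩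
    · simp [Prog.maxCost, Expr.cost]
    have hnd : (d ++ [v]).Nodup := by
      have := hρ.reverse.1
      rw [hd, ← List.singleton_append, ← List.append_assoc] at this
      exact this.of_append_left
    have hvd : v ∉ d := fun h' => by
      rw [List.nodup_append] at hnd
      exact hnd.2.2 v h' v (by simp) rfl
    have hnd' := hnum _ hnd
    rw [List.map_append] at hnd'
    obtain ⟨h1, h2⟩ := Linked.append_singleton hnd' hR hnx hpv
    refine ⟨st'.var 6 :: R, ?_, ?_, ?_, fun x hx => ?_⟩
    · rw [List.map_append, ← List.cons_append, List.reverse_append, hR]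
      simp [Prog.exec, Expr.eval, h4]
    · rw [List.map_append]
      simpa [Prog.exec, Expr.eval, h4] using h1
    · simpa [Prog.exec, Expr.eval, h4] using h2
    · simp only [List.mem_append, List.mem_singleton] at hx
      by_cases hxv : x = v
      · simp [Prog.exec, Expr.eval, h4, hxv]
      · have h3 := hdv x (hx.resolve_right hxv)
        have h5 : (e x : ℕ) ≠ e v := mt num_inj.1 hxv
        simp [Prog.exec, Expr.eval, h4, h5, h3]

/-! ### Lexicographic breadth first search on the machine -/

/-- Take the first vertex from the list, load it into variable `4`, and write it into the next cell of
the array `3`. -/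
def popVertex : Prog :=
  .seq (.seq (.assign 4 (.read 10 (.var 0)))
      (.seq (.write 3 (.var 2) (.var 4)) (.write 17 (.var 4) (.const 1))))
    (.seq (.seq (.assign 6 (.read 10 (.var 4))) (.write 12 (.read 14 (.var 4)) (.var 6)))
      (.seq (.seq (.write 10 (.var 0) (.var 6)) (.write 11 (.var 6) (.var 0)))
        (.assign 2 (.succ (.var 2)))))

theorem HoldsRefinement.popVertex {st : Store} {D L : List V} {S : V → V → Prop} {v : V}
    (h : HoldsRefinement e st ρ D S (v :: L)) (hn : st.var 0 = Fintype.card V) :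
    HoldsRefinement e (popVertex.exec st) ρ D S L ∧ (popVertex.exec st).var 4 = (e v : ℕ) ∧
      (popVertex.exec st).var 2 = st.var 2 + 1 ∧
      (popVertex.exec st).arr 3 = Function.update (st.arr 3) (st.var 2) (e v) ∧
      (popVertex.exec st).arr 17 = Function.update (st.arr 17) (e v) 1 := by
  obtain ⟨⟨hr, hlink, hfirst, hlt⟩, hmark⟩ := h
  rw [List.map_cons] at hlink
  have hv : st.arr 10 (Fintype.card V) = (e v : ℕ) := hlink.next_head
  have hpv : st.arr 11 (e v) = Fintype.card V := DoublyLinked.prev_eq (A := []) hlink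
  have hrem := DoublyLinked.remove (A := []) hlink
  have h14 : (RAM.popVertex.exec st).arr 14 = st.arr 14 := by simp [RAM.popVertex, Prog.exec]
  have h15 : (RAM.popVertex.exec st).arr 15 = st.arr 15 := by simp [RAM.popVertex, Prog.exec]
  have h12 : (RAM.popVertex.exec st).arr 12 =
      Function.update (st.arr 12) (st.arr 14 (e v)) (st.arr 10 (e v)) := by
    simp [RAM.popVertex, Prog.exec, Expr.eval, hn, hv]
  refine ⟨⟨⟨?_, ?_, ?_, ?_⟩, ?_⟩, ?_, ?_, ?_, ?_⟩
  · rw [h14]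
    exact hr.sublist (List.sublist_cons_self v L)
  · rw [hpv] at hrem
    simpa [RAM.popVertex, Prog.exec, Expr.eval, hn, hv] using hrem
  · rw [h12, h14]
    have hvL : v ∉ L := (List.nodup_cons.1 hr.nodup).1
    have hmax : ∀ y ∈ v :: L, st.arr 14 (e y) = st.arr 14 (e v) → ρ.idxOf y ≤ ρ.idxOf v := by
      intro y hy hcy
      rw [List.mem_cons] at hy
      rcases hy with rfl | hy
      · exact le_rfl
      · rcases List.rel_of_pairwise_cons hr.sorted hy with h1 | h1
        · exact absurd ((hr.same_iff v (by simp) y (by simp [hy])).1 hcy.symm) h1.not_same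
        · exact h1.2.le
    intro x hx
    have hx' : x ∈ v :: L := by simp [hx]
    have hxv : x ≠ v := fun h' => hvL (h' ▸ hx)
    beta_reduce
    by_cases hcx : st.arr 14 (e x) = st.arr 14 (e v)
    · obtain ⟨z, L', rfl, hcz, hz⟩ := IsRefined.exists_next (A := []) hr hmax hx' hxv hcx
      refine ⟨z, by simp, ?_, hcz.trans hcx.symm, fun y hy hcy => ?_⟩
      · rw [List.map_cons] at hlink
        rw [hcx, Function.update_self]
        exact hlink.next.2.1
      · exact hz y (by simp only [List.nil_append, List.mem_cons] at hy ⊢; tauto)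
          (fun h' => hvL (h' ▸ hy)) (hcy.trans hcx)
    · obtain ⟨f, hf, hff, hcf, hmaxf⟩ := hfirst x hx'
      refine ⟨f, ?_, by rw [Function.update_of_ne hcx]; exact hff, hcf, fun y hy => ?_⟩
      · rw [List.mem_cons] at hf
        refine hf.resolve_left fun h' => hcx ?_
        rw [← h']
        exact hcf.symm
      · exact hmaxf y (by simp [hy])
  · intro x hx
    have := hlt x (by simp [hx])
    rw [h14]
    simpa [RAM.popVertex, Prog.exec] using this
  · rw [h14, h15]
    exact fun x hx => hmark x (by simp [hx])
  · simp [RAM.popVertex, Prog.exec, Expr.eval, hn, hv]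
  · simp [RAM.popVertex, Prog.exec, Expr.eval]
  · simp [RAM.popVertex, Prog.exec, Expr.eval, hn, hv]
  · simp [RAM.popVertex, Prog.exec, Expr.eval, hn, hv]

end

end RAM

section

variable {V : Type*} [Fintype V] [DecidableEq V] {G : SimpleGraph V} [DecidableRel G.Adj] {s : V}
  {ρ : List V}

/-- The next vertex of the search is the first one in the partition that has been refined with the
neighbourhoods of the visited vertices. -/
theorem IsValidInput.lexBFS_plus_next (h : IsValidInput G s ρ) {vis rest : List V} {v x : V}
    (hπ : lexBFS.plus G s ρ = vis ++ v :: rest) (hx : x ∉ vis)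
    (hmax : ∀ y ∉ vis, y ≠ x → RefineLT ρ vis G.Adj [] x y) : x = v := by
  have hC := isCliqueOrder_lexBFS_plus h
  have hO := hC.order
  have hst := hC.start
  rw [hπ] at hO hst
  have hv : v ∉ vis := fun hv => lt_irrefl _ (hO.mem_left.1 hv)
  by_contra hxv
  have hlt := hmax v hv (Ne.symm hxv)
  rcases vis with _ | ⟨a, vis⟩
  · -- before the first step, the start vertex is the first one
    have hvs : v = s := by
      by_contra hvs
      rw [List.nil_append, List.idxOf_cons_ne _ hvs] at hst
      omega
    rcases hlt with (h1 | h1) | h1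
    · exact h1
    · exact absurd h1.2.1 (by simp)
    · obtain ⟨l, hl⟩ := List.getLast?_eq_some_iff.1 h.last
      have h2 := h1.2
      rw [hvs] at h2
      have hxl : x ∈ l := by
        have := h.order.2 x
        rw [hl, List.mem_append, List.mem_singleton] at this
        exact this.resolve_right fun h' => hxv (h'.trans hvs.symm)
      have hO' := h.order
      rw [hl] at hO' h2
      have := (hO'.mem_left (B := [])).1 hxl
      omega
  · have hne : ∀ y ∉ a :: vis, y ≠ s := by
      rintro y hy rfl
      rw [List.cons_append, List.idxOf_cons_ne _ fun h' => hy (by simp [h'])] at hst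
      omega
    have hlen : (a :: vis).length ≤ Fintype.card V := by
      rw [← hO.length_eq, List.length_append]
      omega
    have h2 := SearchRule.plus_split h.order hπ x hx
    rcases hlt with (h1 | h1) | h1
    · have h3 := SearchRule.label_lexBFS_lt _ hlen (hne x hx) (hne v hv) h1
      rcases h2 with h2 | h2
      · exact lt_asymm h2 h3
      · rw [h2.1] at h3
        exact lt_irrefl _ h3
    · exact absurd h1.2.1 (by simp)
    · rcases h2 with h2 | h2
      · rw [SearchRule.label_congr lexBFS _ (hne x hx) (hne v hv) h1.1.1] at h2
        exact lt_irrefl _ h2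
      · have := h1.2
        omega

end

namespace RAM

section

variable {V : Type*} [Fintype V] {e : V ≃ Fin (Fintype.card V)}

/-- The sorted adjacency lists are in the array `8`. -/
def HoldsSortedAdj (G : SimpleGraph V) [DecidableRel G.Adj] (ρ : List V)
    (e : V ≃ Fin (Fintype.card V)) (st : Store) : Prop :=
  ∀ v, HoldsAdj e st 8 v (ρ.reverse.filter fun w => G.Adj v w)

theorem HoldsSortedAdj.congr {G : SimpleGraph V} [DecidableRel G.Adj] {ρ : List V}
    {st st' : Store} (h : HoldsSortedAdj G ρ e st) (h1 : st'.arr 1 = st.arr 1) (h8 : st'.arr 8 = st.arr 8) :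
    HoldsSortedAdj G ρ e st' :=
  fun v => (h v).congr h1 h8

variable [DecidableEq V]

theorem HoldsRefinement.isTieBreakOrder {G : SimpleGraph V} {s : V} {ρ π β L : List V} {st : Store}
    (h : HoldsRefinement e st ρ β (LeftAdj G π) L) (hL : IsVertexOrder L) (hβ : IsVertexOrder β) :
    IsTieBreakOrder G s ρ π β (L.filter fun x => x ≠ s) := by
  refine ⟨⟨?_, fun v => ?_⟩, ?_⟩
  · rw [List.nodup_cons]
    exact ⟨by simp, hL.1.filter _⟩
  · by_cases hv : v = s <;> simp [hv, hL.2 v]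
  · refine (h.partition.refined.sorted.sublist List.filter_sublist).imp fun {x y} hxy => ?_
    rcases hxy with (h1 | h1) | h1
    · exact Or.inl h1
    · exact absurd h1.2.1 (by simp)
    · exact Or.inr ⟨fun u => h1.1.1 u (hβ.2 u), h1.2⟩

end

section

variable {V : Type*} [Fintype V] [DecidableEq V] {G : SimpleGraph V} [DecidableRel G.Adj] {s : V}
  {ρ π β : List V} {e : V ≃ Fin (Fintype.card V)}

/-- Lexicographic breadth first search: the vertices in the order of the partition, which is refined
with the neighbourhoods of the visited vertices, are written into the array `3`. -/
def lexBFSLoop : Prog :=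
  .seq (.assign 2 (.const 0)) (.loop (.lt (.var 2) (.var 0)) (.seq popVertex refine))

theorem runsWithin_lexBFSLoop {st : Store} (h : IsValidInput G s ρ)
    (hR : HoldsRefinement e st ρ [] G.Adj ρ.reverse) (h17 : ∀ v, st.arr 17 (e v) = 0)
    (hn : st.var 0 = Fintype.card V) (hadj : HoldsSortedAdj G ρ e st) :
    RunsWithin lexBFSLoop st (300 * (Fintype.card V + G.edgeFinset.card + 1)) fun st' =>
      HoldsList e st' 3 (lexBFS.plus G s ρ) := by
  have hO := (isCliqueOrder_lexBFS_plus h).order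
  set π := lexBFS.plus G s ρ with hπ
  have hlen := hO.length_eq
  have hloop := RunsWithin.loop_list (st := st.setVar 2 0) (b := .lt (.var 2) (.var 0))
    (p := .seq popVertex refine) π
    (fun v => 130 * ((ρ.reverse.filter fun w => G.Adj v w).length + 1))
    (I := fun d st' => (∃ L, HoldsRefinement e st' ρ d G.Adj L ∧ ∀ x, x ∈ L ↔ x ∉ d) ∧
      (∀ x, st'.arr 17 (e x) = 0 ↔ x ∉ d) ∧ st'.var 2 = d.length ∧
      (∀ k (hk : k < π.length), k < d.length → st'.arr 3 k = (e π[k] : ℕ)) ∧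
      st'.var 0 = Fintype.card V ∧ HoldsSortedAdj G ρ e st') ?_ ?_ ?_ ?_
  · refine RunsWithin.seq_le (m := 2) (Q := (· = st.setVar 2 0))
      (m' := 134 * (2 * G.edgeFinset.card + Fintype.card V) + 4)
      (.of_exec trivial (by simp [Prog.maxCost, Expr.cost]) (by simp [Prog.exec, Expr.eval]))
      (by omega) ?_
    rintro _ rfl
    refine hloop.mono ?_ fun st' h k hk => h.2.2.2.1 k hk hk
    have hsum : (π.map fun v => 130 * ((ρ.reverse.filter fun w => G.Adj v w).length + 1) +
        (Test.lt (.var 2) (.var 0)).cost).sum ≤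
        (π.map fun v => 134 * ((ρ.reverse.filter fun w => G.Adj v w).length + 1)).sum := by
      refine List.sum_le_sum fun v _ => ?_
      simp only [Test.cost, Expr.cost]
      omega
    rw [(IsAdjLists.filter h.order.reverse).sum_length hO] at hsum
    simp only [Test.cost, Expr.cost] at hsum ⊢
    omega
  · rintro d v t st' hd ⟨-, -, h2, -, h0, -⟩
    simp only [Test.Holds, Expr.eval, h2, h0]
    rw [← hlen, hd]
    simp
  · rintro st' ⟨-, -, h2, -, h0, -⟩
    simp only [Test.Holds, Expr.eval, h2, h0, hlen]
    exact lt_irrefl _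
  · rintro d v t st' hd ⟨⟨L, hL, hLd⟩, hflag, h2, h3, h0, hadj'⟩
    have hO' := hO
    rw [hd] at hO'
    have hvd : v ∉ d := fun hv => lt_irrefl _ (hO'.mem_left.1 hv)
    rcases L with _ | ⟨x, L⟩
    · exact absurd ((hLd v).2 hvd) (by simp)
    obtain rfl : x = v := by
      refine h.lexBFS_plus_next hd ((hLd x).1 (by simp)) fun y hy hyx => ?_
      have := (hLd y).2 hy
      rw [List.mem_cons] at this
      exact List.rel_of_pairwise_cons hL.partition.refined.sorted (this.resolve_left hyx)
    obtain ⟨hL₁, h4₁, h2₁, h3₁, h17₁⟩ := hL.popVertex h0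
    have hxL : x ∉ L := (List.nodup_cons.1 hL.partition.refined.nodup).1
    have hLd' : ∀ w, w ∈ L ↔ w ∉ d ++ [x] := fun w => by
      have := hLd w
      rw [List.mem_cons] at this
      simp only [List.mem_append, List.mem_singleton, not_or]
      by_cases hwx : w = x
      · simp [hwx, hxL]
      · simp [hwx, ← this]
    have hflag₁ : ∀ w, (popVertex.exec st').arr 17 (e w) = 0 ↔ w ∉ d ++ [x] := fun w => by
      rw [h17₁]
      by_cases hwx : w = x
      · simp [hwx]
      · rw [Function.update_of_ne (mt num_inj.1 hwx), hflag]
        simp [hwx]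
    have hn₁ : (popVertex.exec st').var 0 = Fintype.card V := by
      simpa [popVertex, Prog.exec] using h0
    have hadj₁ : HoldsSortedAdj G ρ e (popVertex.exec st') :=
      hadj'.congr (by simp [popVertex, Prog.exec]) (by simp [popVertex, Prog.exec])
    refine RunsWithin.seq_le (m := 29) (Q := (· = popVertex.exec st'))
      (.of_exec ?_ ?_ rfl) (m' := 99 * ((ρ.reverse.filter fun w => G.Adj x w).length + 1))
      (by omega) ?_
    · exact ⟨⟨trivial, trivial, trivial⟩, ⟨trivial, trivial⟩, ⟨trivial, trivial⟩, trivial⟩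
    · simp [popVertex, Prog.maxCost, Expr.cost]
    rintro _ rfl
    refine (runsWithin_refine hL₁ hvd hn₁ h4₁ (hadj₁ x)
      (h.order.pairwise_reverse.sublist List.filter_sublist)
      (fun w _ hw => (hLd' w).2 ((hflag₁ w).1 hw)) fun w hw => ?_).frame.mono le_rfl ?_
    · have h5 := (hflag₁ w).2 ((hLd' w).1 hw)
      simp [h5, h.order.2 w]
    · rintro st₂ ⟨⟨L₂, hL₂, hR₂⟩, hvar, harr⟩
      have h17₂ := harr 17 (by simp [refine, forAdj, Prog.arrs, splitClass, moveVertex, relink])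
      have h3₂ := harr 3 (by simp [refine, forAdj, Prog.arrs, splitClass, moveVertex, relink])
      refine ⟨⟨L₂, hR₂, fun w => hL₂.mem_iff.trans (hLd' w)⟩, fun w => ?_, ?_, fun k hk hkd => ?_,
        ?_, hadj₁.congr ?_ ?_⟩
      · rw [h17₂, hflag₁]
      · rw [hvar 2 (by simp [refine, forAdj, Prog.vars, splitClass, moveVertex, relink]), h2₁, h2]
        simp
      · rw [h3₂, h3₁, h2]
        simp only [List.length_append, List.length_singleton] at hkd
        by_cases hk' : k = d.length
        · subst hk'
          simp [hd]
        · rw [Function.update_of_ne hk', h3 k hk (by omega)]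
      · rw [hvar 0 (by simp [refine, forAdj, Prog.vars, splitClass, moveVertex, relink]), hn₁]
      · exact harr 1 (by simp [refine, forAdj, Prog.arrs, splitClass, moveVertex, relink])
      · exact harr 8 (by simp [refine, forAdj, Prog.arrs, splitClass, moveVertex, relink])
  · exact ⟨⟨ρ.reverse, hR.congr (by simp) (by simp), fun x => by simp [h.order.2 x]⟩,
      fun x => by simp [h17], by simp, by simp, hn, hadj⟩

/-! ### The ordering procedure on the machine -/

/-- Refine the partition with the neighbours of the vertices in the array `5` to the left of them. -/
def orderingLoop : Prog := forUp 5 (.seq refine (.write 17 (.var 4) (.const 0)))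

theorem runsWithin_orderingLoop {st : Store} (hC : IsCliqueOrder G s ρ π) (hρ : IsVertexOrder ρ)
    (hB : IsTopological (lastInParent G π) β.reverse) (hl : HoldsList e st 5 β)
    (hR : HoldsRefinement e st ρ [] (LeftAdj G π) ρ.reverse) (h17 : ∀ v, st.arr 17 (e v) = 1)
    (hn : st.var 0 = Fintype.card V) (hadj : HoldsSortedAdj G ρ e st) :
    RunsWithin orderingLoop st (300 * (Fintype.card V + G.edgeFinset.card + 1)) fun st' =>
      ∃ L, L.Perm ρ.reverse ∧ HoldsRefinement e st' ρ β (LeftAdj G π) L := by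
  have hβ := hB.order.reverse
  rw [List.reverse_reverse] at hβ
  have hlen := hβ.length_eq
  have hrun := runsWithin_forUp (st := st) (e := e) (a := 5)
    (p := .seq refine (.write 17 (.var 4) (.const 0))) β
    (fun v => 103 * ((ρ.reverse.filter fun w => G.Adj v w).length + 1))
    (I := fun d st' => (∃ L, L.Perm ρ.reverse ∧ HoldsRefinement e st' ρ d (LeftAdj G π) L) ∧
      ∀ x, st'.arr 17 (e x) = 0 ↔ x ∈ d) hl (hn.trans hlen.symm)
    (by simp [refine, forAdj, Prog.vars, splitClass, moveVertex, relink])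
    (by simp [refine, forAdj, Prog.vars, splitClass, moveVertex, relink])
    (by simp [refine, forAdj, Prog.arrs, splitClass, moveVertex, relink])
    ⟨⟨ρ.reverse, List.Perm.refl _, hR⟩, fun x => by simp [h17]⟩ ?_ ?_
  · refine hrun.mono ?_ fun st' h => h.1
    rw [(IsAdjLists.filter hρ.reverse).sum_length hβ, hlen]
    omega
  · rintro d st' x y ⟨⟨L, hL, hR'⟩, h'⟩
    exact ⟨⟨L, hL, hR'.congr (by simp) (by simp)⟩, h'⟩
  · rintro d v t st' hd ⟨⟨L, hL, hR'⟩, hflag⟩ h4 - hvar harr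
    have hO := hβ
    rw [hd] at hO
    have hvd : v ∉ d := fun hv => lt_irrefl _ (hO.mem_left.1 hv)
    have hall : ∀ w, w ∈ L := fun w => hL.mem_iff.2 (by simpa using hρ.2 w)
    have hn' : st'.var 0 = Fintype.card V :=
      (hvar 0 (by simp [refine, forAdj, Prog.vars, splitClass, moveVertex, relink])).trans hn
    have hadj' : HoldsSortedAdj G ρ e st' := hadj.congr
      (harr 1 (by simp [refine, forAdj, Prog.arrs, splitClass, moveVertex, relink]))
      (harr 8 (by simp [refine, forAdj, Prog.arrs, splitClass, moveVertex, relink]))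
    refine RunsWithin.seq_le (runsWithin_refine hR' hvd hn' h4 (hadj' v)
      (hρ.pairwise_reverse.sublist List.filter_sublist) (fun w _ _ => hall w)
      fun w _ => ?_).frame (m' := 4) (by omega) ?_
    · rw [hflag, List.mem_filter]
      simp only [List.mem_reverse, hρ.2 w, true_and, decide_eq_true_eq, LeftAdj]
      refine and_congr_right fun hvw => ?_
      -- for adjacent vertices, the orders `π` and `β.reverse` agree
      rw [← hC.idxOf_lt_iff hB hvw, hβ.idxOf_reverse_lt, hd, hO.mem_left]
    · rintro st₁ ⟨⟨L₁, hL₁, hR₁⟩, hvar₁, harr₁⟩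
      have h4₁ : st₁.var 4 = (e v : ℕ) :=
        (hvar₁ 4 (by simp [refine, forAdj, Prog.vars, splitClass, moveVertex, relink])).trans h4
      have h17₁ : st₁.arr 17 = st'.arr 17 :=
        harr₁ 17 (by simp [refine, forAdj, Prog.arrs, splitClass, moveVertex, relink])
      refine .of_exec trivial (by simp [Prog.maxCost, Expr.cost]) ⟨⟨L₁, hL₁.trans hL, ?_⟩, ?_⟩
      · exact hR₁.congr (by simp [Prog.exec]) (by simp [Prog.exec])
      · intro x
        simp only [Prog.exec, Expr.eval, Store.setArr_arr, if_true, h4₁, h17₁, List.mem_append,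
          List.mem_singleton]
        by_cases hxv : x = v
        · simp [hxv]
        · rw [Function.update_of_ne (mt num_inj.1 hxv), hflag]
          simp [hxv]

/-- Write the order of the partition, in which the start vertex is moved to the leftmost position,
into the array `6` from right to left. -/
def writeTieBreak : Prog :=
  .seq (.seq (.assign 6 (.pred (.var 0)))
      (.seq (.write 6 (.var 6) (.var 1)) (.assign 4 (.read 10 (.var 0)))))
    (.loop (.lt (.var 4) (.var 0))
      (.seq (.ite (.eq (.var 4) (.var 1)) .skip
          (.seq (.assign 6 (.pred (.var 6))) (.write 6 (.var 6) (.var 4))))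
        (.assign 4 (.read 10 (.var 4)))))

theorem runsWithin_writeTieBreak {st : Store} {L : List V} (hL : IsVertexOrder L)
    (hlink : DoublyLinked (st.arr 10) (st.arr 11) (Fintype.card V) (Fintype.card V + 1)
      (L.map fun x => (e x : ℕ)))
    (hn : st.var 0 = Fintype.card V) (h1 : st.var 1 = (e s : ℕ)) :
    RunsWithin writeTieBreak st (40 * (Fintype.card V + 1)) fun st' =>
      HoldsList e st' 6 (s :: L.filter fun x => x ≠ s).reverse := by
  have hlen := hL.length_eq
  have hpos : 0 < Fintype.card V := Fintype.card_pos_iff.2 ⟨s⟩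
  have hlenF : ∀ d t, L = d ++ t → (s :: d.filter fun x => x ≠ s).length +
      (t.filter fun x => x ≠ s).length = Fintype.card V := by
    intro d t hd
    have hperm : (s :: L.filter fun x => x ≠ s).Perm L := by
      have h2 := List.perm_cons_erase (hL.2 s)
      rw [hL.1.erase_eq_filter, List.filter_congr (q := fun x => decide (x ≠ s)) fun x _ => ?_] at h2
      · exact h2.symm
      · by_cases hx : x = s <;> simp [hx]
    rw [← hlen, ← hperm.length_eq, hd, List.filter_append, List.length_cons, List.length_cons,
      List.length_append]
    omega
  have hloop := RunsWithin.loop_list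
    (st := ((st.setVar 6 (Fintype.card V - 1)).setArr 6 (Fintype.card V - 1) (e s)).setVar 4
      (st.arr 10 (Fintype.card V))) (b := .lt (.var 4) (.var 0))
    (p := .seq (.ite (.eq (.var 4) (.var 1)) .skip
          (.seq (.assign 6 (.pred (.var 6))) (.write 6 (.var 6) (.var 4))))
        (.assign 4 (.read 10 (.var 4)))) L (fun _ => 20)
    (I := fun d st' => HoldsQueue e st' 6 (s :: d.filter fun x => x ≠ s) ∧
      st'.var 4 = st.arr 10 (lastFrom (Fintype.card V) (d.map fun x => (e x : ℕ))) ∧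
      st'.arr 10 = st.arr 10 ∧ st'.var 0 = Fintype.card V ∧ st'.var 1 = (e s : ℕ)) ?_ ?_ ?_ ?_
  · refine RunsWithin.seq_le (m := 10) (m' := 24 * Fintype.card V + 4)
      (Q := (· = ((st.setVar 6 (Fintype.card V - 1)).setArr 6 (Fintype.card V - 1) (e s)).setVar 4
        (st.arr 10 (Fintype.card V))))
      (.of_exec ⟨trivial, trivial, trivial⟩ (by simp [Prog.maxCost, Expr.cost]) ?_) (by omega) ?_
    · simp [Prog.exec, Expr.eval, hn, h1]
    rintro _ rfl
    refine hloop.mono ?_ fun st' h => h.1.holdsList (by simpa using hlenF L [] (by simp))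
    simp only [hlen, List.map_const', List.sum_replicate, smul_eq_mul, Test.cost, Expr.cost]
    omega
  · rintro d v t st' hd ⟨-, h4, -, h0, -⟩
    have h2 := hlink.next
    rw [hd, List.map_append, List.append_assoc, linked_append] at h2
    have h3 := h2.2.1
    simp only [Test.Holds, Expr.eval, h4, h3, h0]
    exact (e v).2
  · rintro st' ⟨-, h4, -, h0, -⟩
    have h2 := hlink.next
    rw [linked_append] at h2
    have h3 := h2.2.1
    simp only [Test.Holds, Expr.eval, h4, h3, h0]
    omega
  · rintro d v t st' hd ⟨hQ, h4, h10, h0, h1'⟩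
    have h2 := hlink.next
    rw [hd, List.map_append, List.append_assoc, linked_append] at h2
    rw [h2.2.1] at h4
    beta_reduce at h4
    refine RunsWithin.of_exec ?_ ?_ ?_
    · exact ⟨⟨trivial, trivial, trivial⟩, trivial⟩
    · simp [Prog.maxCost, Test.cost, Expr.cost]
    have hlast : lastFrom (Fintype.card V) ((d ++ [v]).map fun x => (e x : ℕ)) = e v := by
      simp [lastFrom_append, lastFrom]
    simp only [Prog.exec, Test.Holds, Expr.eval, h4, h1', num_inj, hlast]
    by_cases hvs : v = s
    · rw [if_pos hvs, List.filter_append]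
      refine ⟨?_, by simp [h4, h10], by simpa using h10, by simpa using h0, by simpa using h1'⟩
      have h5 : (d.filter fun x => x ≠ s) ++ ([v].filter fun x => x ≠ s) =
          d.filter fun x => x ≠ s := by simp [hvs]
      rw [h5]
      exact hQ
    · rw [if_neg hvs, List.filter_append]
      refine ⟨?_, by simp [h4, h10], by simpa using h10, by simpa using h0, by simpa using h1'⟩
      have h5 := hQ.append (w := v) ?_
      · have h6 : ([v].filter fun x => x ≠ s) = [v] := by simp [hvs]
        rw [h6]
        rw [← h4] at h5
        exact h5
      · have := hlenF d (v :: t) hd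
        rw [List.filter_cons_of_pos (by simpa using hvs), List.length_cons (as := t.filter _)] at this
        omega
  · refine ⟨⟨by simp, fun k hk => ?_⟩, by simp [lastFrom], by simp, hn, h1⟩
    obtain rfl : k = 0 := by simpa using hk
    simp

end

end RAM

/-! ### The algorithm on the machine -/

namespace RAM

/-- The algorithm as a program: sort the adjacency lists, compute the order `π` and the parents in the
last-in tree, search the tree to obtain `β`, compute `τ` by partition refinement, and search the tree
to obtain `σ`. -/
def mainProg : Prog :=
  .seq (.seq (.seq sortAdj (initPartition 0)) (.seq lexBFSLoop findParents))
    (.seq (.seq bfsTree (initPartition 1)) (.seq (.seq orderingLoop writeTieBreak) dfsTree))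

variable {V : Type*} [Fintype V] [DecidableEq V] {G : SimpleGraph V} [DecidableRel G.Adj] {s : V}
  {ρ : List V} {e : V ≃ Fin (Fintype.card V)}

theorem HoldsList.congr {V : Type*} [Fintype V] {e : V ≃ Fin (Fintype.card V)} {st st' : Store}
    {a : ℕ} {l : List V} (h : HoldsList e st a l) (ha : st'.arr a = st.arr a) :
    HoldsList e st' a l := fun i hi => by rw [ha, h i hi]

theorem HoldsParents.congr {V : Type*} [Fintype V] [DecidableEq V] {G : SimpleGraph V}
    [DecidableRel G.Adj] {e : V ≃ Fin (Fintype.card V)} {s : V} {π : List V} {st st' : Store}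
    (h : HoldsParents G e s π st) (ha : st'.arr 4 = st.arr 4) : HoldsParents G e s π st' := by
  unfold HoldsParents
  rwa [ha]

theorem runsWithin_mainProg (h : IsValidInput G s ρ) {st : Store} (hst : HoldsInput G s ρ e st) :
    RunsWithin mainProg st (1220 * (Fintype.card V + G.edgeFinset.card + 1)) fun st' =>
      ∃ π β τ σ, IsRun G s ρ π β τ σ ∧ HoldsRun G π β τ σ e st' := by
  have hC := isCliqueOrder_lexBFS_plus h
  set π := lexBFS.plus G s ρ with hπ
  choose N hN1 hN2 hN3 hN4 using hst.adj
  have hN : IsAdjLists G N := fun v => ⟨hN1 v, hN2 v⟩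
  have hadj : ∀ v, HoldsAdj e st 2 v (N v) := fun v => ⟨hN3 v, hN4 v⟩
  have hm : ∃ m, m = Fintype.card V + G.edgeFinset.card + 1 := ⟨_, rfl⟩
  obtain ⟨m, hm⟩ := hm
  have hcard : Fintype.card V + 1 ≤ m := by omega
  rw [← hm]
  -- the input is preserved, and the sorted adjacency lists are available, in all phases
  let Inp : Store → Prop := fun st' => st'.var 0 = Fintype.card V ∧ st'.var 1 = (e s : ℕ) ∧
    HoldsList e st' 0 ρ ∧ (∀ v, HoldsAdj e st' 2 v (N v)) ∧ HoldsSortedAdj G ρ e st'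
  have hInp : ∀ {st₁ st₂ : Store}, Inp st₁ → st₂.var 0 = st₁.var 0 → st₂.var 1 = st₁.var 1 →
      st₂.arr 0 = st₁.arr 0 → st₂.arr 1 = st₁.arr 1 → st₂.arr 2 = st₁.arr 2 →
      st₂.arr 8 = st₁.arr 8 → Inp st₂ := fun h' v0 v1 a0 a1 a2 a8 =>
    ⟨v0.trans h'.1, v1.trans h'.2.1, h'.2.2.1.congr a0, fun v => (h'.2.2.2.1 v).congr a1 a2,
      h'.2.2.2.2.congr a1 a8⟩
  refine RunsWithin.seq_le (m := 570 * m) (m' := 650 * m)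
    (Q := fun st' => Inp st' ∧ HoldsList e st' 3 π ∧ HoldsParents G e s π st') ?_ (by omega) ?_
  · refine RunsWithin.seq_le (m := 170 * m) (m' := 400 * m)
      (Q := fun st' => Inp st' ∧ HoldsRefinement e st' ρ [] G.Adj ρ.reverse ∧
        ∀ v, st'.arr 17 (e v) = 0) ?_ (by omega) ?_
    · refine RunsWithin.seq_le (m := 110 * m) (m' := 60 * m) (Q := Inp) ?_ (by omega) ?_
      · refine (runsWithin_sortAdj h.order hst.order hst.size hN hadj).frame.mono (by rw [hm]) ?_
        rintro st₁ ⟨h8, hvar, harr⟩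
        have v0 := hvar 0 (by decide)
        have v1 := hvar 1 (by decide)
        exact ⟨v0.trans hst.size, v1.trans hst.start, hst.order.congr (harr 0 (by decide)),
          fun v => (hadj v).congr (harr 1 (by decide)) (harr 2 (by decide)), h8⟩
      · intro st₁ h₁
        refine (runsWithin_initPartition 0 h.order h₁.2.2.1 h₁.1 G.Adj).frame.mono (by omega) ?_
        rintro st₂ ⟨h₂, hvar, harr⟩
        exact ⟨hInp h₁ (hvar 0 (by decide)) (hvar 1 (by decide)) (harr 0 (by decide))
          (harr 1 (by decide)) (harr 2 (by decide)) (harr 8 (by decide)), h₂⟩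
    · rintro st₁ ⟨h₁, hR, h17⟩
      refine RunsWithin.seq_le (m := 300 * m) (m' := 100 * m)
        (Q := fun st' => Inp st' ∧ HoldsList e st' 3 π) ?_ (by omega) ?_
      · refine (runsWithin_lexBFSLoop h hR h17 h₁.1 h₁.2.2.2.2).frame.mono (by rw [hm]) ?_
        rintro st₂ ⟨h₂, hvar, harr⟩
        exact ⟨hInp h₁ (hvar 0 (by decide)) (hvar 1 (by decide)) (harr 0 (by decide))
          (harr 1 (by decide)) (harr 2 (by decide)) (harr 8 (by decide)), h₂⟩
      · rintro st₂ ⟨h₂, h3⟩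
        refine (runsWithin_findParents hC.order hC.start h3 h₂.1 h₂.2.1 hN
          h₂.2.2.2.1).frame.mono (by rw [hm]) ?_
        rintro st₃ ⟨h₃, hvar, harr⟩
        exact ⟨hInp h₂ (hvar 0 (by decide)) (hvar 1 (by decide)) (harr 0 (by decide))
          (harr 1 (by decide)) (harr 2 (by decide)) (harr 8 (by decide)),
          h3.congr (harr 3 (by decide)), h₃⟩
  · rintro st₃ ⟨h₃, h3, h4⟩
    refine RunsWithin.seq_le (m := 210 * m) (m' := 440 * m)
      (Q := fun st' => Inp st' ∧ HoldsList e st' 3 π ∧ HoldsParents G e s π st' ∧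
        (∃ β, bfs.IsSearchOrder (lastInTree G π) s β.reverse ∧ HoldsList e st' 5 β) ∧
        HoldsRefinement e st' ρ [] (LeftAdj G π) ρ.reverse ∧ ∀ v, st'.arr 17 (e v) = 1)
      ?_ (by omega) ?_
    · refine RunsWithin.seq_le (m := 150 * m) (m' := 60 * m)
        (Q := fun st' => Inp st' ∧ HoldsList e st' 3 π ∧ HoldsParents G e s π st' ∧
        ∃ β, bfs.IsSearchOrder (lastInTree G π) s β.reverse ∧ HoldsList e st' 5 β) ?_ (by omega) ?_
      · refine (runsWithin_bfsTree hC h4 h₃.1 h₃.2.1 hN h₃.2.2.2.1).frame.mono (by rw [hm]) ?_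
        rintro st₄ ⟨h₄, hvar, harr⟩
        exact ⟨hInp h₃ (hvar 0 (by decide)) (hvar 1 (by decide)) (harr 0 (by decide))
          (harr 1 (by decide)) (harr 2 (by decide)) (harr 8 (by decide)),
          h3.congr (harr 3 (by decide)), h4.congr (harr 4 (by decide)), h₄⟩
      · rintro st₄ ⟨h₄, h3₄, h4₄, β, hβ, h5⟩
        refine (runsWithin_initPartition 1 h.order h₄.2.2.1 h₄.1 (LeftAdj G π)).frame.mono
          (by omega) ?_
        rintro st₅ ⟨h₅, hvar, harr⟩
        exact ⟨hInp h₄ (hvar 0 (by decide)) (hvar 1 (by decide)) (harr 0 (by decide))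
          (harr 1 (by decide)) (harr 2 (by decide)) (harr 8 (by decide)),
          h3₄.congr (harr 3 (by decide)), h4₄.congr (harr 4 (by decide)),
          ⟨β, hβ, h5.congr (harr 5 (by decide))⟩, h₅⟩
    · rintro st₅ ⟨h₅, h3₅, h4₅, ⟨β, hβ, h5⟩, hR, h17⟩
      have hB := hC.isTopological_of_bfs hβ
      have hrun : IsRun G s ρ π β _ _ := ⟨rfl, hβ, rfl, rfl⟩
      obtain ⟨W, hW, hτ, hL, -⟩ := hrun.exists_tieBreakOrder h
      have hβO := hB.order.reverse
      rw [List.reverse_reverse] at hβO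
      have hW' := hW
      rw [← List.reverse_reverse β] at hW'
      refine RunsWithin.seq_le (m := 340 * m) (m' := 100 * m)
        (Q := fun st' => Inp st' ∧ HoldsList e st' 3 π ∧ HoldsParents G e s π st' ∧
          HoldsList e st' 5 β ∧ HoldsList e st' 6 (s :: W).reverse) ?_ (by omega) ?_
      · refine RunsWithin.seq_le (m := 300 * m) (m' := 40 * m)
          (Q := fun st' => Inp st' ∧ HoldsList e st' 3 π ∧ HoldsParents G e s π st' ∧
            HoldsList e st' 5 β ∧
            ∃ L, L.Perm ρ.reverse ∧ HoldsRefinement e st' ρ β (LeftAdj G π) L) ?_ (by omega) ?_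
        · refine (runsWithin_orderingLoop hC h.order hB h5 hR h17 h₅.1 h₅.2.2.2.2).frame.mono
            (by rw [hm]) ?_
          rintro st₆ ⟨h₆, hvar, harr⟩
          exact ⟨hInp h₅ (hvar 0 (by decide)) (hvar 1 (by decide)) (harr 0 (by decide))
            (harr 1 (by decide)) (harr 2 (by decide)) (harr 8 (by decide)),
            h3₅.congr (harr 3 (by decide)), h4₅.congr (harr 4 (by decide)),
            h5.congr (harr 5 (by decide)), h₆⟩
        · rintro st₆ ⟨h₆, h3₆, h4₆, h5₆, L, hLρ, hRL⟩
          have hLO : IsVertexOrder L := ⟨hLρ.nodup_iff.2 h.order.reverse.1,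
            fun v => hLρ.mem_iff.2 (h.order.reverse.2 v)⟩
          have hWL := (hRL.isTieBreakOrder hLO hβO (s := s)).eq hW
          refine (runsWithin_writeTieBreak hLO hRL.partition.linked h₆.1 h₆.2.1).frame.mono
            (by omega) ?_
          rintro st₇ ⟨h₇, hvar, harr⟩
          rw [hWL] at h₇
          exact ⟨hInp h₆ (hvar 0 (by decide)) (hvar 1 (by decide)) (harr 0 (by decide))
            (harr 1 (by decide)) (harr 2 (by decide)) (harr 8 (by decide)),
            h3₆.congr (harr 3 (by decide)), h4₆.congr (harr 4 (by decide)),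
            h5₆.congr (harr 5 (by decide)), h₇⟩
      · rintro st₇ ⟨h₇, h3₇, h4₇, h5₇, h6₇⟩
        refine (runsWithin_dfsTree hC hB hW' h4₇ h₇.1 h₇.2.1 h6₇).frame.mono (by omega) ?_
        rintro st₈ ⟨h₈, hvar, harr⟩
        refine ⟨π, β, _, _, hrun, h3₇.congr (harr 3 (by decide)), fun v w hvw => ?_,
          h5₇.congr (harr 5 (by decide)), ?_, ?_⟩
        · rw [harr 4 (by decide)]
          exact h4₇.1 v w hvw
        · rw [hτ]
          exact h6₇.congr (harr 6 (by decide))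
        · rw [hτ, hC.dfs_plus_eq (B := β.reverse) hW' (hC.isTreeOrder hB hW')]
          exact h₈

end RAM

theorem mainTheorem1 :
    -- the algorithm is correct: it has a run on every input, and the result of each run is
    -- the `LexDFS⁺(ρ)` order, which is a vertex order starting at `s`
    (∀ (V : Type*) [Fintype V] [DecidableEq V] (G : SimpleGraph V) [DecidableRel G.Adj]
      (s : V) (ρ : List V), IsValidInput G s ρ →
        (∃ π β τ σ : List V, IsRun G s ρ π β τ σ) ∧
        ∀ π β τ σ : List V, IsRun G s ρ π β τ σ →
          σ = lexDFS.plus G s ρ ∧ IsVertexOrder σ ∧ σ.head? = some s) ∧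
    -- the algorithm can be carried out in linear time on a random access machine
    (∃ (P : RAM.Prog) (c : ℕ),
      ∀ (V : Type*) [Fintype V] [DecidableEq V] (G : SimpleGraph V) [DecidableRel G.Adj]
        (s : V) (ρ : List V), IsValidInput G s ρ →
        ∀ (e : V ≃ Fin (Fintype.card V)) (st : RAM.Store), RAM.HoldsInput G s ρ e st →
          ∃ (t : ℕ) (st' : RAM.Store) (π β τ σ : List V),
            RAM.Runs P st t st' ∧ t ≤ c * (Fintype.card V + G.edgeFinset.card) ∧
            IsRun G s ρ π β τ σ ∧ RAM.HoldsRun G π β τ σ e st') := by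
  refine ⟨fun V _ _ G _ s ρ h => ⟨exists_isRun h, fun π β τ σ hr => hr.eq_lexDFS_plus h⟩,
    RAM.mainProg, 2440, fun V _ _ G _ s ρ h e st hst => ?_⟩
  obtain ⟨t, ht, st', hr, π, β, τ, σ, hrun, hhold⟩ := RAM.runsWithin_mainProg h hst
  have hpos : 0 < Fintype.card V := Fintype.card_pos_iff.2 ⟨s⟩
  exact ⟨t, st', π, β, τ, σ, hr, by omega, hrun, hhold⟩
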